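/- **Setting.** Let $L$ be a free abelian group of finite rank with a $\mathbb Z$-valued nondegenerate symmetric bilinear form $(\cdot|\cdot)$, extended to $\mathfrak h=\mathbb C\otimes_{\mathbb Z}L$, and let $\varepsilon:L\times L\to\{\pm1\}$ be bi-multiplicative. Put $V_L=S\otimes\mathbb C_\varepsilon[L]$, where $S$ is the symmetric algebra of $\bigoplus_{n>0}\mathfrak h s^{-n}$ and $\mathbb C_\varepsilon[L]$ has basis $\{e^\beta\}_{\beta\in L}$. For $h\in\mathfrak h$ and $n>0$ let $h_{(-n)}$ be multiplication by $hs^{-n}$, let $h_{(0)}(g\otimes e^\beta)=(h|\beta)\,g\otimes e^\beta$, and let $h_{(n)}$ act on $S$ as the derivation with $h_{(n)}(h's^{-k})=n\,\delta_{n,k}(h|h')$. Let $e^\alpha(g\otimes e^\beta)=\varepsilon(\alpha,\beta)\,g\otimes e^{\alpha+\beta}$, $h(z)=\sum_{m\in\mathbb Z}h_{(-m)}z^{m-1}$, and $$E^\alpha(z)=e^\alpha z^{\alpha_{(0)}}\exp\Big(\sum_{n>0}\alpha_{(-n)}\tfrac{z^n}{n}\Big)\exp\Big(\sum_{n<0}\alpha_{(-n)}\tfrac{z^n}{n}\Big).$$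 The state-field correspondence is the linear map with $$Y(h_1s^{-m_1-1}\cdots h_ks^{-m_k-1}\otimes e^\alpha,z)=\tfrac1{m_1!\cdots m_k!}:\partial_z^{m_1}h_1(z)\cdots\partial_z^{m_k}h_k(z)E^\alpha(z):\qquad(m_i\ge0),$$ where the normally ordered product is expanded from right to left by $:H(z)A(z):\;=H(z)_{\ge0}A(z)+A(z)H(z)_{<0}$, the subscripts denoting the parts of $H(z)$ with nonnegative and with negative powers of $z$. Write $Y(a,z)=\sum_{m\in\mathbb Z}a_{(m)}z^{-m-1}$ with $a_{(m)}\in\operatorname{End}_{\mathbb C}(V_L)$. Let $\ell,r\ge 0$ be integers and $\Gamma=Q\oplus R$, where $Q=\bigoplus_{i=1}^{\ell}\mathbb Zv_i$ and $R=\bigoplus_{\nu=1}^{r}(\mathbb Z\vartheta_\nu\oplus\mathbb Z\Theta_\nu)$, with the symmetric form given by $(v_i|v_j)=\delta_{ij}$, $(\vartheta_\nu|\Theta_\mu)=\delta_{\nu\mu}$, and $(v_i|\vartheta_\nu)=(v_i|\Theta_\mu)=(\vartheta_\nu|\vartheta_\mu)=(\Theta_\nu|\Theta_\mu)=0$. Let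 $\varepsilon:\Gamma\times\Gamma\to\{\pm1\}$ be a bi-multiplicative function with $\varepsilon(v_i,v_j)=\epsilon_{ij}$, where $\epsilon_{ij}=1$ for $i<j$ and $\epsilon_{ij}=-1$ for $i\ge j$; $\varepsilon(\vartheta_\nu,\Theta_\mu)=(-1)^{\delta_{\nu\mu}}$; $\varepsilon(\vartheta_\nu,\vartheta_\mu)=\varepsilon(\Theta_\nu,\Theta_\mu)=1$; and $\varepsilon(v,\eta)=\varepsilon(\eta,v)=1$ for $v\in Q$, $\eta\in R$. The signs $\varepsilon(\Theta_\mu,\vartheta_\nu)$ are arbitrary; the choice $\varepsilon(\Theta_\mu,\vartheta_\nu)=1$ is the one for which $\varepsilon(\alpha,\beta)\varepsilon(\beta,\alpha)=(-1)^{(\alpha|\beta)+(\alpha|\alpha)(\beta|\beta)}$ on $\Gamma$. For $\mathbf p\in\mathbb Z^r$ put $\mathbf p\cdot\boldsymbol\vartheta=\sum_{\nu}p_\nu\vartheta_\nu$. In $\operatorname{End}(V_\Gamma)$ consider the modes, for $1\le i\le\ell-1$, $1\le k\ne l\le\ell$, $m\in\mathbb Z$ and $\mathbf p\in\mathbb Z^r$,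 $$h^{\mathbf p}_{i,m}=\big((v_i-v_{i+1})s^{-1}\otimes e^{\mathbf p\cdot\boldsymbol\vartheta}\big)_{(m)},\qquad e^{\mathbf p}_{kl,m}=\epsilon_{lk}\big(1\otimes e^{v_k-v_l+\mathbf p\cdot\boldsymbol\vartheta}\big)_{(m)},$$ $$\kappa^{\mathbf p}_{0,m}=\big(1\otimes e^{\mathbf p\cdot\boldsymbol\vartheta}\big)_{(m-1)},\qquad \kappa^{\mathbf p}_{\nu,m}=\big(\vartheta_\nu s^{-1}\otimes e^{\mathbf p\cdot\boldsymbol\vartheta}\big)_{(m)}\quad(1\le\nu\le r).$$ **Proposition.** For all $m,n\in\mathbb Z$, $\mathbf p,\mathbf q\in\mathbb Z^r$, $1\le i,j\le\ell-1$ and $k,l,k',l'\in\{1,\dots,\ell\}$ with $k\ne l$ and $k'\ne l'$: $$[h^{\mathbf p}_{i,m},h^{\mathbf q}_{j,n}]=(2\delta_{i,j}-\delta_{i,j+1}-\delta_{i+1,j})\Big(m\,\kappa^{\mathbf p+\mathbf q}_{0,m+n}+\sum_{\nu=1}^rp_\nu\kappa^{\mathbf p+\mathbf q}_{\nu,m+n}\Big),$$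 $$[h^{\mathbf p}_{i,m},e^{\mathbf q}_{kl,n}]=(\delta_{i,k}+\delta_{i+1,l}-\delta_{i,l}-\delta_{i+1,k})\,e^{\mathbf p+\mathbf q}_{kl,m+n},$$ $$[e^{\mathbf p}_{kl,m},e^{\mathbf q}_{k'l',n}]=\begin{cases}\big((v_k-v_l)s^{-1}\otimes e^{(\mathbf p+\mathbf q)\cdot\boldsymbol\vartheta}\big)_{(m+n)}+m\,\kappa^{\mathbf p+\mathbf q}_{0,m+n}+\sum_{\nu=1}^rp_\nu\kappa^{\mathbf p+\mathbf q}_{\nu,m+n},&k=l',\ l=k',\\ e^{\mathbf p+\mathbf q}_{kl',m+n},&k\ne l',\ l=k',\\ -e^{\mathbf p+\mathbf q}_{k'l,m+n},&k=l',\ l\ne k',\\ 0,&\text{otherwise},\end{cases}$$ and, for every $0\le\nu\le r$ and every element $a$ among the $h^{\mathbf q}_{j,n}$, $e^{\mathbf q}_{kl,n}$ and $\kappa^{\mathbf q}_{\mu,n}$ $(0\le\mu\le r)$, $$[\kappa^{\mathbf p}_{\nu,m},a]=0.$$ -/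

import Mathlib

open scoped TensorProduct
noncomputable section
namespace LatticeVA

section SymmetricAlgebraTools
variable {M : Type*} [AddCommGroup M] [Module ℂ M]

/-- The algebra homomorphism from `Sym M` to a possibly noncommutative algebra induced by a linear
map with pairwise commuting values. -/
def symLift {A : Type*} [Ring A] [Algebra ℂ A] (f : M →ₗ[ℂ] A)
    (hf : ∀ x y, f x * f y = f y * f x) : SymmetricAlgebra ℂ M →ₐ[ℂ] A :=
  have hc : IsMulCommutative (Algebra.adjoin ℂ (Set.range f)) :=
    Algebra.isMulCommutative_adjoin ℂ (by rintro _ ⟨x, rfl⟩ _ ⟨y, rfl⟩; exact hf x y)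
  letI : CommSemiring (Algebra.adjoin ℂ (Set.range f)) :=
    { (Algebra.adjoin ℂ (Set.range f)).toSemiring with mul_comm := hc.is_comm.comm }
  (Algebra.adjoin ℂ (Set.range f)).val.comp
    (SymmetricAlgebra.lift
      (f.codRestrict (Subalgebra.toSubmodule (Algebra.adjoin ℂ (Set.range f)))
        fun x => Algebra.subset_adjoin ⟨x, rfl⟩))

theorem symLift_ι {A : Type*} [Ring A] [Algebra ℂ A] (f : M →ₗ[ℂ] A)
    (hf : ∀ x y, f x * f y = f y * f x) (x : M) :
    symLift f hf (SymmetricAlgebra.ι ℂ M x) = f x := by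
  have hc : IsMulCommutative (Algebra.adjoin ℂ (Set.range f)) :=
    Algebra.isMulCommutative_adjoin ℂ (by rintro _ ⟨x, rfl⟩ _ ⟨y, rfl⟩; exact hf x y)
  let _ : CommSemiring (Algebra.adjoin ℂ (Set.range f)) :=
    { (Algebra.adjoin ℂ (Set.range f)).toSemiring with mul_comm := hc.is_comm.comm }
  unfold symLift
  simp only [AlgHom.comp_apply, SymmetricAlgebra.lift_ι_apply]
  rfl

/-- The derivation of `Sym M` that extends a linear functional on `M`. -/
def contraction (f : M →ₗ[ℂ] ℂ) :
    Derivation ℂ (SymmetricAlgebra ℂ M) (SymmetricAlgebra ℂ M) :=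
  let S := SymmetricAlgebra ℂ M
  let F : S →ₐ[ℂ] TrivSqZeroExt S S := SymmetricAlgebra.lift
    ((TrivSqZeroExt.inlAlgHom ℂ S S).toLinearMap ∘ₗ SymmetricAlgebra.ι ℂ M +
      (TrivSqZeroExt.inrHom S S).restrictScalars ℂ ∘ₗ Algebra.linearMap ℂ S ∘ₗ f)
  have hF : ∀ x, (F x).fst = x := fun x => by
    have : (TrivSqZeroExt.fstHom ℂ S S).comp F = AlgHom.id ℂ S := by
      apply SymmetricAlgebra.algHom_ext
      ext x
      simp [F, S]
    exact DFunLike.congr_fun this x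
  Derivation.mk' ((TrivSqZeroExt.sndHom S S).restrictScalars ℂ ∘ₗ F.toLinearMap) fun a b => by
    simp [hF, mul_comm]

theorem contraction_ι (f : M →ₗ[ℂ] ℂ) (x : M) :
    contraction f (SymmetricAlgebra.ι ℂ M x) = algebraMap ℂ _ (f x) := by
  simp [contraction, Algebra.algebraMap_eq_smul_one]

theorem derivation_ext {D D' : Derivation ℂ (SymmetricAlgebra ℂ M) (SymmetricAlgebra ℂ M)}
    (h : ∀ x, D (SymmetricAlgebra.ι ℂ M x) = D' (SymmetricAlgebra.ι ℂ M x)) : D = D' := by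
  ext a
  induction a using SymmetricAlgebra.induction with
  | algebraMap r => simp
  | ι x => exact h x
  | mul a b ha hb => simp [ha, hb]
  | add a b ha hb => simp [ha, hb]

theorem contraction_comm (f g : M →ₗ[ℂ] ℂ) (a : SymmetricAlgebra ℂ M) :
    contraction f (contraction g a) = contraction g (contraction f a) := by
  have : ⁅contraction f, contraction g⁆ = 0 :=
    derivation_ext fun x => by simp [Derivation.commutator_apply, contraction_ι]
  have h := DFunLike.congr_fun this a
  rw [Derivation.commutator_apply] at h
  simpa [sub_eq_zero] using h

/-- `contraction` as a linear map into the endomorphisms of `Sym M`. -/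
def contractionHom : (M →ₗ[ℂ] ℂ) →ₗ[ℂ] Module.End ℂ (SymmetricAlgebra ℂ M) where
  toFun f := (contraction f).toLinearMap
  map_add' f g := by
    have : contraction (f + g) = contraction f + contraction g :=
      derivation_ext fun x => by simp [contraction_ι]
    rw [this]; rfl
  map_smul' c f := by
    have : contraction (c • f) = c • contraction f :=
      derivation_ext fun x => by simp [contraction_ι, Algebra.smul_def]
    rw [this]; rfl

end SymmetricAlgebraTools

/-- `exp (a)` for a formal power series `a` without constant term, over any `ℂ`-algebra. -/
def formalExp {A : Type*} [Ring A] [Algebra ℂ A] (a : PowerSeries A) : PowerSeries A :=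
  PowerSeries.mk fun n =>
    ∑ k ∈ Finset.range (n + 1), ((k.factorial : ℂ)⁻¹) • PowerSeries.coeff n (a ^ k)

section States
variable (L : Type*) [AddCommGroup L]

/-- `𝔥 = ℂ ⊗ L`. -/
abbrev Cartan := ℂ ⊗[ℤ] L

/-- `𝔥^{<0} = ⊕_{n ≥ 0} 𝔥 s^{-n-1}`; the element `h s^{-n-1}` is `Finsupp.single n h`. -/
abbrev NegPart := ℕ →₀ Cartan L

/-- The symmetric algebra of `𝔥^{<0}`. -/
abbrev Fock := SymmetricAlgebra ℂ (NegPart L)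

/-- The space of states `S ⊗ ℂ[L]`; the basis vector `e^β` of `ℂ[L]` is `Finsupp.single β 1`. -/
abbrev StateSpace := Fock L ⊗[ℂ] (L →₀ ℂ)

variable {L}

/-- The vector `h s^{-n-1}` of `Sym (𝔥^{<0})`. -/
def negGen (n : ℕ) : Cartan L →ₗ[ℂ] Fock L :=
  SymmetricAlgebra.ι ℂ (NegPart L) ∘ₗ Finsupp.lsingle n

/-- `g ⊗ e^β`. -/
def stateOf (g : Fock L) (β : L) : StateSpace L := g ⊗ₜ[ℂ] Finsupp.single β 1

/-- The vector of `𝔥` that corresponds to a lattice vector. -/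
def toCartan (α : L) : Cartan L := 1 ⊗ₜ[ℤ] α

/-- `h_{(-n-1)}`: multiplication by `h s^{-n-1}`. -/
def creation (n : ℕ) : Cartan L →ₗ[ℂ] Module.End ℂ (StateSpace L) :=
  LinearMap.rTensorHom (L →₀ ℂ) ∘ₗ LinearMap.mul ℂ (Fock L) ∘ₗ negGen n

/-- The derivation `h_{(n+1)}` of `S`: it sends `h' s^{-n-1}` to `(n + 1) (h | h')` and the other
`h' s^{-k-1}` to `0`. -/
def lowering (B : LinearMap.BilinForm ℤ L) (n : ℕ) : Cartan L →ₗ[ℂ] Module.End ℂ (Fock L) :=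
  contractionHom ∘ₗ
    LinearMap.lcomp ℂ ℂ (Finsupp.lapply n) ∘ₗ ((n + 1 : ℂ) • B.baseChange ℂ)

/-- `h_{(n+1)}` on the space of states. -/
def annihilation (B : LinearMap.BilinForm ℤ L) (n : ℕ) :
    Cartan L →ₗ[ℂ] Module.End ℂ (StateSpace L) :=
  LinearMap.rTensorHom (L →₀ ℂ) ∘ₗ lowering B n

/-- The operator on `S ⊗ ℂ[L]` that multiplies `g ⊗ e^β` by `c β`. -/
def diagonal : (L → ℂ) →ₗ[ℂ] Module.End ℂ (StateSpace L) :=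
  LinearMap.lTensorHom (Fock L) ∘ₗ
    { toFun := fun c => Finsupp.lsum ℂ fun β => c β • Finsupp.lsingle β
      map_add' := fun c d => by ext β; simp [add_smul]
      map_smul' := fun a c => by ext β; simp }

/-- `h_{(0)}`: it multiplies `g ⊗ e^β` by `(h | β)`. -/
def zeroMode (B : LinearMap.BilinForm ℤ L) : Cartan L →ₗ[ℂ] Module.End ℂ (StateSpace L) :=
  diagonal ∘ₗ LinearMap.pi fun β => (B.baseChange ℂ).flip (toCartan β)

/-- The operators `h_{(k)}`, `k ∈ ℤ`, on the space of states. -/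
def heisenberg (B : LinearMap.BilinForm ℤ L) : ℤ → Cartan L →ₗ[ℂ] Module.End ℂ (StateSpace L)
  | .negSucc n => creation n
  | .ofNat 0 => zeroMode B
  | .ofNat (n + 1) => annihilation B n

/-- The coefficient of `z^n` in `z^{α_{(0)}}`: the projection onto the `g ⊗ e^β` with
`(α | β) = n`. -/
def zPow (B : LinearMap.BilinForm ℤ L) (α : L) (n : ℤ) : Module.End ℂ (StateSpace L) :=
  diagonal fun β => if B α β = n then 1 else 0

/-- The action `e^α (g ⊗ e^β) = ε(α, β) g ⊗ e^{α + β}`. -/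
def expAct (ε : L → L → ℤˣ) (α : L) : Module.End ℂ (StateSpace L) :=
  LinearMap.lTensor (Fock L)
    (Finsupp.lsum ℂ fun β => ((ε α β : ℤ) : ℂ) • Finsupp.lsingle (α + β))

/-- `exp (∑_{n > 0} α_{(-n)} z^n / n)` as a series in `z`. -/
def expCreation (B : LinearMap.BilinForm ℤ L) (α : L) :
    PowerSeries (Module.End ℂ (StateSpace L)) :=
  formalExp (PowerSeries.mk fun n =>
    if n = 0 then 0 else (n : ℂ)⁻¹ • heisenberg B (-n) (toCartan α))

/-- `exp (∑_{n < 0} α_{(-n)} z^n / n)` as a series in `z⁻¹`. -/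
def expAnnihilation (B : LinearMap.BilinForm ℤ L) (α : L) :
    PowerSeries (Module.End ℂ (StateSpace L)) :=
  formalExp (PowerSeries.mk fun n =>
    if n = 0 then 0 else (-(n : ℂ)⁻¹) • heisenberg B n (toCartan α))

/-! ### Local finiteness of the operators above -/

/-- `Lvl D N x`: every product of the operators `D h n` (counted with weight `n + 1`) of total weight
greater than `N` kills `x`. -/
inductive Lvl {W H : Type*} [AddCommGroup W] [Module ℂ W] (D : H → ℕ → Module.End ℂ W) :
    ℕ → W → Prop
  | mk (N : ℕ) (x : W) (h0 : ∀ h n, N ≤ n → D h n x = 0)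
      (h1 : ∀ h n, n < N → Lvl D (N - (n + 1)) (D h n x)) : Lvl D N x

section Lvl
variable {W H : Type*} [AddCommGroup W] [Module ℂ W] {D : H → ℕ → Module.End ℂ W}

theorem Lvl.zero (N : ℕ) : Lvl D N 0 := by
  induction N using Nat.strong_induction_on with
  | _ N ih =>
    refine .mk N 0 (by simp) fun h n hn => ?_
    rw [map_zero]
    exact ih _ (by omega)

theorem Lvl.mono {N N' : ℕ} {x : W} (h : Lvl D N x) (hN : N ≤ N') : Lvl D N' x := by
  induction h generalizing N' with
  | mk N x h0 h1 ih =>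
    refine .mk N' x (fun h n hn => h0 h n (hN.trans hn)) fun h n hn => ?_
    by_cases hnN : n < N
    · exact ih h n hnN (by omega)
    · rw [h0 h n (by omega)]
      exact .zero _

theorem Lvl.add {N : ℕ} {x y : W} (hx : Lvl D N x) (hy : Lvl D N y) : Lvl D N (x + y) := by
  induction hx generalizing y with
  | mk N x h0 h1 ih =>
    cases hy with
    | mk _ _ g0 g1 =>
      refine .mk N _ (fun h n hn => by simp [h0 h n hn, g0 h n hn]) fun h n hn => ?_
      rw [map_add]
      exact ih h n hn (g1 h n hn)

theorem Lvl.coeff_pow {N : ℕ} {x : W} (hx : Lvl D N x) {h : H} {a : PowerSeries (Module.End ℂ W)}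
    (ha0 : PowerSeries.coeff 0 a = 0)
    (ha : ∀ n, ∃ c : ℂ, PowerSeries.coeff (n + 1) a = c • D h n) (k : ℕ) {n : ℕ} (hn : N < n) :
    PowerSeries.coeff n (a ^ k) x = 0 := by
  induction k generalizing N x n with
  | zero => simp [PowerSeries.coeff_one, show n ≠ 0 by omega]
  | succ k ih =>
    rw [pow_succ, PowerSeries.coeff_mul, LinearMap.sum_apply]
    refine Finset.sum_eq_zero fun ij hij => ?_
    rw [Finset.HasAntidiagonal.mem_antidiagonal] at hij
    obtain ⟨i, j⟩ := ij
    rw [Module.End.mul_apply]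
    cases j with
    | zero => simp only [ha0, LinearMap.zero_apply, map_zero]
    | succ m =>
      obtain ⟨c, hc⟩ := ha m
      cases hx with
      | mk _ _ h0 h1 =>
        simp only [hc, LinearMap.smul_apply, map_smul]
        by_cases hm : m < N
        · rw [ih (h1 h m hm) (by simp only at hij; omega), smul_zero]
        · rw [h0 h m (by omega), map_zero, smul_zero]

theorem Lvl.coeff_formalExp {N : ℕ} {x : W} (hx : Lvl D N x) {h : H}
    {a : PowerSeries (Module.End ℂ W)} (ha0 : PowerSeries.coeff 0 a = 0)
    (ha : ∀ n, ∃ c : ℂ, PowerSeries.coeff (n + 1) a = c • D h n) {n : ℕ} (hn : N < n) :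
    PowerSeries.coeff n (formalExp a) x = 0 := by
  simp only [formalExp, PowerSeries.coeff_mk, LinearMap.sum_apply, LinearMap.smul_apply]
  exact Finset.sum_eq_zero fun k _ => by rw [hx.coeff_pow ha0 ha k hn, smul_zero]

end Lvl

theorem lowering_ι (B : LinearMap.BilinForm ℤ L) (n : ℕ) (h : Cartan L) (x : NegPart L) :
    lowering B n h (SymmetricAlgebra.ι ℂ (NegPart L) x) =
      algebraMap ℂ _ ((n + 1 : ℂ) * B.baseChange ℂ h (x n)) := by
  simp [lowering, contractionHom, contraction_ι]

theorem lowering_mul (B : LinearMap.BilinForm ℤ L) (n : ℕ) (h : Cartan L) (x y : Fock L) :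
    lowering B n h (x * y) = x * lowering B n h y + lowering B n h x * y := by
  simp [lowering, contractionHom, mul_comm]

theorem lowering_algebraMap (B : LinearMap.BilinForm ℤ L) (n : ℕ) (h : Cartan L) (r : ℂ) :
    lowering B n h (algebraMap ℂ (Fock L) r) = 0 := by
  simp [lowering, contractionHom]

theorem lvl_mul (B : LinearMap.BilinForm ℤ L) (N : ℕ) :
    ∀ a b, a + b = N → ∀ x y : Fock L, Lvl (fun h n => lowering B n h) a x →
      Lvl (fun h n => lowering B n h) b y → Lvl (fun h n => lowering B n h) N (x * y) := by
  induction N using Nat.strong_induction_on with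
  | _ N ih =>
    intro a b hab x y hx hy
    obtain ⟨_, _, hx0, hx1⟩ := id hx
    obtain ⟨_, _, hy0, hy1⟩ := id hy
    refine .mk N _ (fun h n hn => ?_) fun h n hn => ?_
    · simp only [lowering_mul]
      rw [hx0 h n (by omega), hy0 h n (by omega), mul_zero, zero_mul, add_zero]
    · simp only [lowering_mul]
      refine .add ?_ ?_
      · by_cases hb : n < b
        · exact ih _ (by omega) a (b - (n + 1)) (by omega) _ _ hx (hy1 h n hb)
        · rw [hy0 h n (by omega), mul_zero]
          exact .zero _
      · by_cases ha : n < a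
        · exact ih _ (by omega) (a - (n + 1)) b (by omega) _ _ (hx1 h n ha) hy
        · rw [hx0 h n (by omega), zero_mul]
          exact .zero _

theorem exists_lvl_fock (B : LinearMap.BilinForm ℤ L) (x : Fock L) :
    ∃ N, Lvl (fun h n => lowering B n h) N x := by
  induction x using SymmetricAlgebra.induction with
  | algebraMap r => exact ⟨0, .mk _ _ (fun h n _ => lowering_algebraMap B n h r) (by simp)⟩
  | ι x =>
    refine ⟨x.support.sup id + 1, .mk _ _ (fun h n hn => ?_) fun h n hn => ?_⟩
    · have : x n = 0 := by
        by_contra hx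
        have := Finset.le_sup (f := id) (Finsupp.mem_support_iff.2 hx)
        simp only [id] at this
        omega
      simp [lowering_ι, this]
    · simp only [lowering_ι]
      exact Lvl.mono (.mk 0 _ (fun h n _ => lowering_algebraMap B n h _) (by simp)) (Nat.zero_le _)
  | mul a b ha hb =>
    obtain ⟨M, ha⟩ := ha
    obtain ⟨N, hb⟩ := hb
    exact ⟨M + N, lvl_mul B _ M N rfl _ _ ha hb⟩
  | add a b ha hb =>
    obtain ⟨M, ha⟩ := ha
    obtain ⟨N, hb⟩ := hb
    exact ⟨max M N, (ha.mono (le_max_left _ _)).add (hb.mono (le_max_right _ _))⟩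

theorem exists_lvl (B : LinearMap.BilinForm ℤ L) (v : StateSpace L) :
    ∃ N, Lvl (fun h n => annihilation B n h) N v := by
  induction v using TensorProduct.induction_on with
  | zero => exact ⟨0, .zero _⟩
  | tmul g b =>
    obtain ⟨N, hN⟩ := exists_lvl_fock B g
    refine ⟨N, ?_⟩
    induction hN with
    | mk N x h0 h1 ih =>
      have key : ∀ h n, annihilation B n h (x ⊗ₜ[ℂ] b) = lowering B n h x ⊗ₜ[ℂ] b :=
        fun h n => by simp [annihilation]
      refine .mk _ _ (fun h n hn => ?_) fun h n hn => ?_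
      · simp only [key]
        rw [h0 h n hn, TensorProduct.zero_tmul]
      · simp only [key]
        exact ih h n hn
  | add a b ha hb =>
    obtain ⟨M, ha⟩ := ha
    obtain ⟨N, hb⟩ := hb
    exact ⟨max M N, (ha.mono (le_max_left _ _)).add (hb.mono (le_max_right _ _))⟩

theorem exists_heisenberg_eq_zero (B : LinearMap.BilinForm ℤ L) (h : Cartan L)
    (v : StateSpace L) : ∃ N : ℕ, ∀ k : ℤ, N < k → heisenberg B k h v = 0 := by
  obtain ⟨N, hN⟩ := exists_lvl B v
  obtain ⟨_, _, h0, -⟩ := hN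
  refine ⟨N, fun k hk => ?_⟩
  obtain ⟨n, rfl⟩ : ∃ n : ℕ, k = Int.ofNat (n + 1) := ⟨(k - 1).toNat, by simp; omega⟩
  exact h0 h n (by simp at hk; omega)

theorem exists_expAnnihilation_eq_zero (B : LinearMap.BilinForm ℤ L) (α : L)
    (v : StateSpace L) : ∃ N : ℕ, ∀ n, N < n → PowerSeries.coeff n (expAnnihilation B α) v = 0 := by
  obtain ⟨N, hN⟩ := exists_lvl B v
  refine ⟨N, fun n hn => hN.coeff_formalExp (h := toCartan α) (by simp) (fun n => ?_) hn⟩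
  exact ⟨-((n + 1 : ℕ) : ℂ)⁻¹, by rw [PowerSeries.coeff_mk, if_neg (Nat.succ_ne_zero n)]; rfl⟩

theorem coeff_formalExp_commute {A : Type*} [Ring A] [Algebra ℂ A] {a : PowerSeries A} {T : A}
    (h : ∀ n, Commute T (PowerSeries.coeff n a)) (n : ℕ) :
    Commute T (PowerSeries.coeff n (formalExp a)) := by
  have hp : ∀ k n, Commute T (PowerSeries.coeff n (a ^ k)) := by
    intro k
    induction k with
    | zero =>
      intro n
      rw [pow_zero, PowerSeries.coeff_one]
      split_ifs
      exacts [.one_right _, .zero_right _]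
    | succ k ih =>
      intro n
      rw [pow_succ, PowerSeries.coeff_mul]
      exact Commute.sum_right _ _ _ fun ij _ => (ih _).mul_right (h _)
  simp only [formalExp, PowerSeries.coeff_mk]
  exact Commute.sum_right _ _ _ fun k _ => (hp k n).smul_right _

theorem diagonal_commute_rTensor (c : L → ℂ) (f : Module.End ℂ (Fock L)) :
    Commute (diagonal c) (LinearMap.rTensor (L →₀ ℂ) f) := by
  rw [commute_iff_eq]
  simp only [diagonal, LinearMap.comp_apply, Module.End.mul_eq_comp, LinearMap.coe_lTensorHom,
    LinearMap.lTensor_comp_rTensor, LinearMap.rTensor_comp_lTensor]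

theorem zPow_commute_expCreation (B : LinearMap.BilinForm ℤ L) (α : L) (n : ℤ) (i : ℕ) :
    Commute (zPow B α n) (PowerSeries.coeff i (expCreation B α)) := by
  refine coeff_formalExp_commute (fun m => ?_) i
  rw [PowerSeries.coeff_mk]
  cases m with
  | zero => simp
  | succ m =>
    rw [if_neg (Nat.succ_ne_zero m)]
    exact Commute.smul_right (diagonal_commute_rTensor _ _) _

theorem zPow_commute_expAnnihilation (B : LinearMap.BilinForm ℤ L) (α : L) (n : ℤ) (i : ℕ) :
    Commute (zPow B α n) (PowerSeries.coeff i (expAnnihilation B α)) := by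
  refine coeff_formalExp_commute (fun m => ?_) i
  rw [PowerSeries.coeff_mk]
  cases m with
  | zero => simp
  | succ m =>
    rw [if_neg (Nat.succ_ne_zero m)]
    exact Commute.smul_right (diagonal_commute_rTensor _ _) _

theorem exists_zPow_eq_zero (B : LinearMap.BilinForm ℤ L) (α : L) (v : StateSpace L) :
    ∃ F : Finset ℤ, ∀ n ∉ F, zPow B α n v = 0 := by
  induction v using TensorProduct.induction_on with
  | zero => exact ⟨∅, by simp⟩
  | tmul g b =>
    refine ⟨b.support.image (B α), fun n hn => ?_⟩
    simp only [zPow, diagonal, LinearMap.comp_apply, LinearMap.coe_mk, AddHom.coe_mk,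
      LinearMap.coe_lTensorHom, LinearMap.lTensor_tmul]
    refine (congrArg (g ⊗ₜ[ℂ] ·) ?_).trans (TensorProduct.tmul_zero (L →₀ ℂ) g)
    rw [Finsupp.lsum_apply]
    refine Finset.sum_eq_zero fun β hβ => ?_
    have : B α β ≠ n := fun h => hn (Finset.mem_image.2 ⟨β, hβ, h⟩)
    simp [this]
  | add a b ha hb =>
    obtain ⟨F, ha⟩ := ha
    obtain ⟨G, hb⟩ := hb
    refine ⟨F ∪ G, fun n hn => ?_⟩
    rw [Finset.notMem_union] at hn
    rw [map_add, ha n hn.1, hb n hn.2, add_zero]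

/-- The sum of a family of operators only finitely many of which are nonzero on each vector. -/
def pointwiseSum {W κ : Type*} [AddCommGroup W] [Module ℂ W] (T : κ → Module.End ℂ W)
    (hT : ∀ v, (Function.support fun k => T k v).Finite) : Module.End ℂ W where
  toFun v := ∑ᶠ k, T k v
  map_add' v w := by
    simp only [map_add]
    exact finsum_add_distrib (hT v) (hT w)
  map_smul' c v := by
    simp only [map_smul, RingHom.id_apply]
    exact (smul_finsum' c (hT v)).symm

theorem exists_vertexTerm_bound (B : LinearMap.BilinForm ℤ L) (ε : L → L → ℤˣ) (α : L)
    (v : StateSpace L) : ∃ (F : Finset ℤ) (J : ℕ), ∀ (N : ℤ) (i j : ℕ),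
      (expAct ε α * zPow B α (N - i + j) * PowerSeries.coeff i (expCreation B α) *
        PowerSeries.coeff j (expAnnihilation B α)) v ≠ 0 → N - i + j ∈ F ∧ j ≤ J := by
  obtain ⟨F, hF⟩ := exists_zPow_eq_zero B α v
  obtain ⟨J, hJ⟩ := exists_expAnnihilation_eq_zero B α v
  refine ⟨F, J, fun N i j h => ⟨?_, ?_⟩⟩
  · by_contra hn
    refine h ?_
    rw [mul_assoc (expAct ε α), (zPow_commute_expCreation B α _ i).eq, mul_assoc, mul_assoc,
      (zPow_commute_expAnnihilation B α _ j).eq]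
    simp only [Module.End.mul_apply, hF _ hn, map_zero]
  · by_contra hn
    refine h ?_
    simp only [Module.End.mul_apply, hJ j (by omega), map_zero]

/-- `E^α(z) = e^α z^{α_{(0)}} exp (∑_{n > 0} α_{(-n)} z^n / n) exp (∑_{n < 0} α_{(-n)} z^n / n)`.
The coefficient of `z^N` collects the products of the coefficients of `z^{N - i + j}`, `z^i` and
`z^{-j}` of the last three factors. -/
def expField (B : LinearMap.BilinForm ℤ L) (ε : L → L → ℤˣ) (α : L) :
    VertexOperator ℂ (StateSpace L) :=
  VertexOperator.of_coeff
    (fun N => pointwiseSum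
      (fun ij : ℕ × ℕ => expAct ε α * zPow B α (N - ij.1 + ij.2) *
        PowerSeries.coeff ij.1 (expCreation B α) * PowerSeries.coeff ij.2 (expAnnihilation B α))
      (fun v => by
        obtain ⟨F, J, h⟩ := exists_vertexTerm_bound B ε α v
        refine Set.Finite.subset (s := (fun p : ℤ × ℕ => ((N + p.2 - p.1).toNat, p.2)) ''
          (F ×ˢ Finset.range (J + 1) : Finset (ℤ × ℕ))) ((Finset.finite_toSet _).image _) ?_
        rintro ⟨i, j⟩ hij
        obtain ⟨h1, h2⟩ := h N i j hij
        refine ⟨(N - i + j, j), ?_, ?_⟩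
        · simp only [Finset.coe_product, Set.mem_prod, Finset.mem_coe, Finset.mem_range]
          exact ⟨h1, by omega⟩
        · simp only [Prod.mk.injEq, and_true]
          omega))
    (fun v => by
      obtain ⟨F, J, h⟩ := exists_vertexTerm_bound B ε α v
      obtain ⟨b, hb⟩ := F.bddBelow
      refine ⟨b - J, fun N hN => ?_⟩
      have : ∃ ij : ℕ × ℕ, (expAct ε α * zPow B α (N - ij.1 + ij.2) *
        PowerSeries.coeff ij.1 (expCreation B α) *
          PowerSeries.coeff ij.2 (expAnnihilation B α)) v ≠ 0 := by
        by_contra! hc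
        exact hN (by simp only [pointwiseSum, LinearMap.coe_mk, AddHom.coe_mk, hc, finsum_zero])
      obtain ⟨⟨i, j⟩, hij⟩ := this
      obtain ⟨h1, h2⟩ := h N i j hij
      have := hb h1
      omega)

/-- `h(z) = ∑_m h_{(-m)} z^{m-1}`, depending linearly on `h`. -/
def heisenbergField (B : LinearMap.BilinForm ℤ L) :
    Cartan L →ₗ[ℂ] VertexOperator ℂ (StateSpace L) where
  toFun h := VertexOperator.of_coeff (fun N => heisenberg B (-N - 1) h) fun v => by
    obtain ⟨N, hN⟩ := exists_heisenberg_eq_zero B h v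
    refine ⟨-N - 1, fun n hn => ?_⟩
    by_contra hc
    exact hn (hN _ (by omega))
  map_add' h h' := by
    apply HVertexOperator.coeff_inj
    ext N v
    simp
  map_smul' c h := by
    apply HVertexOperator.coeff_inj
    ext N v
    simp

end States

section Fields
variable {W : Type*} [AddCommGroup W] [Module ℂ W]

theorem exists_coeff_eq_zero (A : VertexOperator ℂ W) (v : W) :
    ∃ n : ℤ, ∀ m < n, HVertexOperator.coeff A m v = 0 :=
  ⟨_, fun m hm => VertexOperator.coeff_eq_zero_of_lt_order A m v hm⟩

/-- A common bound for finitely many vectors. -/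
theorem exists_coeff_eq_zero' (A : VertexOperator ℂ W) (w : ℕ → W) (K : ℕ) :
    ∃ n : ℤ, ∀ m < n, ∀ i < K, HVertexOperator.coeff A m (w i) = 0 := by
  induction K with
  | zero => exact ⟨0, by simp⟩
  | succ K ih =>
    obtain ⟨n, hn⟩ := ih
    obtain ⟨n', hn'⟩ := exists_coeff_eq_zero A (w K)
    refine ⟨min n n', fun m hm i hi => ?_⟩
    rcases Nat.lt_succ_iff_lt_or_eq.1 hi with h | rfl
    · exact hn m (by omega) i h
    · exact hn' m (by omega)

/-- The derivative `∂_z A(z)`. -/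
def fieldDeriv : VertexOperator ℂ W →ₗ[ℂ] VertexOperator ℂ W where
  toFun A := VertexOperator.of_coeff
    (fun N => ((N + 1 : ℤ) : ℂ) • HVertexOperator.coeff A (N + 1)) fun v => by
      obtain ⟨n, hn⟩ := exists_coeff_eq_zero A v
      refine ⟨n - 1, fun m hm => ?_⟩
      by_contra hc
      exact hm (by simp only [LinearMap.smul_apply, hn (m + 1) (by omega), smul_zero])
  map_add' A A' := by
    apply HVertexOperator.coeff_inj
    ext N v
    simp
  map_smul' c A := by
    apply HVertexOperator.coeff_inj
    ext N v
    simp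
    exact smul_comm _ _ _

theorem coeff_fieldDeriv (A : VertexOperator ℂ W) (N : ℤ) :
    HVertexOperator.coeff (fieldDeriv A) N =
      ((N + 1 : ℤ) : ℂ) • HVertexOperator.coeff A (N + 1) := rfl

theorem finite_support_nonneg (H : ℕ → Module.End ℂ W) (A : VertexOperator ℂ W) (N : ℤ) (v : W) :
    (Function.support fun i : ℕ => (H i * HVertexOperator.coeff A (N - i)) v).Finite := by
  obtain ⟨n, hn⟩ := exists_coeff_eq_zero A v
  refine (Finset.finite_toSet (Finset.range (N - n + 1).toNat)).subset fun i hi => ?_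
  rw [Finset.mem_coe, Finset.mem_range]
  by_contra hc
  exact hi (by simp only [Module.End.mul_apply, hn (N - i) (by omega), map_zero])

theorem finite_support_neg (H : VertexOperator ℂ W) (A : ℕ → Module.End ℂ W) (v : W) :
    (Function.support fun i : ℕ => (A i * HVertexOperator.coeff H (-i - 1)) v).Finite := by
  obtain ⟨n, hn⟩ := exists_coeff_eq_zero H v
  refine (Finset.finite_toSet (Finset.range (-n).toNat)).subset fun i hi => ?_
  rw [Finset.mem_coe, Finset.mem_range]
  by_contra hc
  exact hi (by simp only [Module.End.mul_apply, hn (-i - 1) (by omega), map_zero])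

/-- `H(z)_{≥ 0} A(z)`. -/
def nonnegMul (H A : VertexOperator ℂ W) : VertexOperator ℂ W :=
  VertexOperator.of_coeff
    (fun N => pointwiseSum
      (fun i : ℕ => HVertexOperator.coeff H i * HVertexOperator.coeff A (N - i))
      (finite_support_nonneg _ A N))
    fun v => by
      obtain ⟨n, hn⟩ := exists_coeff_eq_zero A v
      refine ⟨n, fun m hm => ?_⟩
      by_contra hc
      refine hm ?_
      simp only [pointwiseSum, LinearMap.coe_mk, AddHom.coe_mk, Module.End.mul_apply]
      exact finsum_eq_zero_of_forall_eq_zero fun i => by rw [hn (m - i) (by omega), map_zero]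

/-- `A(z) H(z)_{< 0}`. -/
def mulNeg (H A : VertexOperator ℂ W) : VertexOperator ℂ W :=
  VertexOperator.of_coeff
    (fun N => pointwiseSum
      (fun i : ℕ => HVertexOperator.coeff A (N + i + 1) * HVertexOperator.coeff H (-i - 1))
      (finite_support_neg H _))
    fun v => by
      obtain ⟨n, hn⟩ := exists_coeff_eq_zero H v
      obtain ⟨n', hn'⟩ := exists_coeff_eq_zero' A (fun i => HVertexOperator.coeff H (-i - 1) v)
        (-n).toNat
      refine ⟨n' + n - 1, fun m hm => ?_⟩
      by_contra hc
      refine hm ?_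
      simp only [pointwiseSum, LinearMap.coe_mk, AddHom.coe_mk, Module.End.mul_apply]
      refine finsum_eq_zero_of_forall_eq_zero fun i => ?_
      by_cases hi : i < (-n).toNat
      · exact hn' _ (by omega) i hi
      · rw [hn (-i - 1) (by omega), map_zero]

theorem coeff_nonnegMul (H A : VertexOperator ℂ W) (N : ℤ) (v : W) :
    HVertexOperator.coeff (nonnegMul H A) N v =
      ∑ᶠ i : ℕ, HVertexOperator.coeff H i (HVertexOperator.coeff A (N - i) v) := rfl

theorem coeff_mulNeg (H A : VertexOperator ℂ W) (N : ℤ) (v : W) :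
    HVertexOperator.coeff (mulNeg H A) N v =
      ∑ᶠ i : ℕ, HVertexOperator.coeff A (N + i + 1) (HVertexOperator.coeff H (-i - 1) v) := rfl

/-- The normally ordered product `:H(z) A(z): = H(z)_{≥ 0} A(z) + A(z) H(z)_{< 0}`, where
`H(z)_{≥ 0}` and `H(z)_{< 0}` consist of the terms of `H(z)` with nonnegative, respectively
negative, powers of `z`. -/
def normalOrder : VertexOperator ℂ W →ₗ[ℂ] Module.End ℂ (VertexOperator ℂ W) :=
  LinearMap.mk₂ ℂ (fun H A => nonnegMul H A + mulNeg H A)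
    (fun H H' A => by
      apply HVertexOperator.coeff_inj
      ext N v
      have h1 := finsum_add_distrib
        (finite_support_nonneg (fun i : ℕ => HVertexOperator.coeff H i) A N v)
        (finite_support_nonneg (fun i : ℕ => HVertexOperator.coeff H' i) A N v)
      have h2 := finsum_add_distrib
        (finite_support_neg H (fun i : ℕ => HVertexOperator.coeff A (N + i + 1)) v)
        (finite_support_neg H' (fun i : ℕ => HVertexOperator.coeff A (N + i + 1)) v)
      simp only [Module.End.mul_apply] at h1 h2
      simp only [map_add, Pi.add_apply, LinearMap.add_apply, coeff_nonnegMul, coeff_mulNeg, h1, h2]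
      abel)
    (fun c H A => by
      apply HVertexOperator.coeff_inj
      ext N v
      have h1 := smul_finsum' c
        (finite_support_nonneg (fun i : ℕ => HVertexOperator.coeff H i) A N v)
      have h2 := smul_finsum' c
        (finite_support_neg H (fun i : ℕ => HVertexOperator.coeff A (N + i + 1)) v)
      simp only [Module.End.mul_apply] at h1 h2
      simp only [map_add, map_smul, Pi.add_apply, Pi.smul_apply, LinearMap.add_apply,
        LinearMap.smul_apply, coeff_nonnegMul, coeff_mulNeg, smul_add, h1, h2])
    (fun H A A' => by
      apply HVertexOperator.coeff_inj
      ext N v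
      have h1 := finsum_add_distrib
        (finite_support_nonneg (fun i : ℕ => HVertexOperator.coeff H i) A N v)
        (finite_support_nonneg (fun i : ℕ => HVertexOperator.coeff H i) A' N v)
      have h2 := finsum_add_distrib
        (finite_support_neg H (fun i : ℕ => HVertexOperator.coeff A (N + i + 1)) v)
        (finite_support_neg H (fun i : ℕ => HVertexOperator.coeff A' (N + i + 1)) v)
      simp only [Module.End.mul_apply] at h1 h2
      simp only [map_add, Pi.add_apply, LinearMap.add_apply, coeff_nonnegMul, coeff_mulNeg, h1, h2]
      abel)
    (fun c H A => by
      apply HVertexOperator.coeff_inj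
      ext N v
      have h1 := smul_finsum' c
        (finite_support_nonneg (fun i : ℕ => HVertexOperator.coeff H i) A N v)
      have h2 := smul_finsum' c
        (finite_support_neg H (fun i : ℕ => HVertexOperator.coeff A (N + i + 1)) v)
      simp only [Module.End.mul_apply] at h1 h2
      simp only [map_add, map_smul, Pi.add_apply, Pi.smul_apply, LinearMap.add_apply,
        LinearMap.smul_apply, coeff_nonnegMul, coeff_mulNeg, smul_add, h1, h2])

theorem finsum_eq_range {W : Type*} [AddCommGroup W] {f : ℕ → W} (K : ℕ) (h : ∀ i, K ≤ i → f i = 0) :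
    ∑ᶠ i, f i = ∑ i ∈ Finset.range K, f i :=
  finsum_eq_sum_of_support_subset _ fun i hi => by
    rw [Finset.mem_coe, Finset.mem_range]
    by_contra hc
    exact hi (h i (by omega))

/-- The nonnegative halves of two fields commute, and so do their negative halves. -/
def HalvesCommute (H H' : VertexOperator ℂ W) : Prop :=
  (∀ i j : ℤ, 0 ≤ i → 0 ≤ j →
    Commute (HVertexOperator.coeff H i) (HVertexOperator.coeff H' j)) ∧
  (∀ i j : ℤ, i < 0 → j < 0 →
    Commute (HVertexOperator.coeff H i) (HVertexOperator.coeff H' j))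

theorem HalvesCommute.symm {H H' : VertexOperator ℂ W} (h : HalvesCommute H H') :
    HalvesCommute H' H :=
  ⟨fun i j hi hj => (h.1 j i hj hi).symm, fun i j hi hj => (h.2 j i hj hi).symm⟩

theorem HalvesCommute.deriv {H H' : VertexOperator ℂ W} (h : HalvesCommute H H') (m : ℕ) :
    HalvesCommute ((fieldDeriv ^ m) H) H' := by
  induction m with
  | zero => exact h
  | succ m ih =>
    rw [pow_succ', Module.End.mul_apply]
    refine ⟨fun i j hi hj => ?_, fun i j hi hj => ?_⟩
    · rw [coeff_fieldDeriv]
      exact (ih.1 (i + 1) j (by omega) hj).smul_left _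
    · rw [coeff_fieldDeriv]
      by_cases hi' : i + 1 < 0
      · exact (ih.2 (i + 1) j hi' hj).smul_left _
      · have : i + 1 = 0 := by omega
        rw [this, Int.cast_zero, zero_smul]
        exact .zero_left _

theorem nonnegMul_comm {H H' : VertexOperator ℂ W} (h : HalvesCommute H H')
    (A : VertexOperator ℂ W) : nonnegMul H (nonnegMul H' A) = nonnegMul H' (nonnegMul H A) := by
  apply HVertexOperator.coeff_inj
  ext N v
  obtain ⟨n, hn⟩ := exists_coeff_eq_zero A v
  have key : ∀ H H' : VertexOperator ℂ W,
      HVertexOperator.coeff (nonnegMul H (nonnegMul H' A)) N v =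
        ∑ i ∈ Finset.range (N - n + 1).toNat, ∑ j ∈ Finset.range (N - n + 1).toNat,
          HVertexOperator.coeff H i
            (HVertexOperator.coeff H' j (HVertexOperator.coeff A (N - i - j) v)) := by
    intro H H'
    have inner : ∀ i : ℕ, HVertexOperator.coeff (nonnegMul H' A) (N - i) v =
        ∑ j ∈ Finset.range (N - n + 1).toNat,
          HVertexOperator.coeff H' j (HVertexOperator.coeff A (N - i - j) v) := fun i => by
      rw [coeff_nonnegMul]
      exact finsum_eq_range _ fun j hj => by rw [hn _ (by omega), map_zero]
    rw [coeff_nonnegMul, finsum_eq_range (N - n + 1).toNat fun i hi => ?_]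
    · simp only [inner, map_sum]
    · rw [inner, Finset.sum_eq_zero, map_zero]
      intro j _
      rw [hn _ (by omega), map_zero]
  rw [key, key, Finset.sum_comm]
  refine Finset.sum_congr rfl fun j _ => Finset.sum_congr rfl fun i _ => ?_
  rw [sub_right_comm]
  exact LinearMap.congr_fun (h.1 i j (by omega) (by omega)).eq _

theorem mulNeg_nonnegMul (H H' A : VertexOperator ℂ W) :
    nonnegMul H (mulNeg H' A) = mulNeg H' (nonnegMul H A) := by
  apply HVertexOperator.coeff_inj
  ext N v
  obtain ⟨n, hn⟩ := exists_coeff_eq_zero H' v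
  obtain ⟨n', hn'⟩ := exists_coeff_eq_zero' A (fun i => HVertexOperator.coeff H' (-i - 1) v)
    (-n).toNat
  have e1 : ∀ i : ℕ, HVertexOperator.coeff (mulNeg H' A) (N - i) v =
      ∑ j ∈ Finset.range (-n).toNat, HVertexOperator.coeff A (N - i + j + 1)
        (HVertexOperator.coeff H' (-j - 1) v) := fun i => by
    rw [coeff_mulNeg]
    exact finsum_eq_range _ fun j hj => by rw [hn _ (by omega), map_zero]
  have e2 : ∀ j < (-n).toNat, HVertexOperator.coeff (nonnegMul H A) (N + j + 1)
      (HVertexOperator.coeff H' (-j - 1) v) =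
      ∑ i ∈ Finset.range (N - n - n' + 1).toNat, HVertexOperator.coeff H i
        (HVertexOperator.coeff A (N - i + j + 1) (HVertexOperator.coeff H' (-j - 1) v)) :=
    fun j hj => by
      rw [coeff_nonnegMul, finsum_eq_range (N - n - n' + 1).toNat fun i hi => by
        rw [hn' _ (by omega) j hj, map_zero]]
      refine Finset.sum_congr rfl fun i _ => ?_
      rw [show N + j + 1 - i = N - i + j + 1 by ring]
  rw [coeff_nonnegMul, coeff_mulNeg, finsum_eq_range (N - n - n' + 1).toNat fun i hi => ?_,
    finsum_eq_range (-n).toNat fun j hj => by rw [hn _ (by omega), map_zero],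
    Finset.sum_congr rfl fun j hj => e2 j (Finset.mem_range.1 hj), Finset.sum_comm]
  · exact Finset.sum_congr rfl fun i _ => by rw [e1, map_sum]
  · rw [e1, Finset.sum_eq_zero, map_zero]
    intro j hj
    rw [Finset.mem_range] at hj
    exact hn' _ (by omega) j hj

theorem mulNeg_comm {H H' : VertexOperator ℂ W} (h : HalvesCommute H H')
    (A : VertexOperator ℂ W) : mulNeg H (mulNeg H' A) = mulNeg H' (mulNeg H A) := by
  apply HVertexOperator.coeff_inj
  ext N v
  obtain ⟨n, hn⟩ := exists_coeff_eq_zero H v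
  obtain ⟨n', hn'⟩ := exists_coeff_eq_zero H' v
  obtain ⟨p, hp⟩ := exists_coeff_eq_zero' H (fun i => HVertexOperator.coeff H' (-i - 1) v)
    (-n').toNat
  obtain ⟨p', hp'⟩ := exists_coeff_eq_zero' H' (fun i => HVertexOperator.coeff H (-i - 1) v)
    (-n).toNat
  have key : ∀ (H H' : VertexOperator ℂ W) (n p' K : ℤ), n ≥ -K → p' ≥ -K →
      (∀ m < n, HVertexOperator.coeff H m v = 0) →
      (∀ m < p', ∀ i < (-n).toNat,
        HVertexOperator.coeff H' m (HVertexOperator.coeff H (-i - 1) v) = 0) →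
      HVertexOperator.coeff (mulNeg H (mulNeg H' A)) N v =
        ∑ i ∈ Finset.range K.toNat, ∑ j ∈ Finset.range K.toNat,
          HVertexOperator.coeff A (N + i + 1 + j + 1)
            (HVertexOperator.coeff H' (-j - 1) (HVertexOperator.coeff H (-i - 1) v)) := by
    intro H H' n p' K hnK hpK hn hp'
    rw [coeff_mulNeg, finsum_eq_range K.toNat fun i hi => by rw [hn _ (by omega), map_zero]]
    refine Finset.sum_congr rfl fun i _ => ?_
    rw [coeff_mulNeg]
    refine finsum_eq_range _ fun j hj => ?_
    by_cases hi : i < (-n).toNat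
    · rw [hp' _ (by omega) i hi, map_zero]
    · rw [hn _ (by omega), map_zero, map_zero]
  let K : ℤ := |n| + |n'| + |p| + |p'|
  have hK : n ≥ -K ∧ n' ≥ -K ∧ p ≥ -K ∧ p' ≥ -K := by
    have h1 := neg_abs_le n
    have h2 := neg_abs_le n'
    have h3 := neg_abs_le p
    have h4 := neg_abs_le p'
    have h5 := abs_nonneg n
    have h6 := abs_nonneg n'
    have h7 := abs_nonneg p
    have h8 := abs_nonneg p'
    simp only [K]
    omega
  rw [key H H' n p' K hK.1 hK.2.2.2 hn hp', key H' H n' p K hK.2.1 hK.2.2.1 hn' hp,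
    Finset.sum_comm]
  refine Finset.sum_congr rfl fun j _ => Finset.sum_congr rfl fun i _ => ?_
  rw [show N + i + 1 + j + 1 = N + j + 1 + i + 1 by ring]
  exact congrArg _
    (LinearMap.congr_fun (h.2 (-i - 1) (-j - 1) (by omega) (by omega)).eq.symm v)

theorem nonnegMul_add (H A A' : VertexOperator ℂ W) :
    nonnegMul H (A + A') = nonnegMul H A + nonnegMul H A' := by
  apply HVertexOperator.coeff_inj
  ext N v
  have h1 := finsum_add_distrib
    (finite_support_nonneg (fun i : ℕ => HVertexOperator.coeff H i) A N v)
    (finite_support_nonneg (fun i : ℕ => HVertexOperator.coeff H i) A' N v)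
  simp only [Module.End.mul_apply] at h1
  simp only [map_add, Pi.add_apply, LinearMap.add_apply, coeff_nonnegMul, h1]

theorem mulNeg_add (H A A' : VertexOperator ℂ W) :
    mulNeg H (A + A') = mulNeg H A + mulNeg H A' := by
  apply HVertexOperator.coeff_inj
  ext N v
  have h2 := finsum_add_distrib
    (finite_support_neg H (fun i : ℕ => HVertexOperator.coeff A (N + i + 1)) v)
    (finite_support_neg H (fun i : ℕ => HVertexOperator.coeff A' (N + i + 1)) v)
  simp only [Module.End.mul_apply] at h2
  simp only [map_add, Pi.add_apply, LinearMap.add_apply, coeff_mulNeg, h2]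

theorem normalOrder_commute {H H' : VertexOperator ℂ W} (h : HalvesCommute H H') :
    Commute (normalOrder H) (normalOrder H') := by
  refine LinearMap.ext fun A => ?_
  change nonnegMul H (nonnegMul H' A + mulNeg H' A) + mulNeg H (nonnegMul H' A + mulNeg H' A) =
    nonnegMul H' (nonnegMul H A + mulNeg H A) + mulNeg H' (nonnegMul H A + mulNeg H A)
  simp only [nonnegMul_add, mulNeg_add]
  rw [nonnegMul_comm h, mulNeg_comm h, mulNeg_nonnegMul H H', mulNeg_nonnegMul H' H]
  abel

end Fields

section StateField
variable {L : Type*} [AddCommGroup L]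

theorem rTensor_commute {f g : Module.End ℂ (Fock L)} (h : Commute f g) :
    Commute (LinearMap.rTensor (L →₀ ℂ) f) (LinearMap.rTensor (L →₀ ℂ) g) := by
  rw [commute_iff_eq, Module.End.mul_eq_comp, Module.End.mul_eq_comp, ← LinearMap.rTensor_comp,
    ← LinearMap.rTensor_comp]
  exact congrArg _ h.eq

theorem diagonal_commute (c d : L → ℂ) : Commute (diagonal c) (diagonal d) := by
  rw [commute_iff_eq, Module.End.mul_eq_comp, Module.End.mul_eq_comp]
  simp only [diagonal, LinearMap.comp_apply, LinearMap.coe_lTensorHom, ← LinearMap.lTensor_comp]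
  refine congrArg _ (Finsupp.lhom_ext' fun β => LinearMap.ext fun x => ?_)
  simp only [LinearMap.comp_apply, LinearMap.coe_mk, AddHom.coe_mk, Finsupp.lsingle_apply,
    Finsupp.lsum_single, LinearMap.smul_apply, map_smul]
  exact smul_comm _ _ _

theorem heisenbergField_halvesCommute (B : LinearMap.BilinForm ℤ L) (h h' : Cartan L) :
    HalvesCommute (heisenbergField B h) (heisenbergField B h') := by
  refine ⟨fun i j hi hj => ?_, fun i j hi hj => ?_⟩
  · change Commute (heisenberg B (-i - 1) h) (heisenberg B (-j - 1) h')
    obtain ⟨i, rfl⟩ := Int.eq_ofNat_of_zero_le hi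
    obtain ⟨j, rfl⟩ := Int.eq_ofNat_of_zero_le hj
    rw [show -(i : ℤ) - 1 = Int.negSucc i by omega, show -(j : ℤ) - 1 = Int.negSucc j by omega]
    refine rTensor_commute (LinearMap.ext fun x => ?_)
    exact mul_left_comm (negGen i h) (negGen j h') x
  · change Commute (heisenberg B (-i - 1) h) (heisenberg B (-j - 1) h')
    obtain ⟨i, rfl⟩ : ∃ n : ℕ, i = -(n : ℤ) - 1 := ⟨(-i - 1).toNat, by omega⟩
    obtain ⟨j, rfl⟩ : ∃ n : ℕ, j = -(n : ℤ) - 1 := ⟨(-j - 1).toNat, by omega⟩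
    rw [show -(-(i : ℤ) - 1) - 1 = Int.ofNat i by simp,
      show -(-(j : ℤ) - 1) - 1 = Int.ofNat j by simp]
    cases i with
    | zero =>
      cases j with
      | zero => exact diagonal_commute _ _
      | succ j => exact diagonal_commute_rTensor _ _
    | succ i =>
      cases j with
      | zero => exact (diagonal_commute_rTensor _ _).symm
      | succ j => exact rTensor_commute (LinearMap.ext fun x => contraction_comm _ _ x)

/-- `A(z) ↦ (1 / m!) :∂^m h(z) A(z):` for `h s^{-m-1} ∈ 𝔥^{<0}`, extended linearly to `𝔥^{<0}`. -/
def normalOrderGen (B : LinearMap.BilinForm ℤ L) :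
    NegPart L →ₗ[ℂ] Module.End ℂ (VertexOperator ℂ (StateSpace L)) :=
  Finsupp.lsum ℂ fun m =>
    normalOrder ∘ₗ (((m.factorial : ℂ)⁻¹) • (fieldDeriv ^ m) ∘ₗ heisenbergField B)

theorem normalOrderGen_comm (B : LinearMap.BilinForm ℤ L) (x y : NegPart L) :
    normalOrderGen B x * normalOrderGen B y = normalOrderGen B y * normalOrderGen B x := by
  change Commute (normalOrderGen B x) (normalOrderGen B y)
  simp only [normalOrderGen, Finsupp.lsum_apply, Finsupp.sum]
  refine Commute.sum_left _ _ _ fun m _ => Commute.sum_right _ _ _ fun n _ => ?_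
  simp only [LinearMap.comp_apply, LinearMap.smul_apply, map_smul]
  refine Commute.smul_left (Commute.smul_right ?_ _) _
  exact normalOrder_commute
    (((heisenbergField_halvesCommute B (x m) (y n)).deriv m).symm.deriv n).symm

/-- `g ↦ (A(z) ↦ (1 / (m₁! ⋯ m_k!)) :∂^{m₁} h₁(z) ⋯ ∂^{m_k} h_k(z) A(z):)` for
`g = h₁ s^{-m₁-1} ⋯ h_k s^{-m_k-1}`, the normally ordered product being expanded from the right to the
left. -/
def normalOrderHom (B : LinearMap.BilinForm ℤ L) :
    Fock L →ₐ[ℂ] Module.End ℂ (VertexOperator ℂ (StateSpace L)) :=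
  symLift (M := NegPart L) (A := Module.End ℂ (VertexOperator ℂ (StateSpace L)))
    (normalOrderGen B) (normalOrderGen_comm B)

/-- The state-field correspondence of the lattice vertex algebra of `(L, B)` with sign function `ε`:
it is linear, and
`Y (h₁ s^{-m₁-1} ⋯ h_k s^{-m_k-1} ⊗ e^α, z)
  = (1 / (m₁! ⋯ m_k!)) :∂^{m₁} h₁(z) ⋯ ∂^{m_k} h_k(z) E^α(z):`,
where the normally ordered product is expanded from the right to the left. -/
def stateField (B : LinearMap.BilinForm ℤ L) (ε : L → L → ℤˣ) :
    StateSpace L →ₗ[ℂ] VertexOperator ℂ (StateSpace L) :=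
  TensorProduct.lift <| LinearMap.mk₂ ℂ
    (fun (g : Fock L) (b : L →₀ ℂ) =>
      normalOrderHom B g (Finsupp.linearCombination ℂ (expField B ε) b))
    (fun g g' b => by simp only [map_add, LinearMap.add_apply])
    (fun c g b => by simp only [map_smul, LinearMap.smul_apply])
    (fun g b b' => by simp only [map_add])
    (fun c g b => by simp only [map_smul])

/-- The mode `a_{(m)}`, that is, the coefficient of `z^{-m-1}` in `Y(a, z)`. -/
def mode (B : LinearMap.BilinForm ℤ L) (ε : L → L → ℤˣ) (a : StateSpace L) (m : ℤ) :
    Module.End ℂ (StateSpace L) :=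
  VertexOperator.ncoeff (stateField B ε a) m

end StateField

section Toroidal
variable {ℓ r : ℕ}

/-- `Q = ⊕ ℤ v_i`, of rank `ℓ`. -/
abbrev QLattice (ℓ : ℕ) := Fin ℓ → ℤ

/-- `R = ⊕ (ℤ ϑ_ν ⊕ ℤ Θ_ν)`, of rank `2 r`: the pair of the `ϑ`- and the `Θ`-coordinates. -/
abbrev RLattice (r : ℕ) := (Fin r → ℤ) × (Fin r → ℤ)

/-- `Γ = Q ⊕ R`. -/
abbrev GammaLattice (ℓ r : ℕ) := QLattice ℓ × RLattice r

/-- The basis vector `v_i` of `Q`, in `Γ`. -/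
def vVec (i : Fin ℓ) : GammaLattice ℓ r := (Pi.single i 1, 0, 0)

/-- The basis vector `ϑ_ν` of `R`, in `Γ`. -/
def smallTheta (ν : Fin r) : GammaLattice ℓ r := (0, Pi.single ν 1, 0)

/-- The basis vector `Θ_ν` of `R`, in `Γ`. -/
def bigTheta (ν : Fin r) : GammaLattice ℓ r := (0, 0, Pi.single ν 1)

/-- `p · ϑ = ∑ p_ν ϑ_ν`. -/
def dotTheta (p : Fin r → ℤ) : GammaLattice ℓ r := ∑ ν, p ν • smallTheta ν

/-- The bilinear form on `Γ` with `(v_i | v_j) = δ_{ij}`, `(ϑ_ν | Θ_μ) = (Θ_μ | ϑ_ν) = δ_{νμ}`, all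
other products of basis vectors being zero. -/
def gammaForm (ℓ r : ℕ) : LinearMap.BilinForm ℤ (GammaLattice ℓ r) :=
  LinearMap.mk₂ ℤ
    (fun x y => ∑ i, x.1 i * y.1 i + ∑ ν, (x.2.1 ν * y.2.2 ν + x.2.2 ν * y.2.1 ν))
    (fun x x' y => by
      simp only [Prod.fst_add, Prod.snd_add, Pi.add_apply, add_mul, Finset.sum_add_distrib]; ring)
    (fun c x y => by
      simp only [Prod.smul_fst, Prod.smul_snd, Pi.smul_apply, smul_eq_mul, mul_add, mul_assoc,
        Finset.mul_sum])
    (fun x y y' => by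
      simp only [Prod.fst_add, Prod.snd_add, Pi.add_apply, mul_add, Finset.sum_add_distrib]; ring)
    (fun c x y => by
      simp only [Prod.smul_fst, Prod.smul_snd, Pi.smul_apply, smul_eq_mul, mul_add,
        mul_left_comm _ c, Finset.mul_sum])

/-- `ε_{ij}`, equal to `1` for `i < j` and to `-1` for `i ≥ j`. -/
def epsSign (i j : Fin ℓ) : ℤˣ := if i < j then 1 else -1

/-- The conditions on the bi-multiplicative function `ε : Γ × Γ → {±1}`. The signs `ε (Θ_μ, ϑ_ν)` are
left free. -/
structure IsToroidalSign (ε : GammaLattice ℓ r → GammaLattice ℓ r → ℤˣ) : Prop where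
  add_left : ∀ α β γ, ε (α + β) γ = ε α γ * ε β γ
  add_right : ∀ α β γ, ε α (β + γ) = ε α β * ε α γ
  v_v : ∀ i j, ε (vVec i) (vVec j) = epsSign i j
  theta_Theta : ∀ ν μ, ε (smallTheta ν) (bigTheta μ) = if ν = μ then -1 else 1
  theta_theta : ∀ ν μ, ε (smallTheta ν) (smallTheta μ) = 1
  Theta_Theta : ∀ ν μ, ε (bigTheta ν) (bigTheta μ) = 1
  Q_R : ∀ (v : QLattice ℓ) (η : RLattice r), ε (v, 0) (0, η) = 1
  R_Q : ∀ (v : QLattice ℓ) (η : RLattice r), ε (0, η) (v, 0) = 1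

/-- The mode `(h s^{-1} ⊗ e^{p·ϑ})_{(m)}` in `V_Γ`, for `h ∈ Γ`. -/
def cartanMode (ε : GammaLattice ℓ r → GammaLattice ℓ r → ℤˣ) (h : GammaLattice ℓ r)
    (p : Fin r → ℤ) (m : ℤ) : Module.End ℂ (StateSpace (GammaLattice ℓ r)) :=
  mode (gammaForm ℓ r) ε (stateOf (negGen 0 (toCartan h)) (dotTheta p)) m

/-- `h_{i,m}^p = ((v_i - v_{i+1}) s^{-1} ⊗ e^{p·ϑ})_{(m)}`. The index `i` takes `ℓ - 1` values, and as
for `v` it is counted from `0`. -/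
def hMode (ε : GammaLattice ℓ r → GammaLattice ℓ r → ℤˣ) (i : Fin (ℓ - 1))
    (p : Fin r → ℤ) (m : ℤ) : Module.End ℂ (StateSpace (GammaLattice ℓ r)) :=
  cartanMode ε (vVec ⟨i, by omega⟩ - vVec ⟨i + 1, by omega⟩) p m

/-- `e_{kl,m}^p = ε_{lk} (1 ⊗ e^{v_k - v_l + p·ϑ})_{(m)}`. -/
def eMode (ε : GammaLattice ℓ r → GammaLattice ℓ r → ℤˣ) (k l : Fin ℓ)
    (p : Fin r → ℤ) (m : ℤ) : Module.End ℂ (StateSpace (GammaLattice ℓ r)) :=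
  ((epsSign l k : ℤ) : ℂ) •
    mode (gammaForm ℓ r) ε (stateOf 1 (vVec k - vVec l + dotTheta p)) m

/-- `κ_{0,m}^p = (1 ⊗ e^{p·ϑ})_{(m-1)}` and `κ_{ν,m}^p = (ϑ_ν s^{-1} ⊗ e^{p·ϑ})_{(m)}` for
`1 ≤ ν ≤ r`; the index `ν ≥ 1` is written as the successor of an element of `Fin r`. -/
def kappaMode (ε : GammaLattice ℓ r → GammaLattice ℓ r → ℤˣ) (ν : Fin (r + 1))
    (p : Fin r → ℤ) (m : ℤ) : Module.End ℂ (StateSpace (GammaLattice ℓ r)) :=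
  Fin.cases (mode (gammaForm ℓ r) ε (stateOf 1 (dotTheta p)) (m - 1))
    (fun ν => cartanMode ε (smallTheta ν) p m) ν

/-- The set of all the elements `h_{i,m}^p`, `e_{kl,m}^p` (`k ≠ l`) and `κ_{ν,m}^p`. -/
def toroidalElements (ε : GammaLattice ℓ r → GammaLattice ℓ r → ℤˣ) :
    Set (Module.End ℂ (StateSpace (GammaLattice ℓ r))) :=
  {a | ∃ i p m, a = hMode ε i p m} ∪ {a | ∃ k l p m, k ≠ l ∧ a = eMode ε k l p m} ∪
    {a | ∃ ν p m, a = kappaMode ε ν p m}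

/-- The Kronecker symbol. -/
def kron (a b : ℕ) : ℂ := if a = b then 1 else 0

end Toroidal

end LatticeVA

end

/-!
Let `h_{(k)}` be the Heisenberg operators on `V = S ⊗ ℂ[L]` and let `E^α(z)` be the exponential
vertex operators. The proof computes the commutators of the fields `E^α(z)` and `:h(z) E^α(z):`
for an arbitrary lattice `L`, as far as they are needed, and then specialises to `Γ`.

The first ingredient is a uniqueness principle. The creation operators generate `V` from the vectors
`e^γ`; hence a family of operators that is stable under commutation with the creation operators
vanishes as soon as it kills every `e^γ` (`eq_zero_of_vacuum`). This gives
`[h_{(k)}, E^α(z)] = (h | α) z^k E^α(z)` (`heisenberg_expMode`), and then every product of a field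
`E^α(z)` with a field `E^β(w)` has the same commutators
`((h | α) z^k + (h | β) w^k) E^α(z) E^β(w)` with the Heisenberg operators. A family with this
property is called biprimary here (`IsBiprimary`). Two biprimary families of the same type are equal
if they agree on the vectors `e^γ` (`IsBiprimary.ext`), so an identity between products of vertex
operators has to be verified on these vectors only.

The second ingredient is the product formula on `e^γ`. There `E^β(w)` produces the generating series
`schur β` of the elementary Schur polynomials, which is an eigenvector of the annihilation operators
(`lowering_zcoeff_schur`), and moving the annihilation part of `E^α(z)` past it costs the factor
`(1 - w / z)^{(α | β)}` (`coeff_expLowering_zcoeff_schur`, `expMode_expMode_vacuum`). If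
`(α | β) ≥ 0`, the factor is a polynomial in `w / z`, the two orders of the product differ by the
sign `(-1)^{(α | β)} ε(α, β) ε(β, α)`, which is `1` in the cases needed, and the fields commute. If
`(α | β)` is `-1` or `-2`, the two orders lead to the two expansions of a simple or double pole at
`z = w`, whose difference is a delta function or its derivative. On the level of Schur polynomials
this is the identity `schur (α + β) = schur α * schur β` together with the differential equation
`derivative_schur`; the commutators are `simplePole` and `doublePole`, up to the factor `ε(α, β)`.

The third ingredient treats the currents `:h(z) E^α(z):` with `(α | β) = 0`. Since `E^α(z)` and
`E^β(w)` commute, only the commutators of `h(z)` with the second field contribute, and the remaining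
two-sided sums of products of vertex operators are again simple and double poles
(`currentMode_expMode_zero`, `currentMode_currentMode_zero`).

All pairings of the lattice vectors `v_k - v_l + p·ϑ` and `p·ϑ` that occur in the toroidal relations
lie between `-2` and `2`. It remains to evaluate the poles by means of
`:(x + p·ϑ)(z) E^α(z): = :x(z) E^α(z): + ∑ p_ν :ϑ_ν(z) E^α(z):`, and to follow the signs `ε_{kl}`.
-/

open scoped TensorProduct

noncomputable section

namespace LatticeVA

/-! ### Formal exponentials -/

section FormalExp
variable {A : Type*} [Ring A] [Algebra ℂ A]

theorem coeff_pow_eq_zero {A : Type*} [Ring A] {a : PowerSeries A}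
    (ha : PowerSeries.coeff 0 a = 0) {n k : ℕ} (h : n < k) : PowerSeries.coeff n (a ^ k) = 0 := by
  induction k generalizing n with
  | zero => omega
  | succ k ih =>
    rw [pow_succ, PowerSeries.coeff_mul]
    refine Finset.sum_eq_zero fun ij hij => ?_
    rw [Finset.HasAntidiagonal.mem_antidiagonal] at hij
    rcases Nat.eq_zero_or_pos ij.2 with h0 | h0
    · rw [h0, ha, mul_zero]
    · rw [ih (by omega), zero_mul]

theorem coeff_formalExp {a : PowerSeries A} (ha : PowerSeries.coeff 0 a = 0) {n K : ℕ}
    (h : n < K) : PowerSeries.coeff n (formalExp a) =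
      ∑ k ∈ Finset.range K, ((k.factorial : ℂ)⁻¹) • PowerSeries.coeff n (a ^ k) := by
  rw [formalExp, PowerSeries.coeff_mk]
  refine Finset.sum_subset (Finset.range_subset_range.2 h) fun k _ hk => ?_
  rw [coeff_pow_eq_zero ha (by simpa using hk), smul_zero]

theorem coeff_zero_formalExp {a : PowerSeries A} :
    PowerSeries.coeff 0 (formalExp a) = 1 := by
  simp [formalExp]

/-- A linear map that intertwines the coefficients of two series intertwines those of their
exponentials. -/
theorem formalExp_intertwine {U W : Type*} [AddCommGroup U] [Module ℂ U] [Module A U]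
    [IsScalarTower ℂ A U] [AddCommGroup W] [Module ℂ W] (f : U →ₗ[ℂ] W) {a : PowerSeries A}
    {b : PowerSeries (Module.End ℂ W)}
    (h : ∀ n u, PowerSeries.coeff n b (f u) = f (PowerSeries.coeff n a • u)) (n : ℕ) (u : U) :
    PowerSeries.coeff n (formalExp b) (f u) = f (PowerSeries.coeff n (formalExp a) • u) := by
  have hpow : ∀ (k n : ℕ) (u : U),
      PowerSeries.coeff n (b ^ k) (f u) = f (PowerSeries.coeff n (a ^ k) • u) := by
    intro k
    induction k with
    | zero =>
      intro n u
      rw [pow_zero, pow_zero, PowerSeries.coeff_one, PowerSeries.coeff_one]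
      split_ifs <;> simp
    | succ k ih =>
      intro n u
      rw [pow_succ, pow_succ, PowerSeries.coeff_mul, PowerSeries.coeff_mul, Finset.sum_smul,
        LinearMap.sum_apply, map_sum]
      refine Finset.sum_congr rfl fun ij _ => ?_
      rw [Module.End.mul_apply, h, ih, mul_smul]
  simp only [formalExp, PowerSeries.coeff_mk, LinearMap.sum_apply, LinearMap.smul_apply, hpow,
    Finset.sum_smul, map_sum, smul_assoc, map_smul]

theorem coeff_smul_complex (c : ℂ) (f : PowerSeries A) (n : ℕ) :
    PowerSeries.coeff n (c • f) = c • PowerSeries.coeff n f := rfl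

/-- The chain rule `δ (exp a) = δ a * exp a` for a coefficientwise derivation `δ` of power series
(the multiplication of the `n`-th coefficient by `n`, or the commutator with a fixed operator) such
that `δ a` commutes with `a`. -/
theorem formalExp_leibniz (d : ℕ → A →ₗ[ℂ] A)
    (hd : ∀ i j x y, d (i + j) (x * y) = d i x * y + x * d j y) {a X : PowerSeries A}
    (ha : PowerSeries.coeff 0 a = 0)
    (hX : ∀ n, PowerSeries.coeff n X = d n (PowerSeries.coeff n a)) (hc : Commute X a) (n : ℕ) :
    d n (PowerSeries.coeff n (formalExp a)) = PowerSeries.coeff n (X * formalExp a) := by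
  let δ : PowerSeries A → PowerSeries A := fun f =>
    PowerSeries.mk fun n => d n (PowerSeries.coeff n f)
  have hδ : ∀ n f, PowerSeries.coeff n (δ f) = d n (PowerSeries.coeff n f) := fun n f => by
    simp [δ]
  have hmul : ∀ f g, δ (f * g) = δ f * g + f * δ g := fun f g => by
    ext n
    simp only [hδ, map_add, PowerSeries.coeff_mul, map_sum, ← Finset.sum_add_distrib]
    refine Finset.sum_congr rfl fun ij hij => ?_
    rw [← Finset.HasAntidiagonal.mem_antidiagonal.1 hij, hd]
  have hone : δ 1 = 0 := by
    have := hmul 1 1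
    simpa using this
  have ha' : δ a = X := by
    ext n
    rw [hδ, hX]
  have hpow : ∀ k : ℕ, δ (a ^ (k + 1)) = (k + 1 : ℂ) • (X * a ^ k) := by
    intro k
    induction k with
    | zero => simp [ha']
    | succ k ih =>
      rw [pow_succ a (k + 1), hmul, ih, ha', ← (hc.pow_right (k + 1)).eq]
      simp only [pow_succ, add_mul, smul_mul_assoc, mul_assoc, Nat.cast_succ, add_smul, one_smul]
  have hX0 : PowerSeries.coeff 0 X = 0 := by rw [hX, ha, map_zero]
  have hR : PowerSeries.coeff n (X * formalExp a) =
      ∑ k ∈ Finset.range n, ((k.factorial : ℂ)⁻¹) • PowerSeries.coeff n (X * a ^ k) := by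
    simp only [PowerSeries.coeff_mul, Finset.smul_sum]
    rw [Finset.sum_comm]
    refine Finset.sum_congr rfl fun ij hij => ?_
    rw [Finset.HasAntidiagonal.mem_antidiagonal] at hij
    rcases Nat.eq_zero_or_pos ij.1 with h0 | h0
    · simp [h0, hX0]
    · rw [coeff_formalExp ha (show ij.2 < n by omega), Finset.mul_sum]
      simp only [mul_smul_comm]
  rw [hR, coeff_formalExp ha (Nat.lt_succ_self n), Finset.sum_range_succ', map_add, map_sum]
  have h0 : d n ((((0 : ℕ).factorial : ℂ)⁻¹) • PowerSeries.coeff n (a ^ 0)) = 0 := by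
    rw [map_smul, pow_zero, ← hδ, hone, map_zero, smul_zero]
  rw [h0, add_zero]
  refine Finset.sum_congr rfl fun k _ => ?_
  rw [map_smul, ← hδ, hpow, coeff_smul_complex, smul_smul]
  congr 1
  have h1 : (k.factorial : ℂ) ≠ 0 := Nat.cast_ne_zero.2 k.factorial_ne_zero
  have h2 : (k + 1 : ℂ) ≠ 0 := by exact_mod_cast k.succ_ne_zero
  rw [Nat.factorial_succ]
  push_cast
  field_simp

/-- The Euler recursion for the coefficients of an exponential. -/
theorem smul_coeff_formalExp {a : PowerSeries A} (ha : PowerSeries.coeff 0 a = 0)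
    (hc : ∀ i j, Commute (PowerSeries.coeff i a) (PowerSeries.coeff j a)) (n : ℕ) :
    (n : ℂ) • PowerSeries.coeff n (formalExp a) = ∑ ij ∈ Finset.HasAntidiagonal.antidiagonal n,
      ((ij.1 : ℂ) • PowerSeries.coeff ij.1 a) * PowerSeries.coeff ij.2 (formalExp a) := by
  have := formalExp_leibniz (fun n => (n : ℂ) • LinearMap.id)
    (fun i j x y => by simp [add_smul])
    (X := PowerSeries.mk fun n => (n : ℂ) • PowerSeries.coeff n a) ha (by simp) (by
      ext n
      rw [PowerSeries.coeff_mul, PowerSeries.coeff_mul, ← Finset.Nat.sum_antidiagonal_swap]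
      refine Finset.sum_congr rfl fun ij _ => ?_
      simpa using congrArg _ (hc _ _).eq) n
  simpa [PowerSeries.coeff_mul] using this

/-- If the commutators of `T` with the coefficients of `a` are concentrated in degree `k`, where
they are the scalar `c`, then `[T, exp a] = c z ^ k exp a`. -/
theorem commutator_coeff_formalExp {a : PowerSeries A} (ha : PowerSeries.coeff 0 a = 0) {T : A}
    {c : ℂ} {k : ℕ} (h : ∀ n, T * PowerSeries.coeff n a - PowerSeries.coeff n a * T =
      if n = k then algebraMap ℂ A c else 0) (n : ℕ) :
    T * PowerSeries.coeff n (formalExp a) - PowerSeries.coeff n (formalExp a) * T =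
      if k ≤ n then c • PowerSeries.coeff (n - k) (formalExp a) else 0 := by
  have := formalExp_leibniz (fun _ => LinearMap.mulLeft ℂ T - LinearMap.mulRight ℂ T)
    (fun i j x y => by simp only [LinearMap.sub_apply, LinearMap.mulLeft_apply,
      LinearMap.mulRight_apply]; noncomm_ring)
    (X := c • PowerSeries.X ^ k) ha (fun n => by
      simp only [coeff_smul_complex, PowerSeries.coeff_X_pow, LinearMap.sub_apply,
        LinearMap.mulLeft_apply, LinearMap.mulRight_apply, h]
      split_ifs with hn <;> simp [Algebra.algebraMap_eq_smul_one])
    (((PowerSeries.commute_X_pow a k).symm).smul_left c) n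
  simp only [LinearMap.sub_apply, LinearMap.mulLeft_apply, LinearMap.mulRight_apply,
    smul_mul_assoc, coeff_smul_complex, PowerSeries.coeff_X_pow_mul'] at this
  rw [this]
  split_ifs <;> simp

end FormalExp

/-! ### Elementary Schur polynomials in the symmetric algebra -/

section ZCoeff
variable {S : Type*} [CommRing S]

/-- The coefficient of `z^i` of a power series, for any integer `i`. -/
def zcoeff (f : PowerSeries S) (i : ℤ) : S := if 0 ≤ i then PowerSeries.coeff i.toNat f else 0

theorem zcoeff_natCast (f : PowerSeries S) (i : ℕ) : zcoeff f i = PowerSeries.coeff i f := by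
  simp [zcoeff]

theorem zcoeff_of_neg (f : PowerSeries S) {i : ℤ} (h : i < 0) : zcoeff f i = 0 := by
  simp [zcoeff, h]

theorem zcoeff_mul (f g : PowerSeries S) {M : ℤ} {K : ℕ} (h : M < K) :
    zcoeff (f * g) M =
      ∑ i ∈ Finset.range K, PowerSeries.coeff i f * zcoeff g (M - i) := by
  rcases lt_or_ge M 0 with hM | hM
  · rw [zcoeff_of_neg _ hM]
    refine (Finset.sum_eq_zero fun i _ => ?_).symm
    rw [zcoeff_of_neg _ (by omega), mul_zero]
  · obtain ⟨M, rfl⟩ := Int.eq_ofNat_of_zero_le hM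
    rw [zcoeff_natCast, PowerSeries.coeff_mul, Finset.Nat.sum_antidiagonal_eq_sum_range_succ_mk]
    rw [← Finset.sum_subset (Finset.range_subset_range.2 (show M.succ ≤ K by omega))]
    · refine Finset.sum_congr rfl fun i hi => ?_
      rw [Finset.mem_range] at hi
      rw [← zcoeff_natCast g, Nat.cast_sub (by omega)]
    · intro i _ hi
      rw [Finset.mem_range] at hi
      rw [zcoeff_of_neg _ (by omega), mul_zero]

theorem zcoeff_derivative [Algebra ℂ S] (f : PowerSeries S) (i : ℤ) :
    zcoeff (PowerSeries.derivative S f) i = ((i + 1 : ℤ) : ℂ) • zcoeff f (i + 1) := by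
  rcases lt_or_ge i 0 with hi | hi
  · rw [zcoeff_of_neg _ hi]
    rcases eq_or_lt_of_le (show i + 1 ≤ 0 by omega) with h | h
    · simp [h]
    · rw [zcoeff_of_neg _ h, smul_zero]
  · obtain ⟨i, rfl⟩ := Int.eq_ofNat_of_zero_le hi
    rw [show (i : ℤ) + 1 = ((i + 1 : ℕ) : ℤ) by push_cast; rfl, zcoeff_natCast, zcoeff_natCast,
      PowerSeries.coeff_derivative, Algebra.smul_def, mul_comm]
    simp

end ZCoeff

section Schur
variable {L : Type*} [AddCommGroup L]

/-- The series `∑_{n ≥ 0} α s^{-n-1} z^n`. -/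
def creationSeries (α : L) : PowerSeries (Fock L) := PowerSeries.mk fun n => negGen n (toCartan α)

/-- The series `∑_{n > 0} α s^{-n} z^n / n`. -/
def schurExponent (α : L) : PowerSeries (Fock L) :=
  PowerSeries.mk fun n => if n = 0 then 0 else (n : ℂ)⁻¹ • negGen (n - 1) (toCartan α)

/-- The series `exp (∑_{n > 0} α s^{-n} z^n / n)` of elementary Schur polynomials. -/
def schur (α : L) : PowerSeries (Fock L) := formalExp (schurExponent α)

theorem coeff_zero_schurExponent (α : L) : PowerSeries.coeff 0 (schurExponent α) = 0 := by
  simp [schurExponent]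

theorem coeff_zero_schur (α : L) : PowerSeries.coeff 0 (schur α) = 1 := coeff_zero_formalExp

/-- The differential equation of the Schur polynomials. -/
theorem derivative_schur (α : L) :
    PowerSeries.derivative (Fock L) (schur α) = creationSeries α * schur α := by
  ext n
  have h := smul_coeff_formalExp (coeff_zero_schurExponent α) (fun i j => Commute.all _ _) (n + 1)
  rw [Finset.Nat.sum_antidiagonal_succ] at h
  rw [PowerSeries.coeff_derivative, PowerSeries.coeff_mul, mul_comm]
  simp only [Nat.cast_zero, zero_smul, zero_mul, zero_add] at h
  refine Eq.trans ?_ (h.trans (Finset.sum_congr rfl fun ij _ => ?_))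
  · simp [Algebra.smul_def, schur]
  · have : ((ij.1 + 1 : ℕ) : ℂ) ≠ 0 := Nat.cast_ne_zero.2 (Nat.succ_ne_zero _)
    simp only [schurExponent, creationSeries, PowerSeries.coeff_mk, Nat.succ_ne_zero, if_false,
      Nat.add_sub_cancel, smul_smul, mul_inv_cancel₀ this, one_smul, schur]

/-- A power series is determined by its logarithmic derivative and its constant term. -/
theorem eq_of_derivative_eq_mul {S : Type*} [CommRing S] [Algebra ℂ S] {f g X : PowerSeries S}
    (h0 : PowerSeries.coeff 0 f = PowerSeries.coeff 0 g)
    (hf : PowerSeries.derivative S f = X * f) (hg : PowerSeries.derivative S g = X * g) :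
    f = g := by
  ext n
  induction n using Nat.strong_induction_on with
  | _ n ih =>
    cases n with
    | zero => exact h0
    | succ n =>
      have key : ∀ f : PowerSeries S, PowerSeries.derivative S f = X * f →
          ((n + 1 : ℕ) : ℂ) • PowerSeries.coeff (n + 1) f =
            ∑ ij ∈ Finset.HasAntidiagonal.antidiagonal n,
              PowerSeries.coeff ij.1 X * PowerSeries.coeff ij.2 f := fun f hf => by
        rw [← PowerSeries.coeff_mul, ← hf, PowerSeries.coeff_derivative, mul_comm, Algebra.smul_def]
        simp
      have h1 : ((n + 1 : ℕ) : ℂ) ≠ 0 := Nat.cast_ne_zero.2 (Nat.succ_ne_zero _)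
      refine smul_right_injective S h1 ?_
      simp only
      rw [key f hf, key g hg]
      refine Finset.sum_congr rfl fun ij hij => ?_
      rw [Finset.HasAntidiagonal.mem_antidiagonal] at hij
      rw [ih ij.2 (by omega)]

theorem toCartan_add (α β : L) : toCartan (α + β) = toCartan α + toCartan β :=
  TensorProduct.tmul_add _ _ _

theorem schur_add (α β : L) : schur (α + β) = schur α * schur β := by
  refine eq_of_derivative_eq_mul (X := creationSeries (α + β)) ?_ (derivative_schur _) ?_
  · simp only [PowerSeries.coeff_mul, Finset.HasAntidiagonal.antidiagonal_zero,
      Finset.sum_singleton, coeff_zero_schur, mul_one]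
  · have : creationSeries (α + β) = creationSeries α + creationSeries β := by
      ext n
      simp [creationSeries, toCartan_add]
    rw [Derivation.leibniz, derivative_schur, derivative_schur, this]
    simp only [smul_eq_mul]
    ring

/-- The creation part of `E^α(w)` is an eigenvector of `h_{(n+1)}` with eigenvalue
`(h | α) w^{n+1}`. -/
theorem lowering_zcoeff_schur (B : LinearMap.BilinForm ℤ L) (n : ℕ) (h : Cartan L) (α : L) (i : ℤ) :
    lowering B n h (zcoeff (schur α) i) =
      B.baseChange ℂ h (toCartan α) • zcoeff (schur α) (i - n - 1) := by
  rcases lt_or_ge i 0 with hi | hi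
  · rw [zcoeff_of_neg _ hi, zcoeff_of_neg _ (by omega), map_zero, smul_zero]
  obtain ⟨i, rfl⟩ := Int.eq_ofNat_of_zero_le hi
  rw [zcoeff_natCast, schur, formalExp_leibniz (fun _ => lowering B n h)
    (fun i j x y => by rw [lowering_mul, add_comm])
    (X := B.baseChange ℂ h (toCartan α) • PowerSeries.X ^ (n + 1))
    (coeff_zero_schurExponent α) (fun m => ?_) (Commute.all _ _), smul_mul_assoc,
    coeff_smul_complex, PowerSeries.coeff_X_pow_mul']
  · congr 1
    split_ifs with hn
    · rw [show (i : ℤ) - n - 1 = ((i - (n + 1) : ℕ) : ℤ) by omega, zcoeff_natCast]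
    · rw [zcoeff_of_neg _ (by omega)]
  · rw [coeff_smul_complex, PowerSeries.coeff_X_pow, schurExponent, PowerSeries.coeff_mk]
    cases m with
    | zero => simp
    | succ m =>
      have h1 : ((m + 1 : ℕ) : ℂ) ≠ 0 := Nat.cast_ne_zero.2 (Nat.succ_ne_zero _)
      simp only [Nat.succ_ne_zero, if_false, Nat.add_sub_cancel, map_smul, negGen,
        LinearMap.comp_apply, lowering_ι, Finsupp.lsingle_apply, Finsupp.single_apply,
        Nat.add_right_cancel_iff]
      by_cases hmn : m = n
      · subst hmn
        simp only [if_true, Algebra.algebraMap_eq_smul_one, smul_smul]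
        congr 1
        push_cast at h1 ⊢
        field_simp
      · simp [hmn]

end Schur

/-! ### The exponential of the annihilation operators -/

section Annihilation
variable {L : Type*} [AddCommGroup L]

/-- The exponent `-∑_{n > 0} α_{(n)} z^{-n} / n`, as a series in `z⁻¹` of operators on `Sym`. -/
def loweringExponent (B : LinearMap.BilinForm ℤ L) (α : L) :
    PowerSeries (Module.End ℂ (Fock L)) :=
  PowerSeries.mk fun n => if n = 0 then 0 else (-(n : ℂ)⁻¹) • lowering B (n - 1) (toCartan α)

/-- The series `exp (-∑_{n > 0} α_{(n)} z^{-n} / n)` of operators on `Sym`. -/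
def expLowering (B : LinearMap.BilinForm ℤ L) (α : L) : PowerSeries (Module.End ℂ (Fock L)) :=
  formalExp (loweringExponent B α)

theorem coeff_zero_loweringExponent (B : LinearMap.BilinForm ℤ L) (α : L) :
    PowerSeries.coeff 0 (loweringExponent B α) = 0 := by
  simp [loweringExponent]

theorem lowering_commute (B : LinearMap.BilinForm ℤ L) (m n : ℕ) (h h' : Cartan L) :
    Commute (lowering B m h) (lowering B n h') :=
  LinearMap.ext fun x => contraction_comm _ _ x

/-- The coefficients of `(1 - u)^N`, defined by the recursion that comes from the logarithmic
derivative `-N / (1 - u)`. -/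
structure IsBinomialSeries (N : ℤ) (b : ℕ → ℂ) : Prop where
  zero : b 0 = 1
  recursion : ∀ j : ℕ, (j : ℂ) * b j = -(N : ℂ) * ∑ k ∈ Finset.range j, b k

theorem coeff_expLowering_recursion (B : LinearMap.BilinForm ℤ L) (α : L) (j : ℕ) :
    (j : ℂ) • PowerSeries.coeff j (expLowering B α) =
      -∑ k ∈ Finset.range j,
        lowering B (j - 1 - k) (toCartan α) * PowerSeries.coeff k (expLowering B α) := by
  cases j with
  | zero => simp
  | succ j =>
    have h := smul_coeff_formalExp (coeff_zero_loweringExponent B α) (fun i j => by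
      simp only [loweringExponent, PowerSeries.coeff_mk]
      split_ifs
      exacts [.zero_left _, .zero_left _, .zero_right _,
        ((lowering_commute B _ _ _ _).smul_left _).smul_right _]) (j + 1)
    rw [Finset.Nat.sum_antidiagonal_succ] at h
    simp only [Nat.cast_zero, zero_smul, zero_mul, zero_add] at h
    rw [expLowering, h, ← Finset.Nat.sum_antidiagonal_swap,
      Finset.Nat.sum_antidiagonal_eq_sum_range_succ_mk, ← Finset.sum_neg_distrib]
    refine Finset.sum_congr rfl fun k hk => ?_
    have : ((j - k + 1 : ℕ) : ℂ) ≠ 0 := Nat.cast_ne_zero.2 (Nat.succ_ne_zero _)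
    simp only [Prod.swap, loweringExponent, PowerSeries.coeff_mk, Nat.succ_ne_zero, if_false,
      Nat.add_sub_cancel, smul_smul, mul_neg, mul_inv_cancel₀ this, neg_smul, one_smul]
    rfl

/-- Moving the annihilation part of `E^α(z)` past the creation part of `E^β(w)` costs the factor
`(1 - w / z)^{(α | β)}`. -/
theorem coeff_expLowering_zcoeff_schur (B : LinearMap.BilinForm ℤ L) (α β : L) {b : ℕ → ℂ}
    (hb : IsBinomialSeries (B α β) b) (j : ℕ) (i : ℤ) :
    PowerSeries.coeff j (expLowering B α) (zcoeff (schur β) i) =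
      b j • zcoeff (schur β) (i - j) := by
  induction j using Nat.strong_induction_on with
  | _ j ih =>
    rcases Nat.eq_zero_or_pos j with rfl | hj
    · simp [expLowering, coeff_zero_formalExp, hb.zero]
    · have h1 : (j : ℂ) ≠ 0 := Nat.cast_ne_zero.2 hj.ne'
      refine smul_right_injective _ h1 ?_
      simp only
      rw [← LinearMap.smul_apply, coeff_expLowering_recursion, smul_smul, hb.recursion,
        LinearMap.neg_apply, LinearMap.sum_apply, Finset.mul_sum, Finset.sum_smul,
        ← Finset.sum_neg_distrib]
      refine Finset.sum_congr rfl fun k hk => ?_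
      rw [Finset.mem_range] at hk
      rw [Module.End.mul_apply, ih k hk, map_smul, lowering_zcoeff_schur,
        show i - k - (j - 1 - k : ℕ) - 1 = i - j by omega, smul_smul, ← neg_smul]
      congr 1
      simp [toCartan]
      ring

/-- `[h_{(-n-1)}, exp (-∑ α_{(k)} z^{-k} / k)] = (h | α) z^{-n-1} exp (-∑ α_{(k)} z^{-k} / k)`. -/
theorem commutator_coeff_expLowering (B : LinearMap.BilinForm ℤ L) (hB : LinearMap.IsSymm B) (n : ℕ)
    (h : Cartan L) (α : L) (j : ℕ) :
    LinearMap.mul ℂ (Fock L) (negGen n h) * PowerSeries.coeff j (expLowering B α) -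
      PowerSeries.coeff j (expLowering B α) * LinearMap.mul ℂ (Fock L) (negGen n h) =
      if n + 1 ≤ j then B.baseChange ℂ h (toCartan α) •
        PowerSeries.coeff (j - (n + 1)) (expLowering B α) else 0 := by
  refine commutator_coeff_formalExp (coeff_zero_loweringExponent B α) (fun m => ?_) j
  rw [loweringExponent, PowerSeries.coeff_mk]
  cases m with
  | zero => simp
  | succ m =>
    have hs : B.baseChange ℂ (toCartan α) h = B.baseChange ℂ h (toCartan α) :=
      ((LinearMap.BilinForm.IsSymm.baseChange ℂ hB).eq _ _)
    have h1 : ((m + 1 : ℕ) : ℂ) ≠ 0 := Nat.cast_ne_zero.2 (Nat.succ_ne_zero _)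
    refine LinearMap.ext fun x => ?_
    simp only [Nat.succ_ne_zero, if_false, Nat.add_sub_cancel, LinearMap.sub_apply,
      Module.End.mul_apply, LinearMap.smul_apply, LinearMap.mul_apply', lowering_mul, negGen,
      LinearMap.comp_apply, lowering_ι, Finsupp.lsingle_apply, Finsupp.single_apply,
      Nat.add_right_cancel_iff]
    by_cases hmn : m = n
    · subst hmn
      simp only [if_true, Algebra.algebraMap_eq_smul_one, smul_add, mul_smul_comm, hs]
      rw [sub_add_cancel_left, smul_mul_assoc, one_mul, smul_smul, ← neg_smul, LinearMap.smul_apply,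
        Module.End.one_apply]
      congr 1
      push_cast at h1 ⊢
      field_simp
    · simp [hmn, Ne.symm hmn]

/-- Only finitely many terms of the annihilation part act nontrivially on a given vector. -/
theorem exists_expLowering_eq_zero (B : LinearMap.BilinForm ℤ L) (α : L) (x : Fock L) :
    ∃ K : ℕ, ∀ j, K ≤ j → PowerSeries.coeff j (expLowering B α) x = 0 := by
  obtain ⟨N, hN⟩ := exists_lvl_fock B x
  refine ⟨N + 1, fun n hn => hN.coeff_formalExp (h := toCartan α)
    (coeff_zero_loweringExponent B α) (fun n => ?_) hn⟩
  exact ⟨-((n + 1 : ℕ) : ℂ)⁻¹, by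
    rw [loweringExponent, PowerSeries.coeff_mk, if_neg (Nat.succ_ne_zero n)]; rfl⟩

end Annihilation

/-! ### The action of the fields on the space of states -/

section Action
variable {L : Type*} [AddCommGroup L]

/-- `g ↦ g ⊗ e^β` as a linear map. -/
def stateHom (β : L) : Fock L →ₗ[ℂ] StateSpace L :=
  (TensorProduct.mk ℂ (Fock L) (L →₀ ℂ)).flip (Finsupp.single β 1)

theorem stateHom_apply (β : L) (g : Fock L) : stateHom β g = stateOf g β := rfl

/-- An operator on the space of states is determined by its values on the vectors `g ⊗ e^β`. -/
theorem end_ext {T T' : Module.End ℂ (StateSpace L)}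
    (h : ∀ g β, T (stateHom β g) = T' (stateHom β g)) : T = T' := by
  refine TensorProduct.ext' fun g b => ?_
  induction b using Finsupp.induction_linear with
  | zero => simp
  | add b b' hb hb' => rw [TensorProduct.tmul_add, map_add, map_add, hb, hb']
  | single β c =>
    have : g ⊗ₜ[ℂ] Finsupp.single β c = c • stateHom β g := by
      rw [stateHom_apply, stateOf, ← TensorProduct.tmul_smul, Finsupp.smul_single, smul_eq_mul,
        mul_one]
    rw [this, map_smul, map_smul, h]

theorem diagonal_stateHom (c : L → ℂ) (β : L) (g : Fock L) :
    diagonal c (stateHom β g) = c β • stateHom β g := by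
  simp only [diagonal, stateHom, LinearMap.comp_apply, LinearMap.flip_apply, TensorProduct.mk_apply,
    LinearMap.coe_lTensorHom, LinearMap.lTensor_tmul, LinearMap.coe_mk, AddHom.coe_mk,
    Finsupp.lsum_single, LinearMap.smul_apply, Finsupp.lsingle_apply, TensorProduct.tmul_smul]

theorem expAct_stateHom (ε : L → L → ℤˣ) (α β : L) (g : Fock L) :
    expAct ε α (stateHom β g) = ((ε α β : ℤ) : ℂ) • stateHom (α + β) g := by
  simp only [expAct, stateHom, LinearMap.flip_apply, TensorProduct.mk_apply, LinearMap.lTensor_tmul,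
    Finsupp.lsum_single, LinearMap.smul_apply, Finsupp.lsingle_apply, TensorProduct.tmul_smul]

theorem creation_stateHom (n : ℕ) (h : Cartan L) (β : L) (g : Fock L) :
    creation n h (stateHom β g) = stateHom β (negGen n h * g) := by
  simp [creation, stateHom]

theorem annihilation_stateHom (B : LinearMap.BilinForm ℤ L) (n : ℕ) (h : Cartan L) (β : L)
    (g : Fock L) : annihilation B n h (stateHom β g) = stateHom β (lowering B n h g) := by
  simp [annihilation, stateHom]

theorem zeroMode_stateHom (B : LinearMap.BilinForm ℤ L) (h : Cartan L) (β : L) (g : Fock L) :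
    zeroMode B h (stateHom β g) = B.baseChange ℂ h (toCartan β) • stateHom β g := by
  rw [zeroMode, LinearMap.comp_apply, diagonal_stateHom]
  rfl

theorem coeff_expCreation_stateHom (B : LinearMap.BilinForm ℤ L) (α β : L) (i : ℕ) (g : Fock L) :
    PowerSeries.coeff i (expCreation B α) (stateHom β g) =
      stateHom β (PowerSeries.coeff i (schur α) * g) := by
  refine formalExp_intertwine (a := schurExponent α) (stateHom β) (fun n u => ?_) i g
  rw [schurExponent, PowerSeries.coeff_mk, PowerSeries.coeff_mk]
  cases n with
  | zero => simp
  | succ n =>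
    simp only [Nat.succ_ne_zero, if_false, LinearMap.smul_apply, smul_eq_mul,
      smul_mul_assoc, map_smul]
    exact congrArg _ (creation_stateHom n (toCartan α) β u)

theorem coeff_expAnnihilation_stateHom (B : LinearMap.BilinForm ℤ L) (α β : L) (i : ℕ)
    (g : Fock L) : PowerSeries.coeff i (expAnnihilation B α) (stateHom β g) =
      stateHom β (PowerSeries.coeff i (expLowering B α) g) := by
  refine formalExp_intertwine (a := loweringExponent B α) (stateHom β) (fun n u => ?_) i g
  rw [loweringExponent, PowerSeries.coeff_mk, PowerSeries.coeff_mk]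
  cases n with
  | zero => simp
  | succ n =>
    simp only [Nat.succ_ne_zero, if_false, LinearMap.smul_apply, map_smul, Module.End.smul_def]
    exact congrArg _ (annihilation_stateHom B n (toCartan α) β u)

/-- The coefficient of `z^N` in `E^α(z)`. -/
abbrev expMode (B : LinearMap.BilinForm ℤ L) (ε : L → L → ℤˣ) (α : L) (N : ℤ) :
    Module.End ℂ (StateSpace L) := HVertexOperator.coeff (expField B ε α) N

/-- The action of `E^α(z)` on `g ⊗ e^β`. The factor `z^{α_{(0)}}` shifts the exponent by `(α | β)`,
so that a term of degree `-j` of the annihilation part is met by a single term of the creation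
part. -/
theorem expMode_stateHom (B : LinearMap.BilinForm ℤ L) (ε : L → L → ℤˣ) (α β : L) (N : ℤ)
    {g : Fock L} {K : ℕ} (hK : ∀ j, K ≤ j → PowerSeries.coeff j (expLowering B α) g = 0) :
    expMode B ε α N (stateHom β g) = ((ε α β : ℤ) : ℂ) • stateHom (α + β)
      (∑ j ∈ Finset.range K, zcoeff (schur α) (N - B α β + j) *
        PowerSeries.coeff j (expLowering B α) g) := by
  have term : ∀ i j : ℕ, (expAct ε α * zPow B α (N - i + j) *
      PowerSeries.coeff i (expCreation B α) * PowerSeries.coeff j (expAnnihilation B α))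
      (stateHom β g) = if B α β = N - i + j then ((ε α β : ℤ) : ℂ) • stateHom (α + β)
        (PowerSeries.coeff i (schur α) * PowerSeries.coeff j (expLowering B α) g) else 0 := by
    intro i j
    simp only [Module.End.mul_apply, coeff_expAnnihilation_stateHom, coeff_expCreation_stateHom,
      zPow, diagonal_stateHom]
    split_ifs <;> simp [expAct_stateHom]
  change ∑ᶠ ij : ℕ × ℕ, (expAct ε α * zPow B α (N - ij.1 + ij.2) *
      PowerSeries.coeff ij.1 (expCreation B α) * PowerSeries.coeff ij.2 (expAnnihilation B α))
      (stateHom β g) = _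
  simp only [term]
  rw [finsum_eq_sum_of_support_subset (s := (Finset.range K).image
    fun j : ℕ => ((N - B α β + j).toNat, j)), Finset.sum_image, map_sum, Finset.smul_sum]
  · refine Finset.sum_congr rfl fun j _ => ?_
    by_cases h : 0 ≤ N - B α β + j
    · rw [if_pos (by simp only; omega), zcoeff, if_pos h]
    · rw [if_neg (by simp only; omega), zcoeff, if_neg h, zero_mul, map_zero, smul_zero]
  · intro j _ j' _ h
    exact congrArg Prod.snd h
  · rintro ⟨i, j⟩ hij
    rw [Function.mem_support] at hij
    simp only [ne_eq, ite_eq_right_iff, Classical.not_imp] at hij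
    rw [Finset.coe_image]
    refine ⟨j, ?_, ?_⟩
    · rw [Finset.mem_coe, Finset.mem_range]
      by_contra hj
      exact hij.2 (by rw [hK j (by omega), mul_zero, map_zero, smul_zero])
    · simp only [Prod.mk.injEq, and_true]
      omega

theorem isBinomialSeries_zero : IsBinomialSeries 0 fun j => if j = 0 then 1 else 0 :=
  ⟨by simp, fun j => by simp⟩

/-- The action of `E^α(z)` on the coefficients of `E^β(w) e^γ`. -/
theorem expMode_stateHom_schur (B : LinearMap.BilinForm ℤ L) (ε : L → L → ℤˣ) (α β γ : L) (N i : ℤ)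
    {b : ℕ → ℂ} (hb : IsBinomialSeries (B α β) b) {K : ℕ} (hK : i < K) :
    expMode B ε α N (stateHom γ (zcoeff (schur β) i)) = ((ε α γ : ℤ) : ℂ) • stateHom (α + γ)
      (∑ j ∈ Finset.range K, b j • (zcoeff (schur α) (N - B α γ + j) *
        zcoeff (schur β) (i - j))) := by
  rw [expMode_stateHom B ε α γ N (K := K) fun j hj => by
    rw [coeff_expLowering_zcoeff_schur B α β hb, zcoeff_of_neg _ (by omega), smul_zero]]
  simp only [coeff_expLowering_zcoeff_schur B α β hb, mul_smul_comm]

theorem expMode_vacuum (B : LinearMap.BilinForm ℤ L) (ε : L → L → ℤˣ) (α γ : L) (N : ℤ) :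
    expMode B ε α N (stateHom γ 1) =
      ((ε α γ : ℤ) : ℂ) • stateHom (α + γ) (zcoeff (schur α) (N - B α γ)) := by
  have h0 : zcoeff (schur (0 : L)) 0 = 1 := by
    rw [← coeff_zero_schur (0 : L)]
    exact zcoeff_natCast _ 0
  have := expMode_stateHom_schur B ε α 0 γ N 0 (K := 1) (by simpa using isBinomialSeries_zero)
    (by norm_num)
  simpa [h0] using this

/-- The commutation relations of the Heisenberg algebra. -/
theorem heisenberg_heisenberg (B : LinearMap.BilinForm ℤ L) (hB : LinearMap.IsSymm B) (j k : ℤ)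
    (h h' : Cartan L) (v : StateSpace L) : heisenberg B j h (heisenberg B k h' v) =
      heisenberg B k h' (heisenberg B j h v) +
        (if j + k = 0 then (j : ℂ) * B.baseChange ℂ h h' else 0) • v := by
  have hs : ∀ h h', B.baseChange ℂ h h' = B.baseChange ℂ h' h := fun h h' =>
    (LinearMap.BilinForm.IsSymm.baseChange ℂ hB).eq h h'
  -- The case of two creation operators or of two other operators is part of the commutativity of
  -- the halves of a Heisenberg field; the remaining case is that of a contraction with a generator.
  have mixed : ∀ (n : ℕ) (k : ℤ) (h h' : Cartan L), 0 ≤ k →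
      heisenberg B k h' (heisenberg B (Int.negSucc n) h v) =
        heisenberg B (Int.negSucc n) h (heisenberg B k h' v) +
        (if k + Int.negSucc n = 0 then (k : ℂ) * B.baseChange ℂ h h' else 0) • v := by
    intro n k h h' hk
    obtain ⟨k, rfl⟩ := Int.eq_ofNat_of_zero_le hk
    cases k with
    | zero =>
      rw [if_neg (by simp), zero_smul, add_zero]
      exact LinearMap.congr_fun (diagonal_commute_rTensor _ _).eq v
    | succ k =>
      change (annihilation B k h' * creation n h) v = (creation n h * annihilation B k h' +
        (if ((k + 1 : ℕ) : ℤ) + Int.negSucc n = 0 then (((k + 1 : ℕ) : ℤ) : ℂ) * B.baseChange ℂ h h'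
          else 0) • 1) v
      refine LinearMap.congr_fun (end_ext fun g β => ?_) v
      rw [LinearMap.add_apply, Module.End.mul_apply, Module.End.mul_apply, LinearMap.smul_apply,
        annihilation_stateHom, creation_stateHom, creation_stateHom, annihilation_stateHom,
        Module.End.one_apply, ← map_smul, ← map_add, lowering_mul, negGen, LinearMap.comp_apply,
        lowering_ι, Algebra.smul_def]
      simp only [Finsupp.lsingle_apply, Finsupp.single_apply]
      by_cases hkn : n = k
      · subst hkn
        rw [if_pos rfl, if_pos (by rw [Int.negSucc_eq]; push_cast; ring), hs]
        push_cast
        rfl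
      · rw [if_neg hkn, if_neg (by rw [Int.negSucc_eq]; push_cast; omega)]
        simp
  have halves := heisenbergField_halvesCommute B h h'
  by_cases hj : j < 0
  · by_cases hk : k < 0
    · rw [if_neg (by omega), zero_smul, add_zero]
      have := LinearMap.congr_fun (halves.1 (-j - 1) (-k - 1) (by omega) (by omega)).eq v
      change heisenberg B (-(-j - 1) - 1) h (heisenberg B (-(-k - 1) - 1) h' v) =
        heisenberg B (-(-k - 1) - 1) h' (heisenberg B (-(-j - 1) - 1) h v) at this
      simpa using this
    · obtain ⟨n, rfl⟩ := Int.eq_negSucc_of_lt_zero hj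
      rw [mixed n k h h' (by omega), add_assoc, ← add_smul, add_comm k]
      split_ifs with hjn
      · rw [show (k : ℂ) = -((Int.negSucc n : ℤ) : ℂ) by
          rw [← Int.cast_neg]; exact congrArg _ (by omega), neg_mul, neg_add_cancel, zero_smul,
          add_zero]
      · simp
  · by_cases hk : k < 0
    · obtain ⟨n, rfl⟩ := Int.eq_negSucc_of_lt_zero hk
      rw [mixed n j h' h (by omega), hs h' h]
    · have := LinearMap.congr_fun (halves.2 (-j - 1) (-k - 1) (by omega) (by omega)).eq v
      change heisenberg B (-(-j - 1) - 1) h (heisenberg B (-(-k - 1) - 1) h' v) =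
        heisenberg B (-(-k - 1) - 1) h' (heisenberg B (-(-j - 1) - 1) h v) at this
      simp only [neg_sub, sub_neg_eq_add, add_sub_cancel_left] at this
      rw [this]
      split_ifs with hjk
      · rw [show j = 0 by omega]
        simp
      · simp

/-- The vectors `e^γ` generate the space of states over the creation operators; hence a family of
operators that kills them and whose span is stable under commutation with the creation operators is
zero. -/
theorem eq_zero_of_vacuum (B : LinearMap.BilinForm ℤ L) {ι : Type*}
    {X : ι → Module.End ℂ (StateSpace L)}
    (hX : ∀ i (k : ℤ) (h : Cartan L), k < 0 →
      ∃ T ∈ Submodule.span ℂ (Set.range X), ∀ v,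
        heisenberg B k h (X i v) = X i (heisenberg B k h v) + T v)
    (h0 : ∀ i γ, X i (stateHom γ 1) = 0) (i : ι) (v : StateSpace L) : X i v = 0 := by
  have key : ∀ (a : Fock L) (γ : L) (g : Fock L), (∀ i, X i (stateHom γ g) = 0) →
      ∀ i, X i (stateHom γ (a * g)) = 0 := by
    intro a γ
    induction a using SymmetricAlgebra.induction with
    | algebraMap r =>
      intro g hg i
      rw [← Algebra.smul_def, map_smul, map_smul, hg, smul_zero]
    | ι x =>
      intro g hg i
      induction x using Finsupp.induction_linear with
      | zero => simp
      | add x y hx hy => rw [map_add, add_mul, map_add, map_add, hx, hy, add_zero]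
      | single n h =>
        have hspan : ∀ T ∈ Submodule.span ℂ (Set.range X), T (stateHom γ g) = 0 := by
          intro T hT
          induction hT using Submodule.span_induction with
          | mem T hT =>
            obtain ⟨j, rfl⟩ := hT
            exact hg j
          | zero => rfl
          | add S T _ _ hS hT => rw [LinearMap.add_apply, hS, hT, add_zero]
          | smul c T _ hT => rw [LinearMap.smul_apply, hT, smul_zero]
        obtain ⟨T, hT, h1⟩ := hX i (Int.negSucc n) h (Int.negSucc_lt_zero n)
        have h2 : creation n h (X i (stateHom γ g)) = X i (creation n h (stateHom γ g)) + _ := h1 _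
        rw [hg, map_zero, hspan T hT, add_zero, creation_stateHom] at h2
        exact h2.symm
    | mul a b ha hb =>
      intro g hg i
      rw [mul_assoc]
      exact ha _ (hb g hg) i
    | add a b ha hb =>
      intro g hg i
      rw [add_mul, map_add, map_add, ha g hg, hb g hg, add_zero]
  refine LinearMap.congr_fun (end_ext fun g γ => ?_ : X i = 0) v
  have := key g γ 1 (fun i => h0 i γ) i
  rwa [mul_one] at this

/-- The commutator of `E^α(z)` with a Heisenberg operator:
`[h_{(k)}, E^α(z)] = (h | α) z^k E^α(z)`. -/
theorem heisenberg_expMode (B : LinearMap.BilinForm ℤ L) (hB : LinearMap.IsSymm B)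
    (ε : L → L → ℤˣ) (α : L) (k : ℤ) (h : Cartan L) (N : ℤ) (v : StateSpace L) :
    heisenberg B k h (expMode B ε α N v) = expMode B ε α N (heisenberg B k h v) +
      B.baseChange ℂ h (toCartan α) • expMode B ε α (N - k) v := by
  -- The creation operators are treated directly; with this case at hand, the uniqueness principle
  -- reduces the operators `h_{(k)}` with `k ≥ 0` to their action on the vectors `e^γ`.
  have neg : ∀ (n : ℕ) (h : Cartan L) (N : ℤ) (v : StateSpace L),
      heisenberg B (Int.negSucc n) h (expMode B ε α N v) =
        expMode B ε α N (heisenberg B (Int.negSucc n) h v) +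
        B.baseChange ℂ h (toCartan α) • expMode B ε α (N - Int.negSucc n) v := by
    intro n h N v
    refine LinearMap.congr_fun (end_ext fun g γ => ?_ : creation n h * expMode B ε α N =
      expMode B ε α N * creation n h +
        B.baseChange ℂ h (toCartan α) • expMode B ε α (N - Int.negSucc n)) v
    obtain ⟨K₁, hK₁⟩ := exists_expLowering_eq_zero B α g
    obtain ⟨K₂, hK₂⟩ := exists_expLowering_eq_zero B α (negGen n h * g)
    rw [LinearMap.add_apply, Module.End.mul_apply, Module.End.mul_apply, LinearMap.smul_apply,
      creation_stateHom,
      expMode_stateHom B ε α γ N (K := n + 1 + max K₁ K₂) fun j hj => hK₁ j (by omega),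
      expMode_stateHom B ε α γ N (K := n + 1 + max K₁ K₂) fun j hj => hK₂ j (by omega),
      expMode_stateHom B ε α γ _ (K := max K₁ K₂) fun j hj => hK₁ j (by omega),
      map_smul, creation_stateHom, smul_comm (B.baseChange ℂ h (toCartan α)), ← smul_add,
      ← map_smul (stateHom _) (B.baseChange ℂ h (toCartan α)), ← map_add]
    congr 2
    rw [← sub_eq_iff_eq_add', Finset.mul_sum, ← Finset.sum_sub_distrib, Finset.sum_range_add,
      Finset.smul_sum, Finset.sum_eq_zero, zero_add]
    · refine Finset.sum_congr rfl fun j _ => ?_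
      have := LinearMap.congr_fun (commutator_coeff_expLowering B hB n h α (n + 1 + j)) g
      rw [if_pos (by omega), Nat.add_sub_cancel_left] at this
      simp only [LinearMap.sub_apply, Module.End.mul_apply, LinearMap.mul_apply',
        LinearMap.smul_apply] at this
      rw [mul_left_comm, ← mul_sub, this, mul_smul_comm, Int.negSucc_eq]
      congr 3
      push_cast
      ring
    · intro j hj
      rw [Finset.mem_range] at hj
      have := LinearMap.congr_fun (commutator_coeff_expLowering B hB n h α j) g
      rw [if_neg (by omega)] at this
      simp only [LinearMap.sub_apply, Module.End.mul_apply, LinearMap.mul_apply',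
        LinearMap.zero_apply] at this
      rw [mul_left_comm, ← mul_sub, this, mul_zero]
  rcases lt_or_ge k 0 with hk | hk
  · obtain ⟨n, rfl⟩ := Int.eq_negSucc_of_lt_zero hk
    exact neg n h N v
  have key := eq_zero_of_vacuum B (X := fun N => heisenberg B k h * expMode B ε α N -
      (expMode B ε α N * heisenberg B k h + B.baseChange ℂ h (toCartan α) • expMode B ε α (N - k)))
      (fun N j h' hj => ?_) (fun N γ => ?_) N v
  · exact sub_eq_zero.1 key
  · obtain ⟨n, rfl⟩ := Int.eq_negSucc_of_lt_zero hj
    refine ⟨_, Submodule.smul_mem _ (B.baseChange ℂ h' (toCartan α)) (Submodule.subset_span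
      (Set.mem_range_self (N - Int.negSucc n))), fun v => ?_⟩
    simp only [LinearMap.sub_apply, LinearMap.add_apply, LinearMap.smul_apply, Module.End.mul_apply,
      map_sub, map_add, map_smul, neg, heisenberg_heisenberg B hB (Int.negSucc n) k]
    rw [show N - Int.negSucc n - k = N - k - Int.negSucc n by ring]
    module
  · obtain ⟨k, rfl⟩ := Int.eq_ofNat_of_zero_le hk
    rw [LinearMap.sub_apply, LinearMap.add_apply, LinearMap.smul_apply, Module.End.mul_apply,
      Module.End.mul_apply, expMode_vacuum, expMode_vacuum]
    cases k with
    | zero =>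
      change zeroMode B h _ - (expMode B ε α N (zeroMode B h _) + _) = 0
      rw [map_smul, zeroMode_stateHom, zeroMode_stateHom, map_smul, expMode_vacuum, toCartan_add,
        map_add, Nat.cast_zero, sub_zero]
      module
    | succ k =>
      change annihilation B k h _ - (expMode B ε α N (annihilation B k h _) + _) = 0
      have : lowering B k h (1 : Fock L) = 0 := by
        simpa using lowering_algebraMap B k h 1
      rw [map_smul, annihilation_stateHom, annihilation_stateHom, this, map_zero, map_zero,
        zero_add, lowering_zcoeff_schur, map_smul, smul_comm,
        show N - B α γ - k - 1 = N - (k + 1 : ℕ) - B α γ by push_cast; ring, sub_self]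

end Action

/-! ### Normally ordered products with a Heisenberg field -/

section Current
variable {L : Type*} [AddCommGroup L]

/-- The coefficients of a normally ordered product, evaluated at a vector, as finite sums with a
common large bound. -/
theorem coeff_normalOrder {W : Type*} [AddCommGroup W] [Module ℂ W] (H A : VertexOperator ℂ W)
    (N : ℤ) (v : W) : ∃ K₀ : ℕ, ∀ K, K₀ ≤ K → HVertexOperator.coeff (normalOrder H A) N v =
      ∑ i ∈ Finset.range K, HVertexOperator.coeff H i (HVertexOperator.coeff A (N - i) v) +
      ∑ i ∈ Finset.range K,
        HVertexOperator.coeff A (N + i + 1) (HVertexOperator.coeff H (-i - 1) v) := by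
  obtain ⟨n, hn⟩ := exists_coeff_eq_zero A v
  obtain ⟨n', hn'⟩ := exists_coeff_eq_zero H v
  refine ⟨max (N - n + 1).toNat (-n').toNat, fun K hK => ?_⟩
  change HVertexOperator.coeff (nonnegMul H A) N v + HVertexOperator.coeff (mulNeg H A) N v = _
  rw [coeff_nonnegMul, coeff_mulNeg,
    finsum_eq_range K fun i hi => by rw [hn _ (by omega), map_zero],
    finsum_eq_range K fun i hi => by rw [hn' _ (by omega), map_zero]]

/-- The coefficient of `z^N` in `:h(z) E^α(z):`. -/
abbrev currentMode (B : LinearMap.BilinForm ℤ L) (ε : L → L → ℤˣ) (h : Cartan L) (α : L) (N : ℤ) :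
    Module.End ℂ (StateSpace L) :=
  HVertexOperator.coeff (normalOrder (heisenbergField B h) (expField B ε α)) N

/-- `coeff_normalOrder` in terms of the Heisenberg operators. -/
theorem currentMode_apply (B : LinearMap.BilinForm ℤ L) (ε : L → L → ℤˣ) (h : Cartan L) (α : L)
    (N : ℤ) (v : StateSpace L) : ∃ K₀ : ℕ, ∀ K, K₀ ≤ K → currentMode B ε h α N v =
      ∑ i ∈ Finset.range K, heisenberg B (-i - 1) h (expMode B ε α (N - i) v) +
      ∑ i ∈ Finset.range K, expMode B ε α (N + i + 1) (heisenberg B i h v) := by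
  obtain ⟨K₀, hK₀⟩ := coeff_normalOrder (heisenbergField B h) (expField B ε α) N v
  refine ⟨K₀, fun K hK => (hK₀ K hK).trans ?_⟩
  congr 1
  refine Finset.sum_congr rfl fun i _ => congrArg _ ?_
  change heisenberg B (-(-i - 1) - 1) h v = _
  rw [show -(-(i : ℤ) - 1) - 1 = i by ring]

/-- Exactly one of the two sums picks up the scalar `[h_{(k)}, h'_{(-k)}]`, the first for `k > 0`
and the second for `k ≤ 0`. -/
theorem sum_ite_add_sum_ite {W : Type*} [AddCommGroup W] [Module ℂ W] (g : ℤ → W) (c : ℂ) (N k : ℤ)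
    {K : ℕ} (hK : k.natAbs < K) :
    ∑ i ∈ Finset.range K, (if k + (-i - 1) = 0 then c else 0) • g (N - i) +
      ∑ i ∈ Finset.range K, (if k + i = 0 then c else 0) • g (N + i + 1) = c • g (N + 1 - k) := by
  by_cases hk : 0 < k
  · rw [Finset.sum_eq_single (k - 1).toNat, Finset.sum_eq_zero, add_zero, if_pos (by omega)]
    · congr 2
      omega
    · intro i _
      rw [if_neg (by omega), zero_smul]
    · intro i _ hi
      rw [if_neg (by omega), zero_smul]
    · intro hi
      rw [Finset.mem_range] at hi
      omega
  · rw [Finset.sum_eq_zero, zero_add, Finset.sum_eq_single (-k).toNat, if_pos (by omega)]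
    · congr 2
      omega
    · intro i _ hi
      rw [if_neg (by omega), zero_smul]
    · intro hi
      rw [Finset.mem_range] at hi
      omega
    · intro i _
      rw [if_neg (by omega), zero_smul]

/-- `[h_{(k)}, :h'(z) E^α(z):] = (h | α) z^k :h'(z) E^α(z): + k (h | h') z^{k-1} E^α(z)`. -/
theorem heisenberg_currentMode (B : LinearMap.BilinForm ℤ L) (hB : LinearMap.IsSymm B)
    (ε : L → L → ℤˣ) (α : L) (k : ℤ) (h h' : Cartan L) (N : ℤ) (v : StateSpace L) :
    heisenberg B k h (currentMode B ε h' α N v) = currentMode B ε h' α N (heisenberg B k h v) +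
      B.baseChange ℂ h (toCartan α) • currentMode B ε h' α (N - k) v +
      ((k : ℂ) * B.baseChange ℂ h h') • expMode B ε α (N + 1 - k) v := by
  obtain ⟨K₁, h₁⟩ := currentMode_apply B ε h' α N v
  obtain ⟨K₂, h₂⟩ := currentMode_apply B ε h' α N (heisenberg B k h v)
  obtain ⟨K₃, h₃⟩ := currentMode_apply B ε h' α (N - k) v
  let K := K₁ + K₂ + K₃ + k.natAbs + 1
  rw [h₁ K (by omega), h₂ K (by omega), h₃ K (by omega),
    ← sum_ite_add_sum_ite (fun n => expMode B ε α n v) _ N k (show k.natAbs < K by omega)]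
  simp only [map_add, map_sum, heisenberg_heisenberg B hB k, heisenberg_expMode B hB ε α k,
    map_smul, Finset.sum_add_distrib, smul_add, Finset.smul_sum, sub_right_comm N _ k]
  simp only [show ∀ i : ℕ, N - k + i + 1 = N + i + 1 - k from fun i => by ring]
  abel

/-- The commutator of `:h(z) E^α(z):` with `E^β(w)`, if `E^α(z)` and `E^β(w)` commute. -/
theorem currentMode_expMode (B : LinearMap.BilinForm ℤ L) (hB : LinearMap.IsSymm B)
    (ε : L → L → ℤˣ) {α β : L} (hc : ∀ a b v, expMode B ε α a (expMode B ε β b v) =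
      expMode B ε β b (expMode B ε α a v)) (h : Cartan L) (a b : ℤ) (v : StateSpace L) :
    ∃ K₀ : ℕ, ∀ K, K₀ ≤ K → currentMode B ε h α a (expMode B ε β b v) =
      expMode B ε β b (currentMode B ε h α a v) + B.baseChange ℂ h (toCartan β) •
        (∑ i ∈ Finset.range K, expMode B ε α (a + 1 + i) (expMode B ε β (b - i) v) +
          ∑ i ∈ Finset.range K, expMode B ε β (b + 1 + i) (expMode B ε α (a - i) v)) := by
  obtain ⟨K₁, h₁⟩ := currentMode_apply B ε h α a v
  obtain ⟨K₂, h₂⟩ := currentMode_apply B ε h α a (expMode B ε β b v)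
  refine ⟨K₁ + K₂, fun K hK => ?_⟩
  rw [h₁ K (by omega), h₂ K (by omega)]
  simp only [map_add, map_sum, hc, heisenberg_expMode B hB ε β, map_smul, Finset.sum_add_distrib,
    smul_add, Finset.smul_sum]
  simp only [show ∀ i : ℕ, b - (-i - 1) = b + 1 + i from fun i => by ring,
    show ∀ i : ℕ, a + i + 1 = a + 1 + i from fun i => by ring]
  abel

/-- `:h(z) E^α(z):` and `E^β(w)` commute if `E^α(z)` and `E^β(w)` do and `(h | β) = 0`. -/
theorem currentMode_expMode_of_eq_zero (B : LinearMap.BilinForm ℤ L) (hB : LinearMap.IsSymm B)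
    (ε : L → L → ℤˣ) {α β : L} (hc : ∀ a b v, expMode B ε α a (expMode B ε β b v) =
      expMode B ε β b (expMode B ε α a v)) {h : Cartan L}
    (h0 : B.baseChange ℂ h (toCartan β) = 0) (a b : ℤ) (v : StateSpace L) :
    currentMode B ε h α a (expMode B ε β b v) = expMode B ε β b (currentMode B ε h α a v) := by
  obtain ⟨K₀, hK₀⟩ := currentMode_expMode B hB ε hc h a b v
  rw [hK₀ K₀ le_rfl, h0, zero_smul, add_zero]

/-- The commutator of `:h(z) E^α(z):` with `:h'(w) E^β(w):`, if `E^α(z)` and `E^β(w)` commute and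
`(h | β) = (h' | α) = 0`. -/
theorem currentMode_currentMode (B : LinearMap.BilinForm ℤ L) (hB : LinearMap.IsSymm B)
    (ε : L → L → ℤˣ) {α β : L} (hc : ∀ a b v, expMode B ε α a (expMode B ε β b v) =
      expMode B ε β b (expMode B ε α a v)) {h h' : Cartan L}
    (h0 : B.baseChange ℂ h (toCartan β) = 0) (h0' : B.baseChange ℂ h' (toCartan α) = 0)
    (a b : ℤ) (v : StateSpace L) :
    ∃ K₀ : ℕ, ∀ K, K₀ ≤ K → currentMode B ε h α a (currentMode B ε h' β b v) =
      currentMode B ε h' β b (currentMode B ε h α a v) + B.baseChange ℂ h h' •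
        (∑ i ∈ Finset.range K,
            (i : ℂ) • expMode B ε α (a + 1 + i) (expMode B ε β (b + 1 - i) v) +
          ∑ i ∈ Finset.range K,
            (-(i + 1) : ℂ) • expMode B ε β (b + 2 + i) (expMode B ε α (a - i) v)) := by
  obtain ⟨K₁, h₁⟩ := currentMode_apply B ε h α a v
  obtain ⟨K₂, h₂⟩ := currentMode_apply B ε h α a (currentMode B ε h' β b v)
  have hc' := currentMode_expMode_of_eq_zero B hB ε (fun a b v => (hc b a v).symm) h0'
  refine ⟨K₁ + K₂, fun K hK => ?_⟩
  rw [h₁ K (by omega), h₂ K (by omega)]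
  simp only [map_add, map_sum, ← hc', heisenberg_currentMode B hB ε β, h0, zero_smul, add_zero,
    map_smul, Finset.sum_add_distrib, smul_add, Finset.smul_sum]
  simp only [show ∀ i : ℕ, b + 1 - (-i - 1) = b + 2 + i from fun i => by ring,
    show ∀ i : ℕ, a + i + 1 = a + 1 + i from fun i => by ring, smul_smul,
    mul_comm _ (B.baseChange ℂ h h')]
  have : ∀ i : ℕ, (((-(i : ℤ) - 1 : ℤ) : ℂ)) = -(i + 1 : ℂ) := fun i => by push_cast; ring
  simp only [this, Int.cast_natCast]
  abel

end Current

/-! ### Two-sided sums of products of Schur polynomials -/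

section Commutators

/-- Splitting a finitely supported sum over the integers at an arbitrary place. -/
theorem sum_range_add_sum_range {S : Type*} [AddCommGroup S] (g : ℤ → S) (A M : ℤ) {K : ℕ}
    (hg : ∀ i, i < 0 ∨ M < i → g i = 0) (hK : A.natAbs + M.natAbs < K) :
    ∑ j ∈ Finset.range K, g (A + 1 + j) + ∑ j ∈ Finset.range K, g (A - j) =
      ∑ i ∈ Finset.range K, g i := by
  have h1 : ∑ᶠ i, g i = ∑ i ∈ Finset.range K, g i := by
    rw [finsum_eq_sum_of_support_subset (s := (Finset.range K).image fun j : ℕ => (j : ℤ)),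
      Finset.sum_image]
    · intro i _ j _ h
      exact Int.ofNat_injective h
    · intro i hi
      have : ¬(i < 0 ∨ M < i) := fun h => hi (hg i h)
      rw [Finset.coe_image]
      exact ⟨i.toNat, by simp; omega, by simp; omega⟩
  have h2 : ∑ᶠ i, g i = ∑ j ∈ Finset.range K, g (A + 1 + j) + ∑ j ∈ Finset.range K, g (A - j) := by
    rw [finsum_eq_sum_of_support_subset
      (s := (Finset.range K).image (fun j : ℕ => A + 1 + (j : ℤ)) ∪
        (Finset.range K).image (fun j : ℕ => A - (j : ℤ))), Finset.sum_union, Finset.sum_image,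
      Finset.sum_image]
    · intro i _ j _ h
      simp only at h
      omega
    · intro i _ j _ h
      simp only at h
      omega
    · rw [Finset.disjoint_left]
      intro i hi hi'
      simp only [Finset.mem_image] at hi hi'
      obtain ⟨j, _, rfl⟩ := hi
      obtain ⟨j', _, h⟩ := hi'
      omega
    · intro i hi
      have : ¬(i < 0 ∨ M < i) := fun h => hi (hg i h)
      rw [Finset.mem_coe, Finset.mem_union, Finset.mem_image, Finset.mem_image]
      by_cases h : A < i
      · exact Or.inl ⟨(i - A - 1).toNat, by simp; omega, by omega⟩
      · exact Or.inr ⟨(A - i).toNat, by simp; omega, by omega⟩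
  rw [← h1, h2]

variable {L : Type*} [AddCommGroup L]

/-- The product of two Schur polynomials. -/
abbrev schurProd (α β : L) (i j : ℤ) : Fock L := zcoeff (schur α) i * zcoeff (schur β) j

theorem schurProd_eq_zero (α β : L) {i j : ℤ} (h : i < 0 ∨ j < 0) : schurProd α β i j = 0 := by
  rcases h with h | h
  · rw [schurProd, zcoeff_of_neg _ h, zero_mul]
  · rw [schurProd, zcoeff_of_neg _ h, mul_zero]

/-- `δ(z - w) E^{α+β}(w)` on the level of Schur polynomials: the product formula for
`schur (α + β)`, split at `A` into an expansion in `w / z` and one in `z / w`. -/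
theorem zcoeff_schur_add (α β : L) (A B : ℤ) {K : ℕ} (hK : 2 * A.natAbs + B.natAbs + 1 < K) :
    zcoeff (schur (α + β)) (A + B + 1) =
      ∑ j ∈ Finset.range K, schurProd α β (A + 1 + j) (B - j) +
        ∑ j ∈ Finset.range K, schurProd α β (A - j) (B + 1 + j) := by
  have := sum_range_add_sum_range (fun i => schurProd α β i (A + B + 1 - i)) A (A + B + 1) (K := K)
    (fun i hi => schurProd_eq_zero α β (by omega)) (by omega)
  rw [schur_add, zcoeff_mul _ _ (show A + B + 1 < K by omega)]
  simp only [← zcoeff_natCast]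
  rw [← this]
  congr 1 <;> refine Finset.sum_congr rfl fun i _ => ?_
  · rw [show A + B + 1 - (A + 1 + i) = B - i by ring]
  · rw [show A + B + 1 - (A - i) = B + 1 + i by ring]

/-- The analogue of `zcoeff_schur_add` for a pole of order two: the product formula for
`schur (α + β)` weighted by the signed distance from the place `A + 1` of the splitting. The weight
comes from the derivative of `schur α`. -/
theorem sum_negGen_mul_zcoeff_schur (α β : L) (A B : ℤ) {K : ℕ}
    (hK : 2 * A.natAbs + B.natAbs + 2 < K) :
    ∑ k ∈ Finset.range K, negGen k (toCartan α) * zcoeff (schur (α + β)) (A + B + 1 - k) -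
        (A + 1 : ℂ) • zcoeff (schur (α + β)) (A + B + 2) =
      ∑ j ∈ Finset.range K, (j : ℂ) • schurProd α β (A + 1 + j) (B + 1 - j) +
        ∑ j ∈ Finset.range K, (-(j + 1) : ℂ) • schurProd α β (A - j) (B + 2 + j) := by
  have h1 := sum_range_add_sum_range
    (fun i => ((i - A - 1 : ℤ) : ℂ) • schurProd α β i (A + B + 2 - i)) A (A + B + 2) (K := K)
    (fun i hi => by rw [schurProd_eq_zero α β (by omega), smul_zero]) (by omega)
  -- `α(z) schur (α + β) = (schur α)' * schur β`, whose coefficients carry the weight `i`.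
  have h2 : ∑ k ∈ Finset.range K, negGen k (toCartan α) * zcoeff (schur (α + β)) (A + B + 1 - k) =
      ∑ i ∈ Finset.range K, (i : ℂ) • schurProd α β i (A + B + 2 - i) := by
    have e1 : ∑ k ∈ Finset.range K,
        negGen k (toCartan α) * zcoeff (schur (α + β)) (A + B + 1 - k) =
        zcoeff (PowerSeries.derivative _ (schur α) * schur β) (A + B + 1) := by
      rw [derivative_schur, mul_assoc, ← schur_add, zcoeff_mul _ _ (show A + B + 1 < K by omega)]
      simp [creationSeries]
    obtain ⟨K, rfl⟩ : ∃ K', K = K' + 1 := ⟨K - 1, by omega⟩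
    rw [e1, zcoeff_mul _ _ (show A + B + 1 < K by omega), Finset.sum_range_succ']
    simp only [Nat.cast_zero, zero_smul, add_zero]
    refine Finset.sum_congr rfl fun i _ => ?_
    rw [← zcoeff_natCast, zcoeff_derivative, smul_mul_assoc, schurProd]
    push_cast
    rw [show A + B + 2 - (i + 1 : ℤ) = A + B + 1 - i by ring]
  rw [h2, schur_add, zcoeff_mul _ _ (show A + B + 2 < K by omega), Finset.smul_sum,
    ← Finset.sum_sub_distrib]
  refine Eq.trans ?_ (h1.symm.trans ?_)
  · refine Finset.sum_congr rfl fun i _ => ?_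
    rw [← zcoeff_natCast, ← sub_smul]
    congr 1
    push_cast
    ring
  · congr 1 <;> refine Finset.sum_congr rfl fun i _ => ?_
    · rw [show A + B + 2 - (A + 1 + i) = B + 1 - i by ring,
        show A + 1 + i - A - 1 = (i : ℤ) by ring, Int.cast_natCast]
    · rw [show A + B + 2 - (A - i) = B + 2 + i by ring,
        show A - i - A - 1 = -((i : ℤ) + 1) by ring]
      push_cast
      rfl

end Commutators

/-! ### Biprimary families and products of vertex operators -/

section Commutators
variable {L : Type*} [AddCommGroup L]

/-- A family `X(z, w)` of operators with `[h_{(k)}, X(z, w)] = ((h | α) z^k + (h | β) w^k) X(z, w)`,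
given by its coefficients. -/
def IsBiprimary (B : LinearMap.BilinForm ℤ L) (α β : L)
    (X : ℤ → ℤ → Module.End ℂ (StateSpace L)) : Prop :=
  ∀ (a b k : ℤ) (h : Cartan L) (v : StateSpace L), heisenberg B k h (X a b v) =
    X a b (heisenberg B k h v) + B.baseChange ℂ h (toCartan α) • X (a - k) b v +
      B.baseChange ℂ h (toCartan β) • X a (b - k) v

/-- A biprimary family is determined by its values on the vectors `e^γ`. -/
theorem IsBiprimary.ext {B : LinearMap.BilinForm ℤ L} {α β : L}
    {X Y : ℤ → ℤ → Module.End ℂ (StateSpace L)} (hX : IsBiprimary B α β X)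
    (hY : IsBiprimary B α β Y) (h0 : ∀ a b γ, X a b (stateHom γ 1) = Y a b (stateHom γ 1))
    (a b : ℤ) (v : StateSpace L) : X a b v = Y a b v := by
  have := eq_zero_of_vacuum B (X := fun ab : ℤ × ℤ => X ab.1 ab.2 - Y ab.1 ab.2)
    (fun ab k h _ => ?_) (fun ab γ => sub_eq_zero.2 (h0 ab.1 ab.2 γ)) (a, b) v
  · exact sub_eq_zero.1 this
  · refine ⟨_, Submodule.add_mem _
      (Submodule.smul_mem _ (B.baseChange ℂ h (toCartan α))
        (Submodule.subset_span (Set.mem_range_self (ab.1 - k, ab.2))))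
      (Submodule.smul_mem _ (B.baseChange ℂ h (toCartan β))
        (Submodule.subset_span (Set.mem_range_self (ab.1, ab.2 - k)))), fun v => ?_⟩
    simp only [LinearMap.sub_apply, LinearMap.add_apply, LinearMap.smul_apply, map_sub, hX ab.1,
      hY ab.1]
    module

theorem IsBiprimary.sub {B : LinearMap.BilinForm ℤ L} {α β : L}
    {X Y : ℤ → ℤ → Module.End ℂ (StateSpace L)} (hX : IsBiprimary B α β X)
    (hY : IsBiprimary B α β Y) : IsBiprimary B α β fun a b => X a b - Y a b := by
  intro a b k h v
  simp only [LinearMap.sub_apply, map_sub, hX a, hY a]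
  module

theorem IsBiprimary.smul {B : LinearMap.BilinForm ℤ L} {α β : L}
    {X : ℤ → ℤ → Module.End ℂ (StateSpace L)} (hX : IsBiprimary B α β X) (c : ℂ) :
    IsBiprimary B α β fun a b => c • X a b := by
  intro a b k h v
  simp only [LinearMap.smul_apply, map_smul, hX a]
  module

theorem isBiprimary_expMode_mul (B : LinearMap.BilinForm ℤ L) (hB : LinearMap.IsSymm B)
    (ε : L → L → ℤˣ) (α β : L) :
    IsBiprimary B α β fun a b => expMode B ε α a * expMode B ε β b := by
  intro a b k h v
  simp only [Module.End.mul_apply, heisenberg_expMode B hB, map_add, map_smul]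
  module

theorem isBiprimary_mul_expMode (B : LinearMap.BilinForm ℤ L) (hB : LinearMap.IsSymm B)
    (ε : L → L → ℤˣ) (α β : L) :
    IsBiprimary B α β fun a b => expMode B ε β b * expMode B ε α a := by
  intro a b k h v
  simp only [Module.End.mul_apply, heisenberg_expMode B hB, map_add, map_smul]

/-- The coefficients of `δ(z - w) E^{α+β}(w)`. -/
def simplePole (B : LinearMap.BilinForm ℤ L) (ε : L → L → ℤˣ) (α β : L) (a b : ℤ) :
    Module.End ℂ (StateSpace L) := expMode B ε (α + β) (a + b + 1)

/-- The coefficients of `∂_w δ(z - w) E^{α+β}(w) + δ(z - w) :α(w) E^{α+β}(w):`. -/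
def doublePole (B : LinearMap.BilinForm ℤ L) (ε : L → L → ℤˣ) (α β : L) (a b : ℤ) :
    Module.End ℂ (StateSpace L) :=
  (-(a + 1) : ℂ) • expMode B ε (α + β) (a + b + 2) +
    currentMode B ε (toCartan α) (α + β) (a + b + 1)

theorem isBiprimary_simplePole (B : LinearMap.BilinForm ℤ L) (hB : LinearMap.IsSymm B)
    (ε : L → L → ℤˣ) (α β : L) : IsBiprimary B α β (simplePole B ε α β) := by
  intro a b k h v
  simp only [simplePole, heisenberg_expMode B hB, toCartan_add, map_add]
  rw [show a - k + b + 1 = a + b + 1 - k by ring, show a + (b - k) + 1 = a + b + 1 - k by ring]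
  module

theorem isBiprimary_doublePole (B : LinearMap.BilinForm ℤ L) (hB : LinearMap.IsSymm B)
    (ε : L → L → ℤˣ) (α β : L) : IsBiprimary B α β (doublePole B ε α β) := by
  intro a b k h v
  simp only [doublePole, LinearMap.add_apply, LinearMap.smul_apply, map_smul, map_add,
    heisenberg_expMode B hB, heisenberg_currentMode B hB, toCartan_add]
  rw [show a - k + b + 1 = a + b + 1 - k by ring, show a + (b - k) + 1 = a + b + 1 - k by ring,
    show a - k + b + 2 = a + b + 2 - k by ring, show a + (b - k) + 2 = a + b + 2 - k by ring,
    show a + b + 1 + 1 - k = a + b + 2 - k by ring]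
  push_cast
  module

/-- The action of `:h(z) E^α(z):` on `e^γ`: of the annihilation part of `h(z)` only `h_{(0)}`
contributes. -/
theorem currentMode_vacuum (B : LinearMap.BilinForm ℤ L) (ε : L → L → ℤˣ) (h : Cartan L) (α γ : L)
    (N : ℤ) : ∃ K₀ : ℕ, ∀ K, K₀ ≤ K → currentMode B ε h α N (stateHom γ 1) =
      ((ε α γ : ℤ) : ℂ) • stateHom (α + γ)
        (∑ k ∈ Finset.range K, negGen k h * zcoeff (schur α) (N - B α γ - k) +
          B.baseChange ℂ h (toCartan γ) • zcoeff (schur α) (N - B α γ + 1)) := by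
  obtain ⟨K₀, hK₀⟩ := currentMode_apply B ε h α N (stateHom γ 1)
  refine ⟨K₀ + 1, fun K hK => ?_⟩
  obtain ⟨K, rfl⟩ : ∃ K', K = K' + 1 := ⟨K - 1, by omega⟩
  rw [hK₀ (K + 1) (by omega), map_add, smul_add]
  congr 1
  · rw [map_sum, Finset.smul_sum]
    refine Finset.sum_congr rfl fun i _ => ?_
    rw [expMode_vacuum, map_smul, show -(i : ℤ) - 1 = Int.negSucc i by omega]
    refine congrArg _ ((creation_stateHom i h _ _).trans ?_)
    rw [sub_right_comm]
  · rw [Finset.sum_range_succ', Finset.sum_eq_zero, zero_add]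
    · change expMode B ε α (N + (0 : ℕ) + 1) (zeroMode B h (stateHom γ 1)) = _
      rw [zeroMode_stateHom, map_smul, expMode_vacuum, map_smul, smul_comm, Nat.cast_zero, add_zero,
        add_sub_right_comm]
    · intro i _
      have : lowering B i h (1 : Fock L) = 0 := by
        simpa using lowering_algebraMap B i h 1
      change expMode B ε α _ (annihilation B i h (stateHom γ 1)) = _
      rw [annihilation_stateHom, this, map_zero, map_zero]

section Vacuum
variable (B : LinearMap.BilinForm ℤ L) {ε : L → L → ℤˣ}

/-- The product `E^α(z) E^β(w)` on `e^γ`, with `c` the coefficients of `(1 - w / z)^{(α | β)}`. -/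
theorem expMode_expMode_vacuum (hl : ∀ α β γ, ε (α + β) γ = ε α γ * ε β γ)
    (hr : ∀ α β γ, ε α (β + γ) = ε α β * ε α γ) (α β γ : L) {c : ℕ → ℂ}
    (hc : IsBinomialSeries (B α β) c) (a b : ℤ) {K : ℕ} (hK : b - B β γ < K) :
    expMode B ε α a (expMode B ε β b (stateHom γ 1)) =
      (((ε α β : ℤ) : ℂ) * ((ε (α + β) γ : ℤ) : ℂ)) • stateHom (α + β + γ)
        (∑ j ∈ Finset.range K, c j • schurProd α β (a - B α γ - B α β + j) (b - B β γ - j)) := by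
  rw [expMode_vacuum, map_smul, expMode_stateHom_schur B ε α β _ _ _ hc hK, smul_smul, add_assoc]
  have hs : ((ε β γ : ℤ) : ℂ) * ((ε α (β + γ) : ℤ) : ℂ) =
      ((ε α β : ℤ) : ℂ) * ((ε (α + β) γ : ℤ) : ℂ) := by
    rw [hl, hr]
    push_cast
    ring
  rw [hs, map_add, sub_sub, add_comm (B α β)]

/-- The product in the other order, in terms of `schurProd α β` and the coefficients of
`(1 - z / w)^{(α | β)}`. -/
theorem expMode_expMode_vacuum_swap (hB : LinearMap.IsSymm B)
    (hl : ∀ α β γ, ε (α + β) γ = ε α γ * ε β γ)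
    (hr : ∀ α β γ, ε α (β + γ) = ε α β * ε α γ) (α β γ : L) {c : ℕ → ℂ}
    (hc : IsBinomialSeries (B α β) c) (a b : ℤ) {K : ℕ} (hK : a - B α γ < K) :
    expMode B ε β b (expMode B ε α a (stateHom γ 1)) =
      (((ε β α : ℤ) : ℂ) * ((ε (α + β) γ : ℤ) : ℂ)) • stateHom (α + β + γ)
        (∑ j ∈ Finset.range K, c j • schurProd α β (a - B α γ - j) (b - B β γ - B α β + j)) := by
  have hs : B α β = B β α := hB.eq α β
  rw [expMode_expMode_vacuum B hl hr β α γ (hs ▸ hc) b a hK, add_comm β α, hs]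
  simp only [mul_comm (zcoeff (schur β) _)]

/-- The two sums are the expansions of `(z - w)^{-1}` times a product of Schur polynomials in the
domains `|z| > |w|` and `|z| < |w|`, with the sign that makes their sum a commutator. -/
theorem simplePole_vacuum (α β γ : L) (a b : ℤ) {K : ℕ}
    (hK : 2 * (a - B α γ).natAbs + (b - B β γ).natAbs + 1 < K) :
    simplePole B ε α β a b (stateHom γ 1) = ((ε (α + β) γ : ℤ) : ℂ) • stateHom (α + β + γ)
      (∑ j ∈ Finset.range K, schurProd α β (a - B α γ + 1 + j) (b - B β γ - j) +
        ∑ j ∈ Finset.range K, schurProd α β (a - B α γ - j) (b - B β γ + 1 + j)) := by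
  rw [simplePole, expMode_vacuum, ← zcoeff_schur_add α β _ _ hK, map_add, LinearMap.add_apply]
  congr 3
  ring

/-- The analogue of `simplePole_vacuum` for the expansions of `(z - w)^{-2}`. -/
theorem doublePole_vacuum (α β γ : L) (a b : ℤ) :
    ∃ K₀ : ℕ, ∀ K, K₀ ≤ K → doublePole B ε α β a b (stateHom γ 1) =
      ((ε (α + β) γ : ℤ) : ℂ) • stateHom (α + β + γ)
      (∑ j ∈ Finset.range K, (j : ℂ) • schurProd α β (a - B α γ + 1 + j) (b - B β γ + 1 - j) +
        ∑ j ∈ Finset.range K,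
          (-(j + 1) : ℂ) • schurProd α β (a - B α γ - j) (b - B β γ + 2 + j)) := by
  obtain ⟨K₀, hK₀⟩ := currentMode_vacuum B ε (toCartan α) (α + β) γ (a + b + 1)
  refine ⟨K₀ + (2 * (a - B α γ).natAbs + (b - B β γ).natAbs + 3), fun K hK => ?_⟩
  rw [doublePole, LinearMap.add_apply, LinearMap.smul_apply, hK₀ K (by omega), expMode_vacuum,
    ← sum_negGen_mul_zcoeff_schur α β (a - B α γ) (b - B β γ) (by omega), smul_comm, ← smul_add,
    ← map_smul (stateHom _) (-(a + 1) : ℂ), ← map_add]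
  congr 2
  have h1 : B.baseChange ℂ (toCartan α) (toCartan γ) = B α γ := by simp [toCartan]
  rw [map_add, LinearMap.add_apply, h1,
    show a + b + 2 - (B α γ + B β γ) = a - B α γ + (b - B β γ) + 2 by ring,
    show a + b + 1 - (B α γ + B β γ) = a - B α γ + (b - B β γ) + 1 by ring,
    show a - B α γ + (b - B β γ) + 1 + 1 = a - B α γ + (b - B β γ) + 2 by ring]
  push_cast
  module

end Vacuum

end Commutators

/-! ### Commutators of the vertex operators -/

theorem isBinomialSeries_one :
    IsBinomialSeries 1 fun j => if j = 0 then 1 else if j = 1 then -1 else 0 := by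
  refine ⟨by simp, fun j => ?_⟩
  match j with
  | 0 => simp
  | 1 => simp
  | j + 2 => simp [Finset.sum_range_succ']

theorem isBinomialSeries_two :
    IsBinomialSeries 2 fun j =>
      if j = 0 then 1 else if j = 1 then -2 else if j = 2 then 1 else 0 := by
  refine ⟨by simp, fun j => ?_⟩
  match j with
  | 0 => simp
  | 1 => simp
  | 2 => norm_num [Finset.sum_range_succ']
  | j + 3 =>
    rw [Finset.sum_range_succ', Finset.sum_range_succ', Finset.sum_range_succ',
      Finset.sum_eq_zero fun k _ => by simp]
    norm_num
    exact if_neg (by omega)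

theorem isBinomialSeries_neg_one : IsBinomialSeries (-1) fun _ => 1 := ⟨rfl, fun j => by simp⟩

theorem isBinomialSeries_neg_two : IsBinomialSeries (-2) fun j => (j + 1 : ℂ) := by
  refine ⟨by simp, fun j => ?_⟩
  induction j with
  | zero => simp
  | succ j ih =>
    rw [Finset.sum_range_succ, mul_add (-((-2 : ℤ) : ℂ)), ← ih]
    push_cast
    ring

section Commutators
variable {L : Type*} [AddCommGroup L]

/-- `E^α(z)` and `E^β(w)` commute if `(α | β) = 0`. -/
theorem expMode_expMode_zero (B : LinearMap.BilinForm ℤ L) (hB : LinearMap.IsSymm B)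
    {ε : L → L → ℤˣ} (hl : ∀ α β γ, ε (α + β) γ = ε α γ * ε β γ)
    (hr : ∀ α β γ, ε α (β + γ) = ε α β * ε α γ) {α β : L} (hαβ : B α β = 0)
    (hε : ε β α = ε α β) (a b : ℤ) (v : StateSpace L) :
    expMode B ε α a (expMode B ε β b v) = expMode B ε β b (expMode B ε α a v) := by
  refine (isBiprimary_expMode_mul B hB ε α β).ext (isBiprimary_mul_expMode B hB ε α β)
    (fun a b γ => ?_) a b v
  rw [Module.End.mul_apply, Module.End.mul_apply, expMode_expMode_vacuum B hl hr α β γ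
    (hαβ ▸ isBinomialSeries_zero) a b (K := (b - B β γ).toNat + 1) (by omega),
    expMode_expMode_vacuum_swap B hB hl hr α β γ
    (hαβ ▸ isBinomialSeries_zero) a b (K := (a - B α γ).toNat + 1) (by omega), hε,
    Finset.sum_range_succ', Finset.sum_range_succ']
  simp [hαβ]

/-- `E^α(z)` and `E^β(w)` commute if `(α | β) = 1` and `ε(β, α) = -ε(α, β)`. -/
theorem expMode_expMode_one (B : LinearMap.BilinForm ℤ L) (hB : LinearMap.IsSymm B)
    {ε : L → L → ℤˣ} (hl : ∀ α β γ, ε (α + β) γ = ε α γ * ε β γ)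
    (hr : ∀ α β γ, ε α (β + γ) = ε α β * ε α γ) {α β : L} (hαβ : B α β = 1)
    (hε : ε β α = -ε α β) (a b : ℤ) (v : StateSpace L) :
    expMode B ε α a (expMode B ε β b v) = expMode B ε β b (expMode B ε α a v) := by
  refine (isBiprimary_expMode_mul B hB ε α β).ext (isBiprimary_mul_expMode B hB ε α β)
    (fun a b γ => ?_) a b v
  rw [Module.End.mul_apply, Module.End.mul_apply, expMode_expMode_vacuum B hl hr α β γ
    (hαβ ▸ isBinomialSeries_one) a b (K := (b - B β γ).toNat + 2) (by omega),
    expMode_expMode_vacuum_swap B hB hl hr α β γ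
    (hαβ ▸ isBinomialSeries_one) a b (K := (a - B α γ).toNat + 2) (by omega), hε,
    Finset.sum_range_succ', Finset.sum_range_succ', Finset.sum_range_succ', Finset.sum_range_succ',
    hαβ]
  simp only [Nat.add_eq_zero_iff, and_false, Nat.add_eq_right, if_false, if_true,
    zero_smul, Finset.sum_const_zero, zero_add, one_ne_zero, Nat.cast_zero, Nat.cast_one, add_zero,
    sub_zero, sub_add_cancel, one_smul, Units.val_neg, Int.cast_neg, map_add, map_smul]
  module

/-- `E^α(z)` and `E^β(w)` commute if `(α | β) = 2` and `ε(β, α) = ε(α, β)`. -/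
theorem expMode_expMode_two (B : LinearMap.BilinForm ℤ L) (hB : LinearMap.IsSymm B)
    {ε : L → L → ℤˣ} (hl : ∀ α β γ, ε (α + β) γ = ε α γ * ε β γ)
    (hr : ∀ α β γ, ε α (β + γ) = ε α β * ε α γ) {α β : L} (hαβ : B α β = 2)
    (hε : ε β α = ε α β) (a b : ℤ) (v : StateSpace L) :
    expMode B ε α a (expMode B ε β b v) = expMode B ε β b (expMode B ε α a v) := by
  refine (isBiprimary_expMode_mul B hB ε α β).ext (isBiprimary_mul_expMode B hB ε α β)
    (fun a b γ => ?_) a b v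
  rw [Module.End.mul_apply, Module.End.mul_apply, expMode_expMode_vacuum B hl hr α β γ
    (hαβ ▸ isBinomialSeries_two) a b (K := (b - B β γ).toNat + 3) (by omega),
    expMode_expMode_vacuum_swap B hB hl hr α β γ
    (hαβ ▸ isBinomialSeries_two) a b (K := (a - B α γ).toNat + 3) (by omega), hε,
    Finset.sum_range_succ', Finset.sum_range_succ', Finset.sum_range_succ', Finset.sum_range_succ',
    Finset.sum_range_succ', Finset.sum_range_succ', hαβ]
  have e : ∀ x : ℤ, x - 2 + (1 : ℕ) = x - 1 := fun x => by push_cast; ring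
  simp only [zero_add, add_assoc, Nat.reduceAdd, e]
  simp only [Nat.add_eq_zero_iff, OfNat.ofNat_ne_zero, and_false, if_false, if_true,
    zero_smul, Finset.sum_const_zero, zero_add, one_ne_zero, Nat.cast_zero, Nat.cast_one, add_zero,
    sub_zero, one_smul, map_add, map_smul, OfNat.ofNat_ne_one, Nat.cast_ofNat, sub_add_cancel,
    Nat.reduceEqDiff]
  module

/-- The commutator of `E^α(z)` and `E^β(w)` if `(α | β) = -1`. -/
theorem expMode_expMode_neg_one (B : LinearMap.BilinForm ℤ L) (hB : LinearMap.IsSymm B)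
    {ε : L → L → ℤˣ} (hl : ∀ α β γ, ε (α + β) γ = ε α γ * ε β γ)
    (hr : ∀ α β γ, ε α (β + γ) = ε α β * ε α γ) {α β : L} (hαβ : B α β = -1)
    (hε : ε β α = -ε α β) (a b : ℤ) (v : StateSpace L) :
    expMode B ε α a (expMode B ε β b v) = ((ε α β : ℤ) : ℂ) • simplePole B ε α β a b v +
      expMode B ε β b (expMode B ε α a v) := by
  refine sub_eq_iff_eq_add.1 (((isBiprimary_expMode_mul B hB ε α β).sub
    (isBiprimary_mul_expMode B hB ε α β)).ext ((isBiprimary_simplePole B hB ε α β).smul _)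
    (fun a b γ => ?_) a b v)
  let K := 2 * (a - B α γ).natAbs + 2 * (b - B β γ).natAbs + 2
  rw [LinearMap.sub_apply, LinearMap.smul_apply, Module.End.mul_apply, Module.End.mul_apply,
    expMode_expMode_vacuum B hl hr α β γ
    (hαβ ▸ isBinomialSeries_neg_one) a b (K := K) (by omega),
    expMode_expMode_vacuum_swap B hB hl hr α β γ
    (hαβ ▸ isBinomialSeries_neg_one) a b (K := K) (by omega), hε, hαβ,
    simplePole_vacuum B α β γ a b (K := K) (by omega)]
  simp only [sub_neg_eq_add, one_smul, Units.val_neg, Int.cast_neg, map_add]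
  module

/-- The commutator of `E^α(z)` and `E^β(w)` if `(α | β) = -2`. -/
theorem expMode_expMode_neg_two (B : LinearMap.BilinForm ℤ L) (hB : LinearMap.IsSymm B)
    {ε : L → L → ℤˣ} (hl : ∀ α β γ, ε (α + β) γ = ε α γ * ε β γ)
    (hr : ∀ α β γ, ε α (β + γ) = ε α β * ε α γ) {α β : L} (hαβ : B α β = -2)
    (hε : ε β α = ε α β) (a b : ℤ) (v : StateSpace L) :
    expMode B ε α a (expMode B ε β b v) = ((ε α β : ℤ) : ℂ) • doublePole B ε α β a b v +
      expMode B ε β b (expMode B ε α a v) := by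
  refine sub_eq_iff_eq_add.1 (((isBiprimary_expMode_mul B hB ε α β).sub
    (isBiprimary_mul_expMode B hB ε α β)).ext ((isBiprimary_doublePole B hB ε α β).smul _)
    (fun a b γ => ?_) a b v)
  obtain ⟨K₀, hK₀⟩ := doublePole_vacuum B (ε := ε) α β γ a b
  let K := K₀ + 2 * (a - B α γ).natAbs + 2 * (b - B β γ).natAbs + 2
  -- The term `j = 0` of the first sum in `doublePole_vacuum` vanishes, so that this sum is shifted.
  have e : ∑ j ∈ Finset.range (K + 1),
      (j : ℂ) • schurProd α β (a - B α γ + 1 + j) (b - B β γ + 1 - j) =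
      ∑ j ∈ Finset.range K, (j + 1 : ℂ) • schurProd α β (a - B α γ + 2 + j) (b - B β γ - j) := by
    rw [Finset.sum_range_succ', Nat.cast_zero, zero_smul, add_zero]
    refine Finset.sum_congr rfl fun j _ => ?_
    push_cast
    rw [show a - B α γ + 1 + (j + 1 : ℤ) = a - B α γ + 2 + j by ring,
      show b - B β γ + 1 - (j + 1 : ℤ) = b - B β γ - j by ring]
  rw [LinearMap.sub_apply, LinearMap.smul_apply, Module.End.mul_apply, Module.End.mul_apply,
    expMode_expMode_vacuum B hl hr α β γ
    (hαβ ▸ isBinomialSeries_neg_two) a b (K := K) (by omega),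
    expMode_expMode_vacuum_swap B hB hl hr α β γ
    (hαβ ▸ isBinomialSeries_neg_two) a b (K := K + 1) (by omega), hε, hαβ,
    hK₀ (K + 1) (by omega), e]
  simp only [sub_neg_eq_add, map_add, neg_smul, Finset.sum_neg_distrib, map_neg]
  module

/-- The commutator of `:h(z) E^α(z):` and `E^β(w)` if `(α | β) = 0`. -/
theorem currentMode_expMode_zero (B : LinearMap.BilinForm ℤ L) (hB : LinearMap.IsSymm B)
    {ε : L → L → ℤˣ} (hl : ∀ α β γ, ε (α + β) γ = ε α γ * ε β γ)
    (hr : ∀ α β γ, ε α (β + γ) = ε α β * ε α γ) {α β : L} (hαβ : B α β = 0)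
    (hε : ε β α = ε α β) (h : Cartan L) (a b : ℤ) (v : StateSpace L) :
    currentMode B ε h α a (expMode B ε β b v) =
      (B.baseChange ℂ h (toCartan β) * ((ε α β : ℤ) : ℂ)) • simplePole B ε α β a b v +
      expMode B ε β b (currentMode B ε h α a v) := by
  have hc := expMode_expMode_zero B hB hl hr hαβ hε
  -- A current is not primary, but the extra terms in its commutators with the Heisenberg operators
  -- cancel in the commutator with `E^β(w)`, because `E^α(z)` commutes with `E^β(w)`.
  have hX : IsBiprimary B α β fun a b => currentMode B ε h α a * expMode B ε β b -
      expMode B ε β b * currentMode B ε h α a := by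
    intro a b k h' v
    simp only [LinearMap.sub_apply, Module.End.mul_apply, heisenberg_expMode B hB,
      heisenberg_currentMode B hB, map_add, map_smul, map_sub, hc]
    module
  refine sub_eq_iff_eq_add.1 (hX.ext ((isBiprimary_simplePole B hB ε α β).smul _)
    (fun a b γ => ?_) a b v)
  obtain ⟨K₀, hK₀⟩ := currentMode_expMode B hB ε hc h a b (stateHom γ 1)
  let K := K₀ + 2 * (a - B α γ).natAbs + 2 * (b - B β γ).natAbs + 2
  have e : ∀ a b : ℤ, expMode B ε α a (expMode B ε β b (stateHom γ 1)) =
      (((ε α β : ℤ) : ℂ) * ((ε (α + β) γ : ℤ) : ℂ)) • stateHom (α + β + γ)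
        (schurProd α β (a - B α γ) (b - B β γ)) := fun a b => by
    rw [expMode_expMode_vacuum B hl hr α β γ
      (hαβ ▸ isBinomialSeries_zero) a b (K := (b - B β γ).toNat + 1) (by omega),
      Finset.sum_range_succ']
    simp [hαβ]
  rw [LinearMap.sub_apply, LinearMap.smul_apply, Module.End.mul_apply, Module.End.mul_apply,
    hK₀ K (by omega), simplePole_vacuum B α β γ a b (K := K) (by omega), add_sub_cancel_left]
  simp only [← hc, e, map_add, map_sum, Finset.smul_sum, smul_add, smul_smul, mul_assoc]
  simp only [add_sub_right_comm, sub_right_comm]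

/-- The commutator of `:h(z) E^α(z):` and `:h'(w) E^β(w):` if `(α | β) = (h | β) = (h' | α) = 0`. -/
theorem currentMode_currentMode_zero (B : LinearMap.BilinForm ℤ L) (hB : LinearMap.IsSymm B)
    {ε : L → L → ℤˣ} (hl : ∀ α β γ, ε (α + β) γ = ε α γ * ε β γ)
    (hr : ∀ α β γ, ε α (β + γ) = ε α β * ε α γ) {α β : L} (hαβ : B α β = 0)
    (hε : ε β α = ε α β) {h h' : Cartan L} (h0 : B.baseChange ℂ h (toCartan β) = 0)
    (h0' : B.baseChange ℂ h' (toCartan α) = 0) (a b : ℤ) (v : StateSpace L) :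
    currentMode B ε h α a (currentMode B ε h' β b v) =
      (B.baseChange ℂ h h' * ((ε α β : ℤ) : ℂ)) • doublePole B ε α β a b v +
      currentMode B ε h' β b (currentMode B ε h α a v) := by
  have hc := expMode_expMode_zero B hB hl hr hαβ hε
  have hc₁ := currentMode_expMode_of_eq_zero B hB ε hc h0
  have hc₂ := currentMode_expMode_of_eq_zero B hB ε (fun a b v => (hc b a v).symm) h0'
  have hX : IsBiprimary B α β fun a b => currentMode B ε h α a * currentMode B ε h' β b -
      currentMode B ε h' β b * currentMode B ε h α a := by
    intro a b k h'' v
    simp only [LinearMap.sub_apply, Module.End.mul_apply, heisenberg_currentMode B hB, map_add,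
      map_smul, map_sub, hc₁, hc₂]
    module
  refine sub_eq_iff_eq_add.1 (hX.ext ((isBiprimary_doublePole B hB ε α β).smul _)
    (fun a b γ => ?_) a b v)
  obtain ⟨K₀, hK₀⟩ := currentMode_currentMode B hB ε hc h0 h0' a b (stateHom γ 1)
  obtain ⟨K₁, hK₁⟩ := doublePole_vacuum B (ε := ε) α β γ a b
  have e : ∀ a b : ℤ, expMode B ε α a (expMode B ε β b (stateHom γ 1)) =
      (((ε α β : ℤ) : ℂ) * ((ε (α + β) γ : ℤ) : ℂ)) • stateHom (α + β + γ)
        (schurProd α β (a - B α γ) (b - B β γ)) := fun a b => by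
    rw [expMode_expMode_vacuum B hl hr α β γ
      (hαβ ▸ isBinomialSeries_zero) a b (K := (b - B β γ).toNat + 1) (by omega),
      Finset.sum_range_succ']
    simp [hαβ]
  rw [LinearMap.sub_apply, LinearMap.smul_apply, Module.End.mul_apply, Module.End.mul_apply,
    hK₀ (K₀ + K₁) (by omega), hK₁ (K₀ + K₁) (by omega), add_sub_cancel_left]
  simp only [← hc, e, map_add, map_sum, map_smul, Finset.smul_sum, smul_add, smul_smul]
  simp only [add_sub_right_comm _ _ (B _ γ), sub_right_comm _ _ (B _ γ)]
  congr 1 <;> refine Finset.sum_congr rfl fun i _ => ?_ <;> congr 1 <;> ring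

end Commutators

/-! ### The toroidal lattice -/

section Toroidal

theorem baseChange_toCartan {L : Type*} [AddCommGroup L] (B : LinearMap.BilinForm ℤ L) (x y : L) :
    B.baseChange ℂ (toCartan x) (toCartan y) = B x y := by
  simp [toCartan]

theorem mode_stateOf_one {L : Type*} [AddCommGroup L] (B : LinearMap.BilinForm ℤ L)
    (ε : L → L → ℤˣ) (α : L) (m : ℤ) :
    mode B ε (stateOf 1 α) m = expMode B ε α (-m - 1) := by
  simp [mode, stateField, stateOf]

theorem mode_stateOf_negGen {L : Type*} [AddCommGroup L] (B : LinearMap.BilinForm ℤ L)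
    (ε : L → L → ℤˣ) (h : Cartan L) (α : L) (m : ℤ) :
    mode B ε (stateOf (negGen 0 h) α) m = currentMode B ε h α (-m - 1) := by
  simp [mode, stateField, stateOf, negGen, normalOrderHom, symLift_ι, normalOrderGen]

variable {ℓ r : ℕ}

theorem gammaForm_apply (x y : GammaLattice ℓ r) : gammaForm ℓ r x y =
    ∑ i, x.1 i * y.1 i + ∑ ν, (x.2.1 ν * y.2.2 ν + x.2.2 ν * y.2.1 ν) := rfl

theorem gammaForm_isSymm : LinearMap.IsSymm (gammaForm ℓ r) := by
  refine ⟨fun x y => ?_⟩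
  simp only [gammaForm_apply, RingHom.id_apply, mul_comm, add_comm]

theorem dotTheta_eq (p : Fin r → ℤ) : (dotTheta p : GammaLattice ℓ r) = (0, p, 0) := by
  refine Prod.ext ?_ (Prod.ext ?_ ?_)
  · simp [dotTheta, smallTheta, Prod.fst_sum]
  · ext μ
    simp [dotTheta, smallTheta, Prod.fst_sum, Prod.snd_sum, Finset.sum_apply, Pi.single_apply]
  · simp [dotTheta, smallTheta, Prod.snd_sum]

theorem dotTheta_add (p q : Fin r → ℤ) :
    (dotTheta (p + q) : GammaLattice ℓ r) = dotTheta p + dotTheta q := by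
  simp [dotTheta_eq]

theorem smallTheta_eq_dotTheta (ν : Fin r) :
    (smallTheta ν : GammaLattice ℓ r) = dotTheta (Pi.single ν 1) := by
  rw [dotTheta_eq, smallTheta]

theorem gammaForm_vVec_vVec (i j : Fin ℓ) :
    gammaForm ℓ r (vVec i) (vVec j) = if i = j then 1 else 0 := by
  simp [gammaForm_apply, vVec, Pi.single_apply, eq_comm]

theorem gammaForm_vVec_dotTheta (i : Fin ℓ) (p : Fin r → ℤ) :
    gammaForm ℓ r (vVec i) (dotTheta p) = 0 := by
  simp [gammaForm_apply, vVec, dotTheta_eq]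

theorem gammaForm_dotTheta_vVec (i : Fin ℓ) (p : Fin r → ℤ) :
    gammaForm ℓ r (dotTheta p) (vVec i) = 0 := by
  simp [gammaForm_apply, vVec, dotTheta_eq]

theorem gammaForm_dotTheta_dotTheta (p q : Fin r → ℤ) :
    gammaForm ℓ r (dotTheta p) (dotTheta q) = 0 := by
  simp [gammaForm_apply, dotTheta_eq]

theorem epsSign_self (i : Fin ℓ) : epsSign i i = -1 := by simp [epsSign]

theorem epsSign_swap {i j : Fin ℓ} (h : i ≠ j) : epsSign j i = -epsSign i j := by
  rcases lt_or_gt_of_ne h with h | h <;> simp [epsSign, h, h.not_gt]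

/-- The element `v_k - v_l + p·ϑ` of `Γ`. -/
abbrev rootVec (k l : Fin ℓ) (p : Fin r → ℤ) : GammaLattice ℓ r := vVec k - vVec l + dotTheta p

theorem gammaForm_rootVec_rootVec (k l k' l' : Fin ℓ) (p q : Fin r → ℤ) :
    gammaForm ℓ r (rootVec k l p) (rootVec k' l' q) =
      (if k = k' then 1 else 0) - (if k = l' then 1 else 0) -
        ((if l = k' then 1 else 0) - (if l = l' then 1 else 0)) := by
  simp only [map_add, map_sub, LinearMap.add_apply, LinearMap.sub_apply, gammaForm_vVec_vVec,
    gammaForm_vVec_dotTheta, gammaForm_dotTheta_vVec, gammaForm_dotTheta_dotTheta]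
  ring

theorem gammaForm_dotTheta_rootVec (k l : Fin ℓ) (p q : Fin r → ℤ) :
    gammaForm ℓ r (dotTheta p) (rootVec k l q) = 0 := by
  simp only [map_add, map_sub, gammaForm_dotTheta_vVec, gammaForm_dotTheta_dotTheta, sub_self,
    add_zero]

variable {ε : GammaLattice ℓ r → GammaLattice ℓ r → ℤˣ}

theorem IsToroidalSign.sub_left (hε : IsToroidalSign ε) (α β γ : GammaLattice ℓ r) :
    ε (α - β) γ = ε α γ * ε β γ := by
  have h := hε.add_left (α - β) β γ
  rw [sub_add_cancel] at h
  rw [h, mul_assoc, Int.units_mul_self, mul_one]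

theorem IsToroidalSign.sub_right (hε : IsToroidalSign ε) (α β γ : GammaLattice ℓ r) :
    ε α (β - γ) = ε α β * ε α γ := by
  have h := hε.add_right α (β - γ) γ
  rw [sub_add_cancel] at h
  rw [h, mul_assoc, Int.units_mul_self, mul_one]

theorem IsToroidalSign.dotTheta_dotTheta (hε : IsToroidalSign ε) (p q : Fin r → ℤ) :
    ε (dotTheta p) (dotTheta q) = 1 := by
  let f : GammaLattice ℓ r → GammaLattice ℓ r →+ Additive ℤˣ := fun β =>
    AddMonoidHom.mk' (fun α => Additive.ofMul (ε α β)) fun a b => by rw [hε.add_left]; rfl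
  let g : GammaLattice ℓ r → GammaLattice ℓ r →+ Additive ℤˣ := fun α =>
    AddMonoidHom.mk' (fun β => Additive.ofMul (ε α β)) fun a b => by rw [hε.add_right]; rfl
  have hg : ∀ ν, dotTheta q ∈ (g (smallTheta ν)).ker := fun ν =>
    AddSubgroup.sum_mem _ fun μ _ => AddSubgroup.zsmul_mem _ (hε.theta_theta ν μ) _
  have hf : dotTheta p ∈ (f (dotTheta q)).ker :=
    AddSubgroup.sum_mem _ fun μ _ => AddSubgroup.zsmul_mem _
      (show smallTheta μ ∈ (f (dotTheta q)).ker from hg μ) _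
  exact hf

theorem IsToroidalSign.dotTheta_vVec (hε : IsToroidalSign ε) (p : Fin r → ℤ) (i : Fin ℓ) :
    ε (dotTheta p) (vVec i) = 1 := by
  rw [dotTheta_eq]
  exact hε.R_Q _ _

theorem IsToroidalSign.vVec_dotTheta (hε : IsToroidalSign ε) (p : Fin r → ℤ) (i : Fin ℓ) :
    ε (vVec i) (dotTheta p) = 1 := by
  rw [dotTheta_eq]
  exact hε.Q_R _ _

theorem IsToroidalSign.dotTheta_rootVec (hε : IsToroidalSign ε) (p q : Fin r → ℤ) (k l : Fin ℓ) :
    ε (dotTheta p) (rootVec k l q) = 1 := by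
  simp only [rootVec, hε.add_right, hε.sub_right, hε.dotTheta_vVec, hε.dotTheta_dotTheta, mul_one]

theorem IsToroidalSign.rootVec_dotTheta (hε : IsToroidalSign ε) (p q : Fin r → ℤ) (k l : Fin ℓ) :
    ε (rootVec k l p) (dotTheta q) = 1 := by
  simp only [rootVec, hε.add_left, hε.sub_left, hε.vVec_dotTheta, hε.dotTheta_dotTheta, mul_one]

theorem IsToroidalSign.rootVec_rootVec (hε : IsToroidalSign ε) (p q : Fin r → ℤ)
    (k l k' l' : Fin ℓ) : ε (rootVec k l p) (rootVec k' l' q) =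
      epsSign k k' * epsSign k l' * (epsSign l k' * epsSign l l') := by
  simp only [rootVec, hε.add_left, hε.sub_left, hε.add_right, hε.sub_right, hε.v_v,
    hε.vVec_dotTheta, hε.dotTheta_vVec, hε.dotTheta_dotTheta, mul_one]

theorem cartanMode_eq (ε : GammaLattice ℓ r → GammaLattice ℓ r → ℤˣ) (h : GammaLattice ℓ r)
    (p : Fin r → ℤ) (m : ℤ) : cartanMode ε h p m =
      currentMode (gammaForm ℓ r) ε (toCartan h) (dotTheta p) (-m - 1) :=
  mode_stateOf_negGen _ _ _ _ _

theorem eMode_eq (ε : GammaLattice ℓ r → GammaLattice ℓ r → ℤˣ) (k l : Fin ℓ)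
    (p : Fin r → ℤ) (m : ℤ) : eMode ε k l p m =
      ((epsSign l k : ℤ) : ℂ) • expMode (gammaForm ℓ r) ε (rootVec k l p) (-m - 1) := by
  rw [eMode, mode_stateOf_one]

theorem kappaMode_zero_eq (ε : GammaLattice ℓ r → GammaLattice ℓ r → ℤˣ) (p : Fin r → ℤ) (m : ℤ) :
    kappaMode ε 0 p m = expMode (gammaForm ℓ r) ε (dotTheta p) (-m) := by
  have : kappaMode ε 0 p m = mode (gammaForm ℓ r) ε (stateOf 1 (dotTheta p)) (m - 1) := rfl
  rw [this, mode_stateOf_one]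
  congr 1
  ring

theorem kappaMode_succ_eq (ε : GammaLattice ℓ r → GammaLattice ℓ r → ℤˣ) (ν : Fin r)
    (p : Fin r → ℤ) (m : ℤ) : kappaMode ε ν.succ p m = cartanMode ε (smallTheta ν) p m := rfl

/-- The value at `v` of the coefficient of `z^N` in `:h(z) E^α(z):`, as a linear function of `h`. -/
def currentModeHom {L : Type*} [AddCommGroup L] (B : LinearMap.BilinForm ℤ L) (ε : L → L → ℤˣ)
    (α : L) (N : ℤ) (v : StateSpace L) : Cartan L →ₗ[ℂ] StateSpace L where
  toFun h := currentMode B ε h α N v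
  map_add' h h' := by
    simp only [currentMode, map_add, LinearMap.add_apply, Pi.add_apply]
  map_smul' c h := by
    simp only [currentMode, map_smul, LinearMap.smul_apply, Pi.smul_apply, RingHom.id_apply]

/-- The modes of `:h(z) E^α(z):` for `h = x + p·ϑ`. -/
theorem currentMode_add_dotTheta (ε : GammaLattice ℓ r → GammaLattice ℓ r → ℤˣ)
    (x α : GammaLattice ℓ r) (p : Fin r → ℤ) (N : ℤ) (v : StateSpace (GammaLattice ℓ r)) :
    currentMode (gammaForm ℓ r) ε (toCartan (x + dotTheta p)) α N v =
      currentMode (gammaForm ℓ r) ε (toCartan x) α N v +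
      ∑ ν, (p ν : ℂ) • currentMode (gammaForm ℓ r) ε (toCartan (smallTheta ν)) α N v := by
  have h : toCartan (dotTheta p : GammaLattice ℓ r) =
      ∑ ν, (p ν : ℂ) • (toCartan (smallTheta ν) : Cartan (GammaLattice ℓ r)) := by
    rw [toCartan, dotTheta, TensorProduct.tmul_sum]
    refine Finset.sum_congr rfl fun ν _ => ?_
    rw [TensorProduct.tmul_smul, toCartan, Int.cast_smul_eq_zsmul]
  have := map_add (currentModeHom (gammaForm ℓ r) ε α N v) (toCartan x) (toCartan (dotTheta p))
  rw [toCartan_add]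
  refine this.trans (congrArg _ ?_)
  rw [h, map_sum]
  refine Finset.sum_congr rfl fun ν _ => ?_
  rw [map_smul]
  rfl

end Toroidal

/-! ### The commutation relations of the toroidal modes -/

section Relations
variable {ℓ r : ℕ} {ε : GammaLattice ℓ r → GammaLattice ℓ r → ℤˣ}

/-- The modes of `doublePole` when the sum of the two lattice vectors lies in the span of the `ϑ_ν`:
the right hand side of the toroidal relations. -/
theorem doublePole_apply (ε : GammaLattice ℓ r → GammaLattice ℓ r → ℤˣ)
    (x : GammaLattice ℓ r) {β : GammaLattice ℓ r} {p q : Fin r → ℤ}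
    (h : x + dotTheta p + β = dotTheta (p + q)) (m n : ℤ) (v : StateSpace (GammaLattice ℓ r)) :
    doublePole (gammaForm ℓ r) ε (x + dotTheta p) β (-m - 1) (-n - 1) v =
      cartanMode ε x (p + q) (m + n) v + (m : ℂ) • kappaMode ε 0 (p + q) (m + n) v +
        ∑ ν : Fin r, (p ν : ℂ) • kappaMode ε ν.succ (p + q) (m + n) v := by
  rw [doublePole, h, LinearMap.add_apply, LinearMap.smul_apply, currentMode_add_dotTheta,
    kappaMode_zero_eq, cartanMode_eq, show -m - 1 + (-n - 1) + 1 = -(m + n) - 1 by ring,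
    show -m - 1 + (-n - 1) + 2 = -(m + n) by ring, ← add_assoc]
  congr 1
  · rw [add_comm]
    congr 2
    push_cast
    ring
  · simp only [kappaMode_succ_eq, cartanMode_eq]

theorem simplePole_apply (ε : GammaLattice ℓ r → GammaLattice ℓ r → ℤˣ)
    {α β γ : GammaLattice ℓ r} (h : α + β = γ) (m n : ℤ) (v : StateSpace (GammaLattice ℓ r)) :
    simplePole (gammaForm ℓ r) ε α β (-m - 1) (-n - 1) v =
      expMode (gammaForm ℓ r) ε γ (-(m + n) - 1) v := by
  rw [simplePole, h, show -m - 1 + (-n - 1) + 1 = -(m + n) - 1 by ring]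

/-- `(v_i - v_{i+1} | v_j - v_{j+1})` in terms of Kronecker symbols. -/
theorem gammaForm_simpleRoot (i j : Fin (ℓ - 1)) (hi : (i : ℕ) < ℓ) (hi' : (i : ℕ) + 1 < ℓ)
    (hj : (j : ℕ) < ℓ) (hj' : (j : ℕ) + 1 < ℓ) :
    ((gammaForm ℓ r (vVec ⟨i, hi⟩ - vVec ⟨i + 1, hi'⟩)
      (vVec ⟨j, hj⟩ - vVec ⟨j + 1, hj'⟩) : ℤ) : ℂ) =
      2 * kron i j - kron i (j + 1) - kron (i + 1) j := by
  simp only [map_sub, LinearMap.sub_apply, gammaForm_vVec_vVec, Fin.mk.injEq, kron,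
    Nat.add_right_cancel_iff]
  push_cast
  ring

theorem lie_hMode_hMode (hε : IsToroidalSign ε) (i j : Fin (ℓ - 1)) (p q : Fin r → ℤ) (m n : ℤ) :
    ⁅hMode ε i p m, hMode ε j q n⁆ = (2 * kron i j - kron i (j + 1) - kron (i + 1) j) •
      ((m : ℂ) • kappaMode ε 0 (p + q) (m + n) +
        ∑ ν : Fin r, (p ν : ℂ) • kappaMode ε ν.succ (p + q) (m + n)) := by
  refine LinearMap.ext fun v => ?_
  change hMode ε i p m (hMode ε j q n v) - hMode ε j q n (hMode ε i p m v) = _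
  rw [hMode, hMode, cartanMode_eq, cartanMode_eq,
    currentMode_currentMode_zero (gammaForm ℓ r) gammaForm_isSymm hε.add_left hε.add_right
      (gammaForm_dotTheta_dotTheta p q) (by rw [hε.dotTheta_dotTheta, hε.dotTheta_dotTheta])
      (by simp [baseChange_toCartan, gammaForm_vVec_dotTheta])
      (by simp [baseChange_toCartan, gammaForm_vVec_dotTheta]), add_sub_cancel_right,
    hε.dotTheta_dotTheta, baseChange_toCartan, gammaForm_simpleRoot, Units.val_one, Int.cast_one,
    mul_one]
  have h := doublePole_apply ε 0 (β := dotTheta q) (p := p) (q := q)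
    (by rw [zero_add, dotTheta_add]) m n v
  have h0 : cartanMode ε 0 (p + q) (m + n) v = 0 := by
    rw [cartanMode_eq, toCartan, TensorProduct.tmul_zero]
    exact map_zero (currentModeHom _ ε _ _ v)
  rw [zero_add, h0, zero_add] at h
  rw [h]
  simp only [LinearMap.smul_apply, LinearMap.add_apply, LinearMap.sum_apply]

theorem lie_hMode_eMode (hε : IsToroidalSign ε) (i : Fin (ℓ - 1)) (k l : Fin ℓ) (p q : Fin r → ℤ)
    (m n : ℤ) : ⁅hMode ε i p m, eMode ε k l q n⁆ =
      (kron i k + kron (i + 1) l - kron i l - kron (i + 1) k) • eMode ε k l (p + q) (m + n) := by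
  refine LinearMap.ext fun v => ?_
  change hMode ε i p m (eMode ε k l q n v) - eMode ε k l q n (hMode ε i p m v) = _
  rw [hMode, cartanMode_eq, eMode_eq, eMode_eq, LinearMap.smul_apply, LinearMap.smul_apply,
    LinearMap.smul_apply, LinearMap.smul_apply, map_smul,
    currentMode_expMode_zero (gammaForm ℓ r) gammaForm_isSymm hε.add_left hε.add_right
      (gammaForm_dotTheta_rootVec k l p q) (by rw [hε.dotTheta_rootVec, hε.rootVec_dotTheta]),
    simplePole_apply ε (show dotTheta p + rootVec k l q = rootVec k l (p + q) by
      rw [rootVec, rootVec, dotTheta_add]; abel), smul_add, add_sub_cancel_right, smul_comm,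
    hε.dotTheta_rootVec, baseChange_toCartan, Units.val_one, Int.cast_one, mul_one]
  congr 1
  simp only [map_sub, map_add, LinearMap.sub_apply, gammaForm_vVec_vVec, gammaForm_vVec_dotTheta,
    kron, Fin.ext_iff]
  push_cast
  ring

theorem lie_eMode_eMode (hε : IsToroidalSign ε) (k l k' l' : Fin ℓ) (p q : Fin r → ℤ) (m n : ℤ)
    (hkl : k ≠ l) (hkl' : k' ≠ l') : ⁅eMode ε k l p m, eMode ε k' l' q n⁆ =
      if k = l' ∧ l = k' then
        cartanMode ε (vVec k - vVec l) (p + q) (m + n) + (m : ℂ) • kappaMode ε 0 (p + q) (m + n) +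
          ∑ ν : Fin r, (p ν : ℂ) • kappaMode ε ν.succ (p + q) (m + n)
      else if k ≠ l' ∧ l = k' then eMode ε k l' (p + q) (m + n)
      else if k = l' ∧ l ≠ k' then -eMode ε k' l (p + q) (m + n)
      else 0 := by
  refine LinearMap.ext fun v => ?_
  have hlie : ⁅eMode ε k l p m, eMode ε k' l' q n⁆ v =
      (((epsSign l k * epsSign l' k' : ℤˣ) : ℤ) : ℂ) •
        (expMode (gammaForm ℓ r) ε (rootVec k l p) (-m - 1)
          (expMode (gammaForm ℓ r) ε (rootVec k' l' q) (-n - 1) v) -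
        expMode (gammaForm ℓ r) ε (rootVec k' l' q) (-n - 1)
          (expMode (gammaForm ℓ r) ε (rootVec k l p) (-m - 1) v)) := by
    change eMode ε k l p m (eMode ε k' l' q n v) - eMode ε k' l' q n (eMode ε k l p m v) = _
    simp only [eMode_eq, LinearMap.smul_apply, map_smul]
    push_cast
    module
  have hform := gammaForm_rootVec_rootVec k l k' l' p q
  rw [hlie]
  by_cases h1 : k = l'
  · subst h1
    by_cases h2 : l = k'
    · subst h2
      rw [if_pos ⟨rfl, rfl⟩, expMode_expMode_neg_two (gammaForm ℓ r) gammaForm_isSymm hε.add_left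
        hε.add_right (by rw [hform]; simp [hkl, hkl.symm]) (by
          rw [hε.rootVec_rootVec, hε.rootVec_rootVec, epsSign_self, epsSign_self]
          simp only [mul_comm, mul_left_comm]), add_sub_cancel_right, smul_smul,
        doublePole_apply ε _ (show rootVec k l p + rootVec l k q = dotTheta (p + q) by
          rw [dotTheta_add, rootVec, rootVec]; abel), hε.rootVec_rootVec, epsSign_self,
        epsSign_self, epsSign_swap hkl, ← Int.cast_mul, ← Units.val_mul]
      have : ∀ u : ℤˣ, -u * u * (u * -1 * (-1 * -u)) = 1 := by decide
      rw [this, Units.val_one, Int.cast_one, one_smul]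
      simp only [LinearMap.smul_apply, LinearMap.add_apply, LinearMap.sum_apply]
    · rw [if_neg (by simp [h2]), if_neg (by simp), if_pos ⟨rfl, h2⟩,
        expMode_expMode_neg_one (gammaForm ℓ r) gammaForm_isSymm hε.add_left
        hε.add_right (by rw [hform]; simp [hkl.symm, h2, hkl'.symm]) (by
          rw [hε.rootVec_rootVec, hε.rootVec_rootVec, epsSign_self, epsSign_swap hkl,
            epsSign_swap h2, epsSign_swap hkl']
          generalize epsSign k l = a
          generalize epsSign l k' = b
          generalize epsSign k' k = c
          revert a b c
          decide), add_sub_cancel_right, smul_smul,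
        simplePole_apply ε (show rootVec k l p + rootVec k' k q = rootVec k' l (p + q) by
          rw [rootVec, rootVec, rootVec, dotTheta_add]; abel), hε.rootVec_rootVec, epsSign_self,
        epsSign_swap hkl, ← Int.cast_mul, ← Units.val_mul, eMode_eq, LinearMap.neg_apply,
        LinearMap.smul_apply]
      have : ∀ u w y : ℤˣ, -u * w * (w * -1 * (y * -u)) = -y := by decide
      rw [this, Units.val_neg, Int.cast_neg]
      module
  · by_cases h2 : l = k'
    · subst h2
      rw [if_neg (by simp [h1]), if_pos ⟨h1, rfl⟩,
        expMode_expMode_neg_one (gammaForm ℓ r) gammaForm_isSymm hε.add_left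
        hε.add_right (by rw [hform]; simp [hkl, h1, hkl']) (by
          rw [hε.rootVec_rootVec, hε.rootVec_rootVec, epsSign_self, epsSign_swap hkl,
            epsSign_swap h1, epsSign_swap hkl']
          generalize epsSign k l = a
          generalize epsSign l l' = b
          generalize epsSign k l' = c
          revert a b c
          decide), add_sub_cancel_right, smul_smul,
        simplePole_apply ε (show rootVec k l p + rootVec l l' q = rootVec k l' (p + q) by
          rw [rootVec, rootVec, rootVec, dotTheta_add]; abel), hε.rootVec_rootVec, epsSign_self,
        epsSign_swap hkl, epsSign_swap hkl', ← Int.cast_mul, ← Units.val_mul,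
        eMode_eq, LinearMap.smul_apply, epsSign_swap h1]
      have : ∀ u w y : ℤˣ, -u * -w * (u * y * (-1 * w)) = -y := by decide
      rw [this]
    · rw [if_neg (by simp [h1]), if_neg (by simp [h2]), if_neg (by simp [h1])]
      have hcomm : expMode (gammaForm ℓ r) ε (rootVec k l p) (-m - 1)
          (expMode (gammaForm ℓ r) ε (rootVec k' l' q) (-n - 1) v) =
          expMode (gammaForm ℓ r) ε (rootVec k' l' q) (-n - 1)
          (expMode (gammaForm ℓ r) ε (rootVec k l p) (-m - 1) v) := by
        by_cases h3 : k = k'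
        · subst h3
          by_cases h4 : l = l'
          · subst h4
            exact expMode_expMode_two (gammaForm ℓ r) gammaForm_isSymm hε.add_left hε.add_right
              (by rw [hform]; simp [h1, h2]) (by rw [hε.rootVec_rootVec, hε.rootVec_rootVec]) _ _ _
          · refine expMode_expMode_one (gammaForm ℓ r) gammaForm_isSymm hε.add_left hε.add_right
              (by rw [hform]; simp [h1, h2, h4]) ?_ _ _ _
            rw [hε.rootVec_rootVec, hε.rootVec_rootVec, epsSign_self, epsSign_swap hkl,
              epsSign_swap h1, epsSign_swap h4]
            generalize epsSign k l = a
            generalize epsSign l l' = b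
            generalize epsSign k l' = c
            revert a b c
            decide
        · by_cases h4 : l = l'
          · subst h4
            refine expMode_expMode_one (gammaForm ℓ r) gammaForm_isSymm hε.add_left hε.add_right
              (by rw [hform]; simp [h1, h2, h3]) ?_ _ _ _
            rw [hε.rootVec_rootVec, hε.rootVec_rootVec, epsSign_self, epsSign_swap h3,
              epsSign_swap h1, epsSign_swap h2]
            generalize epsSign k k' = a
            generalize epsSign k l = b
            generalize epsSign l k' = c
            revert a b c
            decide
          · refine expMode_expMode_zero (gammaForm ℓ r) gammaForm_isSymm hε.add_left hε.add_right
              (by rw [hform]; simp [h1, h2, h3, h4]) ?_ _ _ _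
            rw [hε.rootVec_rootVec, hε.rootVec_rootVec, epsSign_swap h3,
              epsSign_swap h1, epsSign_swap h2, epsSign_swap h4]
            generalize epsSign k k' = a
            generalize epsSign k l' = b
            generalize epsSign l k' = c
            generalize epsSign l l' = d
            revert a b c d
            decide
      rw [hcomm, sub_self, smul_zero]
      rfl

theorem lie_kappaMode (hε : IsToroidalSign ε) (ν : Fin (r + 1)) (p : Fin r → ℤ) (m : ℤ)
    {a : Module.End ℂ (StateSpace (GammaLattice ℓ r))} (ha : a ∈ toroidalElements ε) :
    ⁅kappaMode ε ν p m, a⁆ = 0 := by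
  -- Every element of the list is a multiple of a mode of `E^β(z)` or of `:h(z) E^{q·ϑ}(z):` with
  -- `β` and `h` orthogonal to all the `ϑ_ν`.
  have hβ : ∀ β : GammaLattice ℓ r, (∀ p, gammaForm ℓ r (dotTheta p) β = 0) →
      (∀ p, ε β (dotTheta p) = ε (dotTheta p) β) → ∀ n v,
      kappaMode ε ν p m (expMode (gammaForm ℓ r) ε β n v) =
        expMode (gammaForm ℓ r) ε β n (kappaMode ε ν p m v) := by
    intro β h1 h2 n v
    refine Fin.cases ?_ (fun ν => ?_) ν
    · rw [kappaMode_zero_eq]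
      exact expMode_expMode_zero _ gammaForm_isSymm hε.add_left hε.add_right (h1 p) (h2 p) _ _ _
    · rw [kappaMode_succ_eq, cartanMode_eq, currentMode_expMode_zero _ gammaForm_isSymm hε.add_left
        hε.add_right (h1 p) (h2 p), baseChange_toCartan, smallTheta_eq_dotTheta, h1]
      simp
  have hh : ∀ (h : GammaLattice ℓ r) (q : Fin r → ℤ), (∀ p, gammaForm ℓ r (dotTheta p) h = 0) →
      ∀ n v, kappaMode ε ν p m (cartanMode ε h q n v) =
        cartanMode ε h q n (kappaMode ε ν p m v) := by
    intro h q h1 n v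
    have h1' : ∀ p, gammaForm ℓ r h (dotTheta p) = 0 := fun p =>
      (gammaForm_isSymm.eq _ _).trans (h1 p)
    have hs : ∀ p q : Fin r → ℤ, ε (dotTheta q) (dotTheta p) = ε (dotTheta p) (dotTheta q) :=
      fun p q => by rw [hε.dotTheta_dotTheta, hε.dotTheta_dotTheta]
    rw [cartanMode_eq]
    refine Fin.cases ?_ (fun ν => ?_) ν
    · rw [kappaMode_zero_eq, currentMode_expMode_zero _ gammaForm_isSymm hε.add_left
        hε.add_right (gammaForm_dotTheta_dotTheta q p) (hs q p), baseChange_toCartan, h1']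
      simp
    · rw [kappaMode_succ_eq, cartanMode_eq, smallTheta_eq_dotTheta,
        currentMode_currentMode_zero _ gammaForm_isSymm hε.add_left
        hε.add_right (gammaForm_dotTheta_dotTheta p q) (hs p q)
        (by rw [baseChange_toCartan, gammaForm_dotTheta_dotTheta, Int.cast_zero])
        (by rw [baseChange_toCartan, h1', Int.cast_zero]), baseChange_toCartan, h1]
      simp
  have key : ∀ v, kappaMode ε ν p m (a v) = a (kappaMode ε ν p m v) := by
    intro v
    rcases ha with (⟨i, q, n, rfl⟩ | ⟨k, l, q, n, -, rfl⟩) | ⟨μ, q, n, rfl⟩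
    · exact hh _ q (fun p => by rw [map_sub, gammaForm_dotTheta_vVec, gammaForm_dotTheta_vVec,
        sub_zero]) n v
    · rw [eMode_eq, LinearMap.smul_apply, LinearMap.smul_apply, map_smul,
        hβ _ (fun p => gammaForm_dotTheta_rootVec k l p q) fun p => by
          rw [hε.dotTheta_rootVec, hε.rootVec_dotTheta]]
    · refine Fin.cases ?_ (fun μ => ?_) μ
      · rw [kappaMode_zero_eq ε q]
        exact hβ _ (fun p => gammaForm_dotTheta_dotTheta p q) (fun p => by
          rw [hε.dotTheta_dotTheta, hε.dotTheta_dotTheta]) _ v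
      · exact hh _ q (fun p => by rw [smallTheta_eq_dotTheta, gammaForm_dotTheta_dotTheta]) n v
  refine LinearMap.ext fun v => ?_
  change kappaMode ε ν p m (a v) - a (kappaMode ε ν p m v) = 0
  rw [key, sub_self]

end Relations

end LatticeVA

end

open LatticeVA in
theorem mainTheorem3 (ℓ r : ℕ) (ε : GammaLattice ℓ r → GammaLattice ℓ r → ℤˣ)
    (hε : IsToroidalSign ε) :
    (∀ (i j : Fin (ℓ - 1)) (p q : Fin r → ℤ) (m n : ℤ),
      ⁅hMode ε i p m, hMode ε j q n⁆ =
        (2 * kron i j - kron i (j + 1) - kron (i + 1) j) •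
          ((m : ℂ) • kappaMode ε 0 (p + q) (m + n) +
            ∑ ν : Fin r, (p ν : ℂ) • kappaMode ε ν.succ (p + q) (m + n))) ∧
    (∀ (i : Fin (ℓ - 1)) (k l : Fin ℓ) (p q : Fin r → ℤ) (m n : ℤ), k ≠ l →
      ⁅hMode ε i p m, eMode ε k l q n⁆ =
        (kron i k + kron (i + 1) l - kron i l - kron (i + 1) k) •
          eMode ε k l (p + q) (m + n)) ∧
    (∀ (k l k' l' : Fin ℓ) (p q : Fin r → ℤ) (m n : ℤ), k ≠ l → k' ≠ l' →
      ⁅eMode ε k l p m, eMode ε k' l' q n⁆ =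
        if k = l' ∧ l = k' then
          cartanMode ε (vVec k - vVec l) (p + q) (m + n) +
            (m : ℂ) • kappaMode ε 0 (p + q) (m + n) +
            ∑ ν : Fin r, (p ν : ℂ) • kappaMode ε ν.succ (p + q) (m + n)
        else if k ≠ l' ∧ l = k' then eMode ε k l' (p + q) (m + n)
        else if k = l' ∧ l ≠ k' then -eMode ε k' l (p + q) (m + n)
        else 0) ∧
    (∀ (ν : Fin (r + 1)) (p : Fin r → ℤ) (m : ℤ), ∀ a ∈ toroidalElements ε,
      ⁅kappaMode ε ν p m, a⁆ = 0) := by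
  exact ⟨lie_hMode_hMode hε, fun i k l p q m n _ => lie_hMode_eMode hε i k l p q m n,
    lie_eMode_eMode hε, fun ν p m _ ha => lie_kappaMode hε ν p m ha⟩
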